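/- Let $L^2(0,\infty)=L^2((0,\infty);dx)$, let $\mathcal F$ be the Fourier cosine transform on it, $(\mathcal F f)(y)=\int_0^\infty 2\cos(2\pi xy)f(x)\,dx$, and let $\widehat f(s)=\int_0^\infty f(x)x^{-s}\,dx$ be the Mellin transform, an element of $L^2(\tfrac12+i\mathbb R;\tfrac{|ds|}{2\pi})$ (both transforms are understood in the $L^2$ sense). Let $L\subset L^2(\tfrac12+i\mathbb R;\tfrac{|ds|}{2\pi})$ be the subspace, with the induced scalar product, of all $\widehat f$ where $f\in L^2(0,\infty)$ is such that both $f$ and $\mathcal F f$ are almost everywhere equal to a constant on $(0,1)$. Every element of $L$ is the restriction to the critical line of a meromorphic function $g$ on $\mathbb C$, holomorphic on $\mathbb C\setminus\{1\}$, with which it is identified. For a non-trivial zero $\rho$ of the Riemann zeta function (that is, $\zeta(\rho)=0$, $0<\Re\rho<1$) let $m_\rho$ be its multiplicity. Then: 1. If $g\in L$ and $g(s)/\zeta(s)$ is entire (that is, there is an entire function $h$ with $g(s)=h(s)\zeta(s)$ for all $s\neq1$), then $g=0$. 2. The evaluators at the zeta zeros are complete in $L$: for every non-trivial zero $\rho$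 and every $0\le j<m_\rho$ there is a vector of $L$ that represents the linear form $g\mapsto g^{(j)}(\rho)$ on $L$ through the scalar product, and the closed linear span of these vectors, over all such $(\rho,j)$, is $L$. 3. The functions $g\in L$ that vanish at all but finitely many of the non-trivial zeros $\rho$ to order at least $m_\rho$ are exactly the finite linear combinations of the functions $\dfrac{\zeta(s)}{(s-\rho)^k}$, where $\rho$ is a non-trivial zero of $\zeta$ and $1\le k\le m_\rho$. -/

import Mathlib

open MeasureTheory Topology

noncomputable section

namespace BurnolZeta

/-- The Hilbert space `L²((0,∞), dx)`. -/
abbrev HalfLineL2 : Type := Lp ℂ 2 (volume.restrict (Set.Ioi (0 : ℝ)))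

/-- The Hilbert space `L²(1/2 + iℝ, |ds|/2π)`. The critical line is parametrized by
`τ ↦ s = 1/2 + 2πiτ`, so that the measure `|ds|/2π` is the Lebesgue measure `dτ`. -/
abbrev CriticalLineL2 : Type := Lp ℂ 2 (volume : Measure ℝ)

/-- The point of the critical line with parameter `τ`. -/
def criticalPoint (τ : ℝ) : ℂ := 1 / 2 + 2 * Real.pi * τ * Complex.I

theorem quasi_abs :
    Measure.QuasiMeasurePreserving (fun x : ℝ => |x|) volume
      (volume.restrict (Set.Ioi (0 : ℝ))) := by
  refine ⟨continuous_abs.measurable, Measure.AbsolutelyContinuous.mk fun A hA h => ?_⟩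
  rw [Measure.restrict_apply hA] at h
  rw [Measure.map_apply continuous_abs.measurable hA]
  have hneg : volume (Neg.neg ⁻¹' (A ∩ Set.Ioi (0 : ℝ))) = 0 := by
    rw [Measure.measure_preimage_neg]; exact h
  refine measure_mono_null (t := {0} ∪ (A ∩ Set.Ioi 0) ∪ Neg.neg ⁻¹' (A ∩ Set.Ioi (0 : ℝ))) ?_ ?_
  · intro x hx
    rcases lt_trichotomy x 0 with h0 | h0 | h0
    · right
      simp only [Set.mem_preimage, abs_of_neg h0] at hx
      exact ⟨hx, by simpa using h0⟩
    · left; left; exact h0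
    · left; right
      simp only [Set.mem_preimage, abs_of_pos h0] at hx
      exact ⟨hx, h0⟩
  · exact measure_union_null (measure_union_null (by simp) h) hneg

theorem quasi_exp :
    Measure.QuasiMeasurePreserving Real.exp volume (volume.restrict (Set.Ioi (0 : ℝ))) := by
  refine ⟨Real.measurable_exp, Measure.AbsolutelyContinuous.mk fun A hA h => ?_⟩
  rw [Measure.restrict_apply hA] at h
  rw [Measure.map_apply Real.measurable_exp hA]
  have h2 : volume (Real.log '' (A ∩ Set.Ioi (0 : ℝ))) = 0 := by
    refine addHaar_image_eq_zero_of_differentiableOn_of_addHaar_eq_zero volume ?_ h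
    intro x hx
    exact (Real.differentiableAt_log (ne_of_gt hx.2)).differentiableWithinAt
  refine measure_mono_null ?_ h2
  intro u hu
  exact ⟨Real.exp u, ⟨hu, Real.exp_pos u⟩, Real.log_exp u⟩

theorem memLp_even (f : HalfLineL2) : MemLp (fun x : ℝ => f |x|) 2 volume := by
  have hm : AEStronglyMeasurable (fun x : ℝ => f |x|) volume :=
    (Lp.aestronglyMeasurable f).comp_quasiMeasurePreserving quasi_abs
  rw [memLp_two_iff_integrable_sq_norm hm]
  have hf : IntegrableOn (fun x : ℝ => ‖f x‖ ^ 2) (Set.Ioi 0) :=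
    (memLp_two_iff_integrable_sq_norm (Lp.aestronglyMeasurable f)).1 (Lp.memLp f)
  have h1 : IntegrableOn (fun x : ℝ => ‖f |x|‖ ^ 2) (Set.Ioi 0) :=
    hf.congr_fun (fun x hx => by simp [abs_of_pos (Set.mem_Ioi.1 hx)]) measurableSet_Ioi
  have h2 : IntegrableOn (fun x : ℝ => ‖f |x|‖ ^ 2) (Set.Iic 0) := by
    rw [integrableOn_Iic_iff_integrableOn_Iio]
    have := h1.comp_neg
    simpa using this
  rw [← integrableOn_univ, ← Set.Iic_union_Ioi (a := (0 : ℝ))]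
  exact h2.union h1

theorem memLp_exp (f : HalfLineL2) :
    MemLp (fun u : ℝ => (Real.exp (u / 2) : ℂ) * f (Real.exp u)) 2 volume := by
  have hm : AEStronglyMeasurable (fun u : ℝ => (Real.exp (u / 2) : ℂ) * f (Real.exp u)) volume := by
    refine AEStronglyMeasurable.mul ?_
      ((Lp.aestronglyMeasurable f).comp_quasiMeasurePreserving quasi_exp)
    exact Continuous.aestronglyMeasurable (by fun_prop)
  rw [memLp_two_iff_integrable_sq_norm hm]
  have hf : IntegrableOn (fun x : ℝ => ‖f x‖ ^ 2) (Set.Ioi 0) :=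
    (memLp_two_iff_integrable_sq_norm (Lp.aestronglyMeasurable f)).1 (Lp.memLp f)
  have himg : Real.exp '' Set.univ = Set.Ioi 0 := by rw [Set.image_univ, Real.range_exp]
  have key := integrableOn_image_iff_integrableOn_abs_deriv_smul MeasurableSet.univ
    (fun x _ => (Real.hasDerivAt_exp x).hasDerivWithinAt) Real.exp_injective.injOn
    (fun x : ℝ => ‖f x‖ ^ 2)
  rw [himg, integrableOn_univ] at key
  replace hf := key.1 hf
  refine hf.congr (Filter.Eventually.of_forall fun u => ?_)
  simp only [norm_mul, Complex.norm_real, Real.norm_eq_abs, Real.abs_exp, mul_pow, smul_eq_mul]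
  rw [← Real.exp_nat_mul]
  congr 2
  push_cast
  ring

/-- The even extension `x ↦ f(|x|)` of `f ∈ L²(0,∞)` to the real line. -/
def evenExtension : HalfLineL2 →ₗ[ℂ] Lp ℂ 2 (volume : Measure ℝ) where
  toFun f := (memLp_even f).toLp
  map_add' f g := by
    rw [← MemLp.toLp_add, MemLp.toLp_eq_toLp_iff]
    exact quasi_abs.ae (Lp.coeFn_add f g)
  map_smul' c f := by
    rw [RingHom.id_apply, ← MemLp.toLp_const_smul, MemLp.toLp_eq_toLp_iff]
    exact quasi_abs.ae (Lp.coeFn_smul c f)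

/-- The Fourier cosine transform `(𝓕 f)(y) = ∫_0^∞ 2 cos(2πxy) f(x) dx` on `L²(0,∞)`, that is, the
restriction to `(0,∞)` of the `L²` Fourier transform (kernel `e^{-2πixy}`) of the even extension. -/
def cosineTransform : HalfLineL2 →ₗ[ℂ] HalfLineL2 :=
  (LpToLpRestrictCLM ℝ ℂ ℂ volume 2 (Set.Ioi (0 : ℝ))).toLinearMap ∘ₗ
    (Lp.fourierTransformₗᵢ ℝ ℂ).toLinearEquiv.toLinearMap ∘ₗ evenExtension

/-- The map `f ↦ (u ↦ e^{u/2} f(e^u))` from `L²(0,∞)` to `L²(ℝ)`. -/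
def logSubstitution : HalfLineL2 →ₗ[ℂ] Lp ℂ 2 (volume : Measure ℝ) where
  toFun f := (memLp_exp f).toLp
  map_add' f g := by
    rw [← MemLp.toLp_add, MemLp.toLp_eq_toLp_iff]
    filter_upwards [quasi_exp.ae (Lp.coeFn_add f g)] with u hu
    simp only [Pi.add_apply] at hu ⊢
    rw [hu, mul_add]
  map_smul' c f := by
    rw [RingHom.id_apply, ← MemLp.toLp_const_smul, MemLp.toLp_eq_toLp_iff]
    filter_upwards [quasi_exp.ae (Lp.coeFn_smul c f)] with u hu
    simp only [Pi.smul_apply, smul_eq_mul] at hu ⊢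
    rw [hu]
    ring

/-- The Mellin transform `f̂(s) = ∫_0^∞ f(x) x^{-s} dx` on the critical line, in the sense of `L²`:
for `s = 1/2 + 2πiτ` and `x = e^u` it is the Fourier integral `∫ e^{u/2} f(e^u) e^{-2πiuτ} du`. -/
def mellinTransform : HalfLineL2 →ₗ[ℂ] CriticalLineL2 :=
  (Lp.fourierTransformₗᵢ ℝ ℂ).toLinearEquiv.toLinearMap ∘ₗ logSubstitution

/-- The functions in `L²(0,∞)` that are (almost everywhere) constant on `(0,1)`. -/
def constantNearZero : Submodule ℂ HalfLineL2 where
  carrier := {f | ∃ c : ℂ, ∀ᵐ x ∂(volume.restrict (Set.Ioo (0 : ℝ) 1)), f x = c}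
  zero_mem' := by
    refine ⟨0, ?_⟩
    exact ae_restrict_of_ae_restrict_of_subset (fun x hx => hx.1) (Lp.coeFn_zero ℂ 2 _)
  add_mem' := by
    rintro f g ⟨a, ha⟩ ⟨b, hb⟩
    refine ⟨a + b, ?_⟩
    filter_upwards [ha, hb, ae_restrict_of_ae_restrict_of_subset
      (s := Set.Ioo (0 : ℝ) 1) (fun x hx => hx.1) (Lp.coeFn_add f g)] with x h1 h2 h3
    rw [h3, Pi.add_apply, h1, h2]
  smul_mem' := by
    rintro c f ⟨a, ha⟩
    refine ⟨c * a, ?_⟩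
    filter_upwards [ha, ae_restrict_of_ae_restrict_of_subset
      (s := Set.Ioo (0 : ℝ) 1) (fun x hx => hx.1) (Lp.coeFn_smul c f)] with x h1 h3
    rw [h3, Pi.smul_apply, h1, smul_eq_mul]

/-- The space `L ⊆ L²(1/2 + iℝ, |ds|/2π)` of the Mellin transforms of those `f ∈ L²(0,∞)` for which
both `f` and its cosine transform are constant on `(0,1)`. -/
def spaceL : Submodule ℂ CriticalLineL2 :=
  (constantNearZero ⊓ constantNearZero.comap cosineTransform).map mellinTransform

/-- `g` is the meromorphic function on `ℂ`, with at most a pole at `1`, whose restriction to the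
critical line is `G`. The values of `g` on `ℂ ∖ {1}` are determined by `G`;
the value at `1` is not constrained. -/
def IsMeromorphicExtension (G : CriticalLineL2) (g : ℂ → ℂ) : Prop :=
  DifferentiableOn ℂ g {1}ᶜ ∧ MeromorphicAt g 1 ∧ ∀ᵐ τ : ℝ, G τ = g (criticalPoint τ)

/-- The non-trivial zeros of the Riemann zeta function. -/
def nontrivialZeros : Set ℂ := {ρ | riemannZeta ρ = 0 ∧ 0 < ρ.re ∧ ρ.re < 1}

/-- The index set of the couples `(ρ, k)`, with `ρ` a non-trivial zero and `1 ≤ k ≤ m_ρ`, where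
`m_ρ` is the multiplicity of `ρ`. -/
def zeroIndex : Set (ℂ × ℕ) :=
  {p | p.1 ∈ nontrivialZeros ∧ 1 ≤ p.2 ∧ p.2 ≤ analyticOrderNatAt riemannZeta p.1}

/-- The function `s ↦ ζ(s) / (s - ρ)^k`, with the singularity at `ρ` removed
(for `(ρ, k)` in the index set). -/
def zetaQuotient (ρ : ℂ) (k : ℕ) : ℂ → ℂ :=
  Function.update (fun s => riemannZeta s / (s - ρ) ^ k) ρ
    (Filter.limUnder (𝓝[≠] ρ) fun s => riemannZeta s / (s - ρ) ^ k)

end BurnolZeta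

end

open BurnolZeta

/-!
Every `f` in the domain of `L` and its cosine transform have Gaussian transforms
`k(t) = 2 ∫_0^∞ f(x) e^{-π t² x²} dx` related by a theta-like functional equation. Where `f` equals
the constant `a` on `(0, 1)`, `k(t) - a/t` decays exponentially, so Riemann's argument applies:
`Γ_ℝ(s) f̂(s)`, the Mellin transform of `k`, continues to the plane with at most simple poles at `0`
and `1`. This gives the extension `CosinePair.ext` of the elements of `L`, the entire function
`CosinePair.completed = s (1 - s) Γ_ℝ(s) f̂(s)`, and bounds by the `L²` norms of `f` and its cosine
transform, hence bounded evaluators (`exists_evaluator`). That the extension takes the right values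
on the critical line is seen by truncating `f` smoothly at infinity
(`CosinePair.mellinTransform_ae_eq_ext`).

The heart is `eq_zero_of_analyticOrderAt_le`: a function of `L` that vanishes at each non-trivial
zero to at least its multiplicity is `0`. Its completion is `h(s) ξ(s)` with `h` entire and
`ξ(s) = s (1 - s) Γ_ℝ(s) ζ(s)`. To the right of the critical strip `h = f̂/ζ` is `O((re s)^{-1/2})`,
because `f̂(s) = a/(1 - s) + ∫_1^∞ f(x) x^{-s} dx` there and `f` is square integrable; by the
functional equation the same holds on the left. In between, a Borel-Carathéodory type bound for
quotients of functions of controlled growth makes the Phragmén-Lindelöf principle applicable, so `h`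
is bounded, constant by Liouville's theorem, and `0` by its decay (`eq_zero_of_mul_xi`). The first
assertion is a special case, and the second follows since `L` is complete and a vector orthogonal to
all the evaluators vanishes with full multiplicities.

For the third, `ζ(s)/s` is the Mellin transform of `-{x}/x`, and the average
`x ↦ ∫_0^1 f(xu) u^{-ρ} du` divides the Mellin transform by `s - ρ` while it preserves constancy on
`(0, 1)` and, if the transform vanishes at `ρ`, the decay at infinity. This produces functions with
transforms `ζ(s)/(s - ρ)^k`; the functional equation of `ζ`, together with the totality of the
Gaussians in `L²(0,∞)`, shows that the cosine transform exchanges `ρ` and `1 - ρ` up to a sign, so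
these functions are in `L` (`exists_mem_spaceL_zetaQuotient`). Conversely, subtracting multiples of
them raises the order of a function at the exceptional zeros up to the multiplicity; what remains is
`0` by the uniqueness above.
-/

open BurnolZeta

/-! ### Growth of the quotient of two bounded entire functions -/

namespace BurnolZeta

open Complex Metric

/-- A holomorphic function without zeros on a disc has a holomorphic logarithm there. -/
theorem exists_log_of_ne_zero_on_ball {G : ℂ → ℂ} {ρ : ℝ} (hρ : 0 < ρ)
    (hG : DifferentiableOn ℂ G (ball 0 ρ)) (h0 : ∀ z ∈ ball (0 : ℂ) ρ, G z ≠ 0) :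
    ∃ l : ℂ → ℂ, DifferentiableOn ℂ l (ball 0 ρ) ∧ ∀ z ∈ ball (0 : ℂ) ρ, exp (l z) = G z := by
  have hd : DifferentiableOn ℂ (fun z => deriv G z / G z) (ball 0 ρ) :=
    (hG.deriv isOpen_ball).div hG h0
  obtain ⟨l, hl⟩ := hd.isExactOn_ball
  have h00 : (0 : ℂ) ∈ ball (0 : ℂ) ρ := mem_ball_self hρ
  have hld : DifferentiableOn ℂ l (ball 0 ρ) := fun z hz =>
    (hl z hz).differentiableAt.differentiableWithinAt
  have hconst : ∀ z ∈ ball (0 : ℂ) ρ, G z * exp (-l z) = G 0 * exp (-l 0) := by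
    intro z hz
    refine (convex_ball (0 : ℂ) ρ).is_const_of_fderivWithin_eq_zero (𝕜 := ℂ)
      (f := fun z => G z * exp (-l z)) ?_ ?_ hz h00
    · exact hG.mul (hld.neg.cexp)
    · intro w hw
      have hGw := (hG.differentiableAt (isOpen_ball.mem_nhds hw)).hasDerivAt
      have h1 := hGw.mul ((hl w hw).neg.cexp)
      have h2 : HasDerivAt (fun z => G z * exp (-l z)) 0 w := by
        convert! h1 using 1
        have := h0 w hw
        simp only [Pi.neg_apply]
        field_simp
        ring
      rw [fderivWithin_of_isOpen isOpen_ball hw, h2.hasFDerivAt.fderiv]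
      simp
  refine ⟨fun z => l z + (log (G 0) - l 0), hld.add_const _, fun z hz => ?_⟩
  have h1 := hconst z hz
  rw [exp_add, exp_sub, exp_log (h0 0 h00)]
  rw [exp_neg, exp_neg] at h1
  field_simp at h1
  field_simp
  rw [← h1, mul_comm]

/-- Harnack-type lower bound: a bounded holomorphic function without zeros on a disc is bounded
below on a smaller disc in terms of its value at the centre. -/
theorem norm_lower_bound_of_ne_zero {G : ℂ → ℂ} {r ρ M : ℝ} (hr : 0 ≤ r) (hrρ : r < ρ)
    (hG : DifferentiableOn ℂ G (ball 0 ρ)) (h0 : ∀ z ∈ ball (0 : ℂ) ρ, G z ≠ 0)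
    (hM : ∀ z ∈ ball (0 : ℂ) ρ, ‖G z‖ ≤ M) (hM0 : ‖G 0‖ < M) {z : ℂ} (hz : ‖z‖ ≤ r) :
    ‖G 0‖ * Real.exp (-(2 * r / (ρ - r)) * Real.log (M / ‖G 0‖)) ≤ ‖G z‖ := by
  have hρ : 0 < ρ := hr.trans_lt hrρ
  obtain ⟨l, hl, hlG⟩ := exists_log_of_ne_zero_on_ball hρ hG h0
  have h00 : (0 : ℂ) ∈ ball (0 : ℂ) ρ := mem_ball_self hρ
  have hzρ : z ∈ ball (0 : ℂ) ρ := by simpa using hz.trans_lt hrρ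
  have hG0 : 0 < ‖G 0‖ := norm_pos_iff.2 (h0 0 h00)
  have hre : ∀ w ∈ ball (0 : ℂ) ρ, (l w).re = Real.log ‖G w‖ := fun w hw => by
    rw [← hlG w hw, norm_exp, Real.log_exp]
  set m := Real.log (M / ‖G 0‖) with hm
  have hm0 : 0 < m := Real.log_pos (by rwa [one_lt_div hG0])
  have hmlog : m = Real.log M - Real.log ‖G 0‖ :=
    Real.log_div (hG0.trans hM0).ne' hG0.ne'
  have key := borelCaratheodory_zero (f := fun w => l w - l 0) (M := m) (R := ρ) (z := z) hm0
    (hl.sub_const _) (fun w hw => by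
      simp only [Set.mem_ofPred_eq, sub_re]
      rw [hre w hw, hre 0 h00, hmlog]
      have := Real.log_le_log (norm_pos_iff.2 (h0 w hw)) (hM w hw)
      linarith) hρ hzρ (by simp)
  have hb : 2 * m * ‖z‖ / (ρ - ‖z‖) ≤ 2 * r / (ρ - r) * m := by
    have : 2 * m * ‖z‖ / (ρ - ‖z‖) ≤ 2 * m * r / (ρ - r) := by
      gcongr
    exact this.trans_eq (by ring)
  have h3 : (l 0).re - 2 * r / (ρ - r) * m ≤ (l z).re := by
    have := (abs_le.1 ((abs_re_le_norm _).trans (key.trans hb))).1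
    simp only [sub_re] at this
    linarith
  rw [← hlG z hzρ, norm_exp]
  calc ‖G 0‖ * Real.exp (-(2 * r / (ρ - r)) * m)
      = Real.exp ((l 0).re - 2 * r / (ρ - r) * m) := by
        rw [hre 0 h00, sub_eq_add_neg (Real.log _), Real.exp_add, Real.exp_log hG0, neg_mul]
    _ ≤ _ := Real.exp_le_exp.2 h3

/-- Maximum principle on a closed disc. -/
theorem norm_le_of_norm_le_on_sphere {G : ℂ → ℂ} {R M : ℝ} (hR : 0 < R) (hG : Differentiable ℂ G)
    (hM : ∀ z : ℂ, ‖z‖ = R → ‖G z‖ ≤ M) {z : ℂ} (hz : ‖z‖ ≤ R) : ‖G z‖ ≤ M := by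
  refine Complex.norm_le_of_forall_mem_frontier_norm_le (U := ball 0 R) isBounded_ball
    hG.diffContOnCl (fun w hw => ?_) ?_
  · rw [frontier_ball _ hR.ne'] at hw
    exact hM w (by simpa using hw)
  · rw [closure_ball _ hR.ne']
    simpa using hz

/-- Bound for an entire quotient `h = F / G` on a disc, in terms of bounds for `F = h G` and `G` on
a larger circle and of `G` at the centre only. -/
theorem norm_quotient_le {h : ℂ → ℂ} (hh : Differentiable ℂ h) {r ρ R M : ℝ} (hr : 0 ≤ r)
    (hrρ : r < ρ) (hρR : ρ < R) (G : ℂ → ℂ) (hG : Differentiable ℂ G)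
    (hG0 : G 0 ≠ 0) (hGM0 : ‖G 0‖ < M) (hGM : ∀ z : ℂ, ‖z‖ = R → ‖G z‖ ≤ M)
    (hF : ∀ z : ℂ, ‖z‖ = R → ‖h z * G z‖ ≤ M) {z : ℂ} (hz : ‖z‖ ≤ r) :
    ‖h z‖ ≤ Real.exp ((1 + 2 * r / (ρ - r)) * Real.log (M / ‖G 0‖)) := by
  have hρ : 0 < ρ := hr.trans_lt hrρ
  have hR : 0 < R := hρ.trans hρR
  have hq : 1 < R / ρ := by rwa [one_lt_div hρ]
  have hc : 0 ≤ 2 * r / (ρ - r) := div_nonneg (by positivity) (by linarith)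
  -- The zeros of `G` in the disc of radius `ρ` are removed one at a time by Blaschke factors; each
  -- step multiplies `|G 0|` by at least `R / ρ`, so there are finitely many steps.
  suffices H : ∀ n : ℕ, ∀ (G : ℂ → ℂ), Differentiable ℂ G → G 0 ≠ 0 → ‖G 0‖ < M →
      (∀ z : ℂ, ‖z‖ = R → ‖G z‖ ≤ M) → (∀ z : ℂ, ‖z‖ = R → ‖h z * G z‖ ≤ M) →
      M < ‖G 0‖ * (R / ρ) ^ n →
      ‖h z‖ ≤ Real.exp ((1 + 2 * r / (ρ - r)) * Real.log (M / ‖G 0‖)) by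
    have hG0' : 0 < ‖G 0‖ := norm_pos_iff.2 hG0
    obtain ⟨n, hn⟩ := pow_unbounded_of_one_lt (M / ‖G 0‖) hq
    refine H n G hG hG0 hGM0 hGM hF ?_
    rwa [div_lt_iff₀' hG0'] at hn
  intro n
  induction n with
  | zero =>
    intro G _ _ h1 _ _ h2
    simp only [pow_zero, mul_one] at h2
    exact absurd h1 h2.not_gt
  | succ n ih =>
    intro G hG hG0 hGM0 hGM hF hn
    have hG0' : 0 < ‖G 0‖ := norm_pos_iff.2 hG0
    have hMpos : 0 < M := hG0'.trans hGM0
    by_cases hzero : ∃ a ∈ ball (0 : ℂ) ρ, G a = 0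
    · obtain ⟨a, ha, hGa⟩ := hzero
      have haρ : ‖a‖ < ρ := by simpa using ha
      have ha0 : 0 < ‖a‖ := norm_pos_iff.2 (fun h => hG0 (h ▸ hGa))
      set G' : ℂ → ℂ := fun w => dslope G a w * ((R ^ 2 - starRingEnd ℂ a * w) / R) with hG'
      have hds : Differentiable ℂ (dslope G a) := by
        rw [← differentiableOn_univ] at hG ⊢
        exact (differentiableOn_dslope Filter.univ_mem).2 hG
      have hG'd : Differentiable ℂ G' := by
        refine hds.mul (Differentiable.div_const ?_ _)
        fun_prop
      have hfac : ∀ w, (w - a) * dslope G a w = G w := fun w => by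
        have := sub_smul_dslope G a w
        simpa [hGa] using this
      have hsphere : ∀ w : ℂ, ‖w‖ = R → ‖G' w‖ = ‖G w‖ := by
        intro w hw
        have h1 : ((R : ℂ) ^ 2 - starRingEnd ℂ a * w) = starRingEnd ℂ (w - a) * w := by
          have : (R : ℂ) ^ 2 = starRingEnd ℂ w * w := by
            rw [← normSq_eq_conj_mul_self, normSq_eq_norm_sq, hw]; push_cast; rfl
          rw [this, map_sub]; ring
        have h2 : ‖((R : ℂ) ^ 2 - starRingEnd ℂ a * w) / R‖ = ‖w - a‖ := by
          rw [h1, norm_div, norm_mul, norm_conj, hw, norm_real, Real.norm_of_nonneg hR.le,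
            mul_div_assoc, div_self hR.ne', mul_one]
        rw [hG', ← hfac w]
        simp only [norm_mul]
        rw [h2, mul_comm]
      have hG'0 : ‖G' 0‖ = ‖G 0‖ * (R / ‖a‖) := by
        have h1 := hfac 0
        have h2 : ‖G 0‖ = ‖a‖ * ‖dslope G a 0‖ := by rw [← h1]; simp
        rw [h2, hG']
        simp only [mul_zero, sub_zero, norm_mul, norm_div, norm_pow, norm_real,
          Real.norm_of_nonneg hR.le]
        field_simp
      have hgrow : ‖G 0‖ * (R / ρ) ≤ ‖G' 0‖ := by
        rw [hG'0]; gcongr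
      have hlt : ‖G 0‖ ≤ ‖G' 0‖ :=
        (le_mul_of_one_le_right hG0'.le hq.le).trans hgrow
      have hG'pos : 0 < ‖G' 0‖ := hG0'.trans_le hlt
      have hG'le : ‖G' 0‖ ≤ M :=
        norm_le_of_norm_le_on_sphere hR hG'd (fun w hw => (hsphere w hw).trans_le (hGM w hw))
          (by simpa using hR.le)
      rcases hG'le.lt_or_eq with hlt' | heq
      · refine (ih G' hG'd (norm_pos_iff.1 hG'pos) hlt'
          (fun w hw => (hsphere w hw).trans_le (hGM w hw))
          (fun w hw => by rw [norm_mul, hsphere w hw, ← norm_mul]; exact hF w hw) ?_).trans ?_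
        · calc M < ‖G 0‖ * (R / ρ) ^ (n + 1) := hn
            _ = ‖G 0‖ * (R / ρ) * (R / ρ) ^ n := by ring
            _ ≤ _ := by gcongr
        · gcongr
      · -- If `|G' 0| = M` then `G'` is constant by the maximum principle.
        have hmax : ∀ w, ‖w‖ ≤ R → ‖G' w‖ = M := by
          intro w hw
          have h1 : IsMaxOn (norm ∘ G') (closedBall 0 R) 0 := fun w hw => by
            simp only [Set.mem_ofPred_eq, Function.comp_apply, heq]
            exact norm_le_of_norm_le_on_sphere hR hG'd
              (fun w hw => (hsphere w hw).trans_le (hGM w hw)) (by simpa using hw)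
          have h2 := Complex.norm_eqOn_closedBall_of_isMaxOn (z := (0 : ℂ)) (r := R)
            hG'd.diffContOnCl (h1.on_subset ball_subset_closedBall)
          have h3 := h2 (show w ∈ closedBall (0 : ℂ) R by simpa using hw)
          simpa [heq] using h3
        have hh1 : ‖h z‖ ≤ 1 := by
          refine norm_le_of_norm_le_on_sphere hR hh (fun w hw => ?_) (hz.trans (hrρ.trans hρR).le)
          have h1 := hF w hw
          rw [norm_mul, ← hsphere w hw, hmax w hw.le] at h1
          exact le_of_mul_le_mul_right (by simpa using h1) hMpos
        refine hh1.trans (Real.one_le_exp ?_)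
        have := Real.log_nonneg (show 1 ≤ M / ‖G 0‖ by rw [one_le_div hG0']; exact hGM0.le)
        positivity
    · push Not at hzero
      have hMball : ∀ w ∈ ball (0 : ℂ) ρ, ‖G w‖ ≤ M := fun w hw =>
        norm_le_of_norm_le_on_sphere hR hG hGM
          ((by simpa using hw : ‖w‖ < ρ).le.trans hρR.le)
      have hlow := norm_lower_bound_of_ne_zero hr hrρ hG.differentiableOn hzero hMball hGM0 hz
      have hFz : ‖h z‖ * ‖G z‖ ≤ M := by
        rw [← norm_mul]
        exact norm_le_of_norm_le_on_sphere hR (hh.mul hG) hF (hz.trans (hrρ.trans hρR).le)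
      have hGz : 0 < ‖G z‖ := norm_pos_iff.2 (hzero z (by simpa using hz.trans_lt hrρ))
      set m := Real.log (M / ‖G 0‖) with hm
      have hMm : M = ‖G 0‖ * Real.exp m := by
        rw [hm, Real.exp_log (by positivity)]; field_simp
      rw [← le_div_iff₀ hGz] at hFz
      refine hFz.trans ?_
      rw [div_le_iff₀ hGz]
      calc M = Real.exp ((1 + 2 * r / (ρ - r)) * m) *
            (‖G 0‖ * Real.exp (-(2 * r / (ρ - r)) * m)) := by
            rw [mul_left_comm, ← Real.exp_add]
            conv_lhs => rw [hMm]
            congr 2; ring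
        _ ≤ _ := by gcongr

end BurnolZeta

/-! ### The completed zeta function `xi` -/

namespace BurnolZeta

open Complex

/-- Three-lines type bound for Mellin transforms: convergence at the edges of a vertical strip
bounds the transform on the strip. -/
theorem norm_mellin_le_of_strip {f : ℝ → ℂ} {a b : ℝ} (ha : MellinConvergent f a)
    (hb : MellinConvergent f b) {s : ℂ} (h1 : a ≤ s.re) (h2 : s.re ≤ b) :
    ‖mellin f s‖ ≤ (∫ t in Set.Ioi (0 : ℝ), ‖(t : ℂ) ^ ((a : ℂ) - 1) • f t‖) +
      ∫ t in Set.Ioi (0 : ℝ), ‖(t : ℂ) ^ ((b : ℂ) - 1) • f t‖ := by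
  rw [← integral_add ha.norm hb.norm]
  refine (norm_integral_le_integral_norm _).trans
    (integral_mono_of_nonneg (Filter.Eventually.of_forall fun t => norm_nonneg _)
      (ha.norm.add hb.norm) ?_)
  refine (ae_restrict_iff' measurableSet_Ioi).2 (Filter.Eventually.of_forall fun t ht => ?_)
  have ht0 : 0 < t := ht
  simp only [norm_smul, norm_cpow_eq_rpow_re_of_pos ht0, sub_re, ofReal_re, one_re]
  rw [← add_mul]
  gcongr
  rcases le_total t 1 with h | h
  · have := Real.rpow_le_rpow_of_exponent_ge ht0 h (show a - 1 ≤ s.re - 1 by linarith)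
    have := Real.rpow_nonneg ht0.le (b - 1)
    linarith
  · have := Real.rpow_le_rpow_of_exponent_le h (show s.re - 1 ≤ b - 1 by linarith)
    have := Real.rpow_nonneg ht0.le (a - 1)
    linarith

/-- The entire function `s (1 - s) π^{-s/2} Γ(s/2) ζ(s)`, whose zeros are the non-trivial zeros of
the zeta function, written in terms of the completed zeta function without its poles. -/
noncomputable def xi (s : ℂ) : ℂ := s * (1 - s) * completedRiemannZeta₀ s - 1

theorem differentiable_xi : Differentiable ℂ xi := by
  have := differentiable_completedZeta₀
  unfold xi
  fun_prop

theorem xi_one_sub (s : ℂ) : xi (1 - s) = xi s := by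
  unfold xi
  rw [completedRiemannZeta₀_one_sub]
  ring

theorem xi_eq {s : ℂ} (h0 : s ≠ 0) (h1 : s ≠ 1) (hG : Gammaℝ s ≠ 0) :
    xi s = s * (1 - s) * Gammaℝ s * riemannZeta s := by
  rw [riemannZeta_def_of_ne_zero h0, mul_assoc _ (Gammaℝ s), mul_div_cancel₀ _ hG,
    completedRiemannZeta_eq, xi]
  have : 1 - s ≠ 0 := sub_ne_zero.2 h1.symm
  field_simp
  ring

theorem exists_norm_xi_le (a b : ℝ) :
    ∃ A > 0, ∀ s : ℂ, a ≤ s.re → s.re ≤ b → ‖xi s‖ ≤ A * (1 + |s.im|) ^ 2 := by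
  set p := HurwitzZeta.hurwitzEvenFEPair 0
  have hc : ∀ s : ℂ, MellinConvergent p.f_modif s := fun s =>
    (p.isStrongFEPair_toStrongFEPair.hasMellin s).1
  set K := (∫ t in Set.Ioi (0 : ℝ), ‖(t : ℂ) ^ (((a / 2 : ℝ) : ℂ) - 1) • p.f_modif t‖) +
      ∫ t in Set.Ioi (0 : ℝ), ‖(t : ℂ) ^ (((b / 2 : ℝ) : ℂ) - 1) • p.f_modif t‖ with hK
  have hK0 : 0 ≤ K := add_nonneg (integral_nonneg fun _ => norm_nonneg _)
    (integral_nonneg fun _ => norm_nonneg _)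
  set m := |a| + |b| + 1 with hm
  refine ⟨m ^ 2 * K * 4 + 1, by positivity, fun s h1 h2 => ?_⟩
  have hre : |s.re| ≤ |a| + |b| := by
    rw [abs_le]
    constructor
    · linarith [neg_abs_le a, abs_nonneg b]
    · linarith [le_abs_self b, abs_nonneg a]
  have hz : ‖completedRiemannZeta₀ s‖ ≤ K := by
    have e : completedRiemannZeta₀ s = mellin p.f_modif (s / 2) / 2 := rfl
    have h3 : ‖mellin p.f_modif (s / 2)‖ ≤ K := by
      refine norm_mellin_le_of_strip (hc _) (hc _) ?_ ?_ <;> simp <;> linarith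
    rw [e, norm_div]
    refine (div_le_self (norm_nonneg _) (by simp)).trans h3
  have hs : ‖s‖ ≤ m * (1 + |s.im|) := by
    have := norm_le_abs_re_add_abs_im s
    nlinarith [abs_nonneg a, abs_nonneg b, abs_nonneg s.im]
  have hs1 : ‖1 - s‖ ≤ 2 * m * (1 + |s.im|) := by
    have : ‖1 - s‖ ≤ 1 + ‖s‖ := by simpa using norm_sub_le 1 s
    nlinarith [abs_nonneg a, abs_nonneg b, abs_nonneg s.im]
  have hone : 1 ≤ (1 + |s.im|) ^ 2 := one_le_pow₀ (by linarith [abs_nonneg s.im])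
  calc ‖xi s‖ ≤ ‖s‖ * ‖1 - s‖ * ‖completedRiemannZeta₀ s‖ + 1 := by
        unfold xi
        refine (norm_sub_le _ _).trans ?_
        simp
    _ ≤ m * (1 + |s.im|) * (2 * m * (1 + |s.im|)) * K + 1 := by gcongr
    _ ≤ _ := by nlinarith [mul_nonneg (mul_nonneg (sq_nonneg m) hK0) (sq_nonneg (1 + |s.im|))]

/-- For `re s ≥ 2` the zeta function is bounded below, since `|ζ(s) - 1| ≤ ζ(2) - 1 < 2/3`. -/
theorem one_third_le_norm_riemannZeta {s : ℂ} (hs : 2 ≤ s.re) : 1 / 3 ≤ ‖riemannZeta s‖ := by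
  have hs1 : 1 < s.re := by linarith
  have h2 : HasSum (fun n : ℕ => 1 / ((n : ℝ)) ^ 2) (Real.pi ^ 2 / 6) := hasSum_zeta_two
  have h3 : HasSum (fun n : ℕ => 1 / ((n + 1 : ℕ) : ℝ) ^ 2) (Real.pi ^ 2 / 6) := by
    rw [hasSum_nat_add_iff (f := fun n : ℕ => 1 / ((n : ℝ)) ^ 2) 1]
    simpa using h2
  have h4 : HasSum (fun n : ℕ => 1 / ((n + 2 : ℕ) : ℝ) ^ 2) (Real.pi ^ 2 / 6 - 1) := by
    have := (hasSum_nat_add_iff (f := fun n : ℕ => 1 / ((n + 1 : ℕ) : ℝ) ^ 2)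
      (g := Real.pi ^ 2 / 6 - 1) 1).2 (by simpa using h3)
    exact this
  have hsum : Summable (fun n : ℕ => 1 / ((n : ℂ) + 1) ^ s) := by
    have := (Complex.summable_one_div_nat_cpow (p := s)).2 hs1
    have := (summable_nat_add_iff 1).2 this
    simpa using this
  have hz := zeta_eq_tsum_one_div_nat_add_one_cpow hs1
  rw [hsum.tsum_eq_zero_add] at hz
  have hle : ‖∑' n : ℕ, 1 / (((n + 1 : ℕ) : ℂ) + 1) ^ s‖ ≤ Real.pi ^ 2 / 6 - 1 := by
    refine tsum_of_norm_bounded h4 fun n => ?_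
    have hn : (0 : ℝ) < (n + 2 : ℕ) := by positivity
    have e : (((n + 1 : ℕ) : ℂ) + 1) = (((n + 2 : ℕ) : ℝ) : ℂ) := by push_cast; ring
    rw [e, norm_div, norm_one, norm_cpow_eq_rpow_re_of_pos hn]
    rw [← Real.rpow_natCast _ 2]
    refine one_div_le_one_div_of_le (by positivity) ?_
    refine Real.rpow_le_rpow_of_exponent_le ?_ (by simpa using hs)
    push_cast; linarith [(Nat.cast_nonneg n : (0 : ℝ) ≤ n)]
  have hpi : Real.pi ^ 2 ≤ 10 := by nlinarith [Real.pi_lt_d2, Real.pi_pos]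
  have e1 : (1 : ℂ) = riemannZeta s - ∑' n : ℕ, 1 / (((n + 1 : ℕ) : ℂ) + 1) ^ s := by
    rw [hz]; simp
  have := norm_sub_le (riemannZeta s) (∑' n : ℕ, 1 / (((n + 1 : ℕ) : ℂ) + 1) ^ s)
  rw [← e1, norm_one] at this
  linarith

/-- Lower bound for the Gamma factor on a vertical line, from the reflection formula. -/
theorem exists_le_norm_Gammaℝ :
    ∃ c > 0, ∀ t : ℝ, c * Real.exp (-(Real.pi * |t|)) ≤ ‖Gammaℝ (3 + t * I)‖ := by
  refine ⟨Real.pi ^ (-(3 / 2) : ℝ) * (1 / 2) * Real.sqrt Real.pi, by positivity, fun t => ?_⟩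
  set y := t / 2 with hy
  set w : ℂ := 1 / 2 + y * I with hw
  have hw0 : w ≠ 0 := fun h => by
    have := congrArg re h
    simp [hw] at this
  have e1 : ((3 : ℂ) + t * I) / 2 = w + 1 := by
    rw [hw, hy]; push_cast; ring
  have hconj : 1 - w = starRingEnd ℂ w := by
    rw [hw]
    simp only [map_add, map_mul, conj_I, conj_ofReal, map_div₀, map_one, map_ofNat]
    ring
  have hrefl := Complex.Gamma_mul_Gamma_one_sub w
  rw [hconj, Complex.Gamma_conj] at hrefl
  have hsin : ‖Complex.sin (Real.pi * w)‖ ≤ Real.exp (Real.pi * |y|) := by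
    have e : Complex.sin (Real.pi * w) =
        (cexp (-(Real.pi * w) * I) - cexp (Real.pi * w * I)) * I / 2 := rfl
    have h1 : ‖cexp (-(Real.pi * w) * I)‖ ≤ Real.exp (Real.pi * |y|) := by
      rw [norm_exp]
      refine Real.exp_le_exp.2 ?_
      simp [hw]
      nlinarith [le_abs_self y, Real.pi_pos]
    have h2 : ‖cexp (Real.pi * w * I)‖ ≤ Real.exp (Real.pi * |y|) := by
      rw [norm_exp]
      refine Real.exp_le_exp.2 ?_
      simp [hw]
      nlinarith [neg_abs_le y, Real.pi_pos]
    rw [e, norm_div, norm_mul, norm_I, mul_one]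
    have := norm_sub_le (cexp (-(Real.pi * w) * I)) (cexp (Real.pi * w * I))
    simp only [norm_ofNat]
    linarith
  have hsin0 : 0 < ‖Complex.sin (Real.pi * w)‖ := by
    rw [norm_pos_iff]
    intro h
    rw [h, div_zero] at hrefl
    have hG : Gamma w ≠ 0 := Gamma_ne_zero_of_re_pos (by simp [hw])
    simp [hG] at hrefl
  have hsq : Real.pi * Real.exp (-(Real.pi * |y|)) ≤ ‖Gamma w‖ ^ 2 := by
    have h1 : ‖Gamma w‖ ^ 2 = Real.pi / ‖Complex.sin (Real.pi * w)‖ := by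
      have := congrArg norm hrefl
      rw [norm_mul, norm_conj, norm_div, norm_real, Real.norm_of_nonneg Real.pi_pos.le] at this
      rw [sq, this]
    rw [h1, Real.exp_neg, ← div_eq_mul_inv]
    gcongr
  have hGw : Real.sqrt Real.pi * Real.exp (-(Real.pi * |t|)) ≤ ‖Gamma w‖ := by
    refine le_of_sq_le_sq ?_ (norm_nonneg _)
    refine le_trans ?_ hsq
    rw [mul_pow, Real.sq_sqrt Real.pi_pos.le, ← Real.exp_nat_mul]
    gcongr
    rw [hy, abs_div]
    norm_num
    nlinarith [abs_nonneg t, Real.pi_pos, mul_nonneg Real.pi_pos.le (abs_nonneg t)]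
  have hwn : 1 / 2 ≤ ‖w‖ := by
    refine le_trans ?_ (abs_re_le_norm w)
    simp [hw]
  rw [Gammaℝ_def, e1, Complex.Gamma_add_one _ hw0, norm_mul, norm_mul,
    norm_cpow_eq_rpow_re_of_pos Real.pi_pos]
  have e2 : (-(3 + t * I) / 2 : ℂ).re = -(3 / 2) := by
    have : (-(3 + t * I) / 2 : ℂ) = ((-(3 / 2) : ℝ) : ℂ) + ((-(t / 2) : ℝ) : ℂ) * I := by
      push_cast; ring
    rw [this]; simp
  rw [e2]
  calc _ = Real.pi ^ (-(3 / 2) : ℝ) * (1 / 2 * (√Real.pi * Real.exp (-(Real.pi * |t|)))) := by ring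
    _ ≤ _ := by gcongr

end BurnolZeta

/-! ### Entire multiples of `xi` -/

namespace BurnolZeta

open Complex

/-- An entire quotient by `xi` of a function of polynomial growth on vertical strips is at most
`exp(B e^{|im s|})` on the strip `-1 ≤ re s ≤ 2`. As the width `3` of the strip is less than `π`,
this is within the range of the Phragmén-Lindelöf principle. -/
theorem exists_norm_quotient_xi_le {P h : ℂ → ℂ} (hh : Differentiable ℂ h)
    (hP : ∀ s, P s = h s * xi s) {A : ℝ}
    (hA : ∀ s : ℂ, -3 ≤ s.re → s.re ≤ 9 → ‖P s‖ ≤ A * (1 + |s.im|) ^ 2) :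
    ∃ B : ℝ, ∀ s : ℂ, -1 ≤ s.re → s.re ≤ 2 → ‖h s‖ ≤ Real.exp (B * Real.exp |s.im|) := by
  obtain ⟨A', hA'0, hA'⟩ := exists_norm_xi_le (-3) 9
  obtain ⟨c, hc0, hc⟩ := exists_le_norm_Gammaℝ
  set D := |A| + A' with hD
  have hD0 : 0 < D := by positivity
  -- The disc of radius `4` around `3 + i im s` contains `s`; with the radii `4 < 5 < 6` the factor
  -- `1 + 2 r / (ρ - r)` of the bound for quotients is `9`, and `(7 + u)² ≤ 98 e^u` for `u ≥ 0`.
  refine ⟨9 * (98 * D + |Real.log c| + Real.pi), fun s h1 h2 => ?_⟩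
  set u := |s.im| with hu
  have hu0 : 0 ≤ u := abs_nonneg _
  set M := D * (7 + u) ^ 2 with hM
  set s₀ : ℂ := 3 + s.im * I with hs₀
  have hs₀re : s₀.re = 3 := by simp [hs₀]
  have hs₀im : s₀.im = s.im := by simp [hs₀]
  have hlow : c * Real.exp (-(Real.pi * u)) ≤ ‖xi s₀‖ := by
    have hne0 : s₀ ≠ 0 := fun h => by rw [h] at hs₀re; simp at hs₀re
    have hne1 : s₀ ≠ 1 := fun h => by rw [h] at hs₀re; norm_num at hs₀re
    rw [xi_eq hne0 hne1 (Gammaℝ_ne_zero_of_re_pos (by rw [hs₀re]; norm_num)), norm_mul, norm_mul,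
      norm_mul]
    have e1 : 3 ≤ ‖s₀‖ := by
      have := abs_re_le_norm s₀
      rw [hs₀re] at this
      exact (le_abs_self _).trans this
    have e2 : 1 ≤ ‖1 - s₀‖ := by
      have := abs_re_le_norm (1 - s₀)
      rw [sub_re, hs₀re, one_re] at this
      norm_num at this
      linarith
    have e3 : 1 / 3 ≤ ‖riemannZeta s₀‖ := one_third_le_norm_riemannZeta (by rw [hs₀re]; norm_num)
    calc c * Real.exp (-(Real.pi * u)) ≤ ‖Gammaℝ s₀‖ := hc s.im
      _ = 3 * 1 * ‖Gammaℝ s₀‖ * (1 / 3) := by ring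
      _ ≤ _ := by gcongr
  have hlowpos : 0 < c * Real.exp (-(Real.pi * u)) := by positivity
  have hxi0 : 0 < ‖xi s₀‖ := hlowpos.trans_le hlow
  have hstrip : ∀ w : ℂ, ‖w‖ = 6 → -3 ≤ (s₀ + w).re ∧ (s₀ + w).re ≤ 9 ∧ |(s₀ + w).im| ≤ u + 6 := by
    intro w hw
    have h3 := abs_le.1 ((abs_re_le_norm w).trans_eq hw)
    have h4 := (abs_im_le_norm w).trans_eq hw
    refine ⟨?_, ?_, ?_⟩
    · rw [add_re, hs₀re]; linarith
    · rw [add_re, hs₀re]; linarith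
    · rw [add_im, hs₀im]
      exact (abs_add_le _ _).trans (by gcongr)
  have hbound : ∀ (F : ℂ → ℂ) (a : ℝ), a ≤ D → (∀ s : ℂ, -3 ≤ s.re → s.re ≤ 9 →
      ‖F s‖ ≤ a * (1 + |s.im|) ^ 2) → ∀ w : ℂ, ‖w‖ = 6 → ‖F (s₀ + w)‖ ≤ M := by
    intro F a ha hF w hw
    obtain ⟨e1, e2, e3⟩ := hstrip w hw
    calc ‖F (s₀ + w)‖ ≤ a * (1 + |(s₀ + w).im|) ^ 2 := hF _ e1 e2
      _ ≤ D * (1 + |(s₀ + w).im|) ^ 2 := by gcongr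
      _ ≤ D * (1 + (u + 6)) ^ 2 := by gcongr
      _ = M := by rw [hM]; ring
  have hcentre : ‖xi s₀‖ < M := by
    have := hA' s₀ (by rw [hs₀re]; norm_num) (by rw [hs₀re]; norm_num)
    rw [hs₀im] at this
    refine this.trans_lt ?_
    have h5 : A' * (1 + u) ^ 2 ≤ D * (1 + u) ^ 2 := by
      gcongr
      rw [hD]; linarith [abs_nonneg A]
    refine h5.trans_lt ?_
    rw [hM]
    gcongr
    norm_num
  have hquot := norm_quotient_le (h := fun w => h (s₀ + w)) (r := 4) (ρ := 5) (R := 6) (M := M)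
    (hh.comp (differentiable_id.const_add s₀)) (by norm_num) (by norm_num) (by norm_num)
    (fun w => xi (s₀ + w)) (differentiable_xi.comp (differentiable_id.const_add s₀))
    (by simpa using hxi0) (by simpa using hcentre)
    (hbound xi A' (by rw [hD]; linarith [abs_nonneg A]) hA')
    (by
      have := hbound P A (by rw [hD]; linarith [le_abs_self A]) hA
      intro w hw
      rw [← hP]
      exact this w hw)
    (z := s - s₀) (by
      have : s - s₀ = ((s.re - 3 : ℝ) : ℂ) := by
        apply Complex.ext <;> simp [hs₀]
      rw [this, norm_real, Real.norm_eq_abs, abs_le]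
      constructor <;> linarith)
  simp only [add_sub_cancel, add_zero] at hquot
  refine hquot.trans (Real.exp_le_exp.2 ?_)
  have hlog : Real.log (M / ‖xi s₀‖) ≤ M - Real.log c + Real.pi * u := by
    rw [Real.log_div (hxi0.trans hcentre).ne' hxi0.ne']
    have e1 : Real.log M ≤ M := (Real.log_le_sub_one_of_pos (hxi0.trans hcentre)).trans (by linarith)
    have e2 := Real.log_le_log hlowpos hlow
    rw [Real.log_mul hc0.ne' (Real.exp_pos _).ne', Real.log_exp] at e2
    linarith
  have hexp : 1 + u + u ^ 2 / 2 ≤ Real.exp u := Real.quadratic_le_exp_of_nonneg hu0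
  have hMle : M ≤ 98 * D * Real.exp u := by
    rw [hM, mul_comm 98 D, mul_assoc]
    gcongr
    nlinarith
  have hcle : -Real.log c ≤ |Real.log c| * Real.exp u := by
    refine (neg_le_abs _).trans (le_mul_of_one_le_right (abs_nonneg _) ?_)
    nlinarith
  have hpile : Real.pi * u ≤ Real.pi * Real.exp u := by
    gcongr
    nlinarith
  norm_num
  nlinarith

/-- **Uniqueness.** Let `P = h ξ` with `h` entire. If `P` has polynomial growth on vertical strips
and `P / (s (1 - s) Γ_ℝ(s))`, `P(1 - s) / (s (1 - s) Γ_ℝ(s))` are `O((re s)^{-1/2})` to the right,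
then `h` vanishes: it is bounded outside a strip and of controlled growth inside, so it is bounded
by the Phragmén-Lindelöf principle, hence constant by Liouville's theorem, and it tends to `0`. -/
theorem eq_zero_of_mul_xi {P h : ℂ → ℂ} (hh : Differentiable ℂ h)
    (hP : ∀ s, P s = h s * xi s) {A K : ℝ}
    (hA : ∀ s : ℂ, -3 ≤ s.re → s.re ≤ 9 → ‖P s‖ ≤ A * (1 + |s.im|) ^ 2)
    (hK : ∀ s : ℂ, 2 ≤ s.re → ‖P s‖ ≤ K / √s.re * ‖s * (1 - s) * Gammaℝ s‖)
    (hK' : ∀ s : ℂ, 2 ≤ s.re → ‖P (1 - s)‖ ≤ K / √s.re * ‖s * (1 - s) * Gammaℝ s‖) :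
    ∀ s, h s = 0 := by
  have hright : ∀ s : ℂ, 2 ≤ s.re → ∀ x : ℂ, ‖x * xi s‖ ≤ K / √s.re * ‖s * (1 - s) * Gammaℝ s‖ →
      ‖x‖ ≤ 3 * K / √s.re := by
    intro s hs x hx
    have hne0 : s ≠ 0 := fun h => by rw [h] at hs; norm_num at hs
    have hne1 : s ≠ 1 := fun h => by rw [h] at hs; norm_num at hs
    have hG := Gammaℝ_ne_zero_of_re_pos (s := s) (by linarith)
    have hpos : 0 < ‖s * (1 - s) * Gammaℝ s‖ :=
      norm_pos_iff.2 (mul_ne_zero (mul_ne_zero hne0 (sub_ne_zero.2 hne1.symm)) hG)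
    rw [xi_eq hne0 hne1 hG, norm_mul, norm_mul _ (riemannZeta s), mul_left_comm,
      mul_comm (K / √s.re)] at hx
    have h1 := le_of_mul_le_mul_left hx hpos
    have h2 := one_third_le_norm_riemannZeta hs
    have h3 : ‖x‖ * (1 / 3) ≤ K / √s.re := (by gcongr : _ ≤ ‖x‖ * ‖riemannZeta s‖).trans h1
    rw [mul_div_assoc]
    linarith
  have hR : ∀ s : ℂ, 2 ≤ s.re → ‖h s‖ ≤ 3 * K / √s.re := fun s hs =>
    hright s hs _ (by rw [← hP]; exact hK s hs)
  have hL : ∀ s : ℂ, 2 ≤ s.re → ‖h (1 - s)‖ ≤ 3 * K / √s.re := fun s hs =>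
    hright s hs _ (by rw [← xi_one_sub, ← hP]; exact hK' s hs)
  have hK0 : 0 ≤ 3 * K := by
    have := (norm_nonneg _).trans (hR 2 (by simp))
    rwa [le_div_iff₀ (by simp), zero_mul] at this
  have hle : ∀ x : ℝ, 2 ≤ x → 3 * K / √x ≤ 3 * K := fun x hx =>
    div_le_self hK0 (Real.one_le_sqrt.2 (by linarith))
  obtain ⟨B, hB⟩ := exists_norm_quotient_xi_le hh hP hA
  have hbdd : ∀ s : ℂ, ‖h s‖ ≤ 3 * K := by
    intro s
    rcases le_total 2 s.re with h2 | h2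
    · exact (hR s h2).trans (hle _ h2)
    rcases le_total s.re (-1) with h1 | h1
    · have := hL (1 - s) (by simp; linarith)
      rw [sub_sub_cancel] at this
      exact this.trans (hle _ (by simp; linarith))
    refine PhragmenLindelof.vertical_strip (a := -1) (b := 2) (C := 3 * K) hh.diffContOnCl
      ⟨1, ?_, B, ?_⟩ (fun z hz => ?_) (fun z hz => ?_) h1 h2
    · rw [lt_div_iff₀ (by norm_num)]
      linarith [Real.pi_gt_three]
    · refine Asymptotics.IsBigO.of_bound 1 ?_
      refine Filter.Eventually.filter_mono inf_le_right ?_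
      refine Filter.eventually_principal.2 fun z hz => ?_
      rw [one_mul, one_mul, Real.norm_of_nonneg (Real.exp_pos _).le]
      exact hB z hz.1.le hz.2.le
    · have := hL (1 - z) (by simp [hz]; norm_num)
      rw [sub_sub_cancel] at this
      exact this.trans (hle _ (by simp [hz]; norm_num))
    · exact (hR z hz.ge).trans (hle _ hz.ge)
  have hconst : ∀ s, h s = h 0 := fun s =>
    hh.apply_eq_apply_of_bounded (isBounded_iff_forall_norm_le.2 ⟨3 * K, by
      rintro _ ⟨z, rfl⟩; exact hbdd z⟩) s 0
  have hlim : Filter.Tendsto (fun x : ℝ => 3 * K / √x) Filter.atTop (𝓝 0) :=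
    Real.tendsto_sqrt_atTop.const_div_atTop _
  have h0 : ‖h 0‖ ≤ 0 := by
    refine ge_of_tendsto hlim ?_
    filter_upwards [Filter.eventually_ge_atTop 2] with x hx
    have := hR x (by simpa using hx)
    rwa [hconst, ofReal_re] at this
  intro s
  rw [hconst, norm_le_zero_iff.1 h0]

end BurnolZeta

/-! ### The Fourier transform on the intersection of `L¹` and `L²` -/

namespace BurnolZeta

open Complex FourierTransform

/-- The multiplication formula for the `L²` Fourier transform, against test functions. -/
theorem integral_fourierLp_mul (f : Lp ℂ 2 (volume : Measure ℝ)) {g : ℝ → ℂ}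
    (hg : ContDiff ℝ ((⊤ : ℕ∞) : WithTop ℕ∞) g) (hc : HasCompactSupport g) :
    ∫ x, g x * Lp.fourierTransformₗᵢ ℝ ℂ f x = ∫ x, 𝓕 g x * f x := by
  have h := congrArg (fun T => T (hc.toSchwartzMap hg)) (Lp.fourier_toTemperedDistribution_eq f)
  simp only [TemperedDistribution.fourier_apply, Lp.toTemperedDistribution_apply,
    smul_eq_mul, SchwartzMap.fourier_coe] at h
  exact h.symm

/-- On `L¹ ∩ L²` the `L²` Fourier transform is the Fourier integral. -/
theorem fourierLp_toLp_ae_eq {w : ℝ → ℂ} (h1 : Integrable w) (h2 : MemLp w 2 volume) :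
    Lp.fourierTransformₗᵢ ℝ ℂ (h2.toLp w) =ᵐ[volume] 𝓕 w := by
  refine ae_eq_of_integral_contDiff_smul_eq
    ((Lp.memLp _).locallyIntegrable (by norm_num)) ?_ fun g hg hc => ?_
  · exact (VectorFourier.fourierIntegral_continuous Real.continuous_fourierChar
      (by exact continuous_inner) h1).locallyIntegrable
  · set G : ℝ → ℂ := fun x => (g x : ℂ) with hG
    have hGd : ContDiff ℝ ((⊤ : ℕ∞) : WithTop ℕ∞) G := ofRealCLM.contDiff.comp hg
    have hGc : HasCompactSupport G := hc.comp_left ofReal_zero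
    have hGi : Integrable G := hGd.continuous.integrable_of_hasCompactSupport hGc
    have e1 := integral_fourierLp_mul (h2.toLp w) hGd hGc
    have e2 : ∫ x, 𝓕 G x * (h2.toLp w) x = ∫ x, 𝓕 G x * w x :=
      integral_congr_ae (by filter_upwards [h2.coeFn_toLp] with x hx; rw [hx])
    have e3 : ∫ x, 𝓕 G x • w x = ∫ x, G x • 𝓕 w x := by
      have := VectorFourier.integral_fourierIntegral_smul_eq_flip (μ := volume) (ν := volume)
        (L := innerₗ ℝ) Real.continuous_fourierChar continuous_inner hGi h1
      rw [flip_innerₗ] at this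
      exact this
    simp only [real_smul]
    simp only [smul_eq_mul] at e3
    rw [e1, e2, e3]

theorem fourier_comp_neg_apply (g : ℝ → ℂ) (x : ℝ) : 𝓕 (fun y => g (-y)) x = 𝓕 g (-x) := by
  rw [← Real.fourierInv_eq_fourier_comp_neg, Real.fourierInv_eq_fourier_neg]

/-- The `L²` Fourier transform of an even function is even. -/
theorem fourierLp_neg_ae_eq {f : Lp ℂ 2 (volume : Measure ℝ)} (hf : ∀ᵐ x, f (-x) = f x) :
    ∀ᵐ x, Lp.fourierTransformₗᵢ ℝ ℂ f (-x) = Lp.fourierTransformₗᵢ ℝ ℂ f x := by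
  have hli : LocallyIntegrable (Lp.fourierTransformₗᵢ ℝ ℂ f) volume :=
    (Lp.memLp _).locallyIntegrable (by norm_num)
  refine ae_eq_of_integral_contDiff_smul_eq ?_ hli fun g hg hc => ?_
  · have := (Lp.memLp (Lp.fourierTransformₗᵢ ℝ ℂ f)).comp_measurePreserving
      (Measure.measurePreserving_neg (volume : Measure ℝ))
    exact this.locallyIntegrable (by norm_num)
  · set G : ℝ → ℂ := fun x => (g x : ℂ) with hG
    have hGd : ContDiff ℝ ((⊤ : ℕ∞) : WithTop ℕ∞) G := ofRealCLM.contDiff.comp hg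
    have hGc : HasCompactSupport G := hc.comp_left ofReal_zero
    have hGd' : ContDiff ℝ ((⊤ : ℕ∞) : WithTop ℕ∞) (fun x => G (-x)) := hGd.comp contDiff_neg
    have hGc' : HasCompactSupport (fun x => G (-x)) :=
      hGc.comp_homeomorph (Homeomorph.neg ℝ)
    have e1 := integral_fourierLp_mul f hGd hGc
    have e2 := integral_fourierLp_mul f hGd' hGc'
    simp only [fourier_comp_neg_apply] at e2
    simp only [real_smul]
    calc ∫ x, (g x : ℂ) * Lp.fourierTransformₗᵢ ℝ ℂ f (-x)
        = ∫ x, G (-x) * Lp.fourierTransformₗᵢ ℝ ℂ f x := by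
          rw [← integral_neg_eq_self]
          simp [hG]
      _ = ∫ x, 𝓕 G (-x) * f x := e2
      _ = ∫ x, 𝓕 G x * f (-x) := by
          rw [← integral_neg_eq_self]
          simp
      _ = ∫ x, 𝓕 G x * f x := integral_congr_ae (by filter_upwards [hf] with x hx; rw [hx])
      _ = _ := e1.symm

end BurnolZeta

/-! ### Gaussians and the cosine transform -/

namespace BurnolZeta

open Complex FourierTransform

/-- The Gaussian `x ↦ e^{-π t² x²}`. -/
noncomputable def gauss (t x : ℝ) : ℝ := Real.exp (-(Real.pi * t ^ 2 * x ^ 2))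

theorem gauss_pos (t x : ℝ) : 0 < gauss t x := Real.exp_pos _

theorem gauss_abs (t x : ℝ) : gauss t |x| = gauss t x := by simp [gauss]

theorem continuous_gauss (t : ℝ) : Continuous (gauss t) := by unfold gauss; fun_prop

theorem integrable_gauss {t : ℝ} (ht : 0 < t) : Integrable (gauss t) := by
  have := integrable_exp_neg_mul_sq (b := Real.pi * t ^ 2) (by positivity)
  refine this.congr (Filter.Eventually.of_forall fun x => ?_)
  simp [gauss]

theorem integrable_gauss_ofReal {t : ℝ} (ht : 0 < t) : Integrable (fun x => (gauss t x : ℂ)) :=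
  (integrable_gauss ht).ofReal

theorem gauss_sq (t x : ℝ) : gauss t x ^ 2 = gauss (√2 * t) x := by
  simp only [gauss]
  rw [← Real.exp_nat_mul, mul_pow, Real.sq_sqrt (by norm_num)]
  congr 1
  push_cast
  ring

theorem memLp_gauss {t : ℝ} (ht : 0 < t) : MemLp (fun x => (gauss t x : ℂ)) 2 volume := by
  have hm : AEStronglyMeasurable (fun x => (gauss t x : ℂ)) volume :=
    (continuous_ofReal.comp (continuous_gauss t)).aestronglyMeasurable
  rw [memLp_two_iff_integrable_sq_norm hm]
  have := integrable_gauss (t := √2 * t) (by positivity)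
  refine this.congr (Filter.Eventually.of_forall fun x => ?_)
  simp only [norm_real, Real.norm_of_nonneg (gauss_pos t x).le, gauss_sq]

theorem fourier_gauss {t : ℝ} (ht : 0 < t) :
    𝓕 (fun x : ℝ => (gauss t x : ℂ)) = fun x : ℝ => ((t⁻¹ * gauss t⁻¹ x : ℝ) : ℂ) := by
  have h := fourier_gaussian_pi (b := ((t ^ 2 : ℝ) : ℂ)) (by rw [ofReal_re]; positivity)
  have e : (fun x : ℝ => (gauss t x : ℂ)) =
      fun x : ℝ => cexp (-Real.pi * ((t ^ 2 : ℝ) : ℂ) * x ^ 2) := by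
    ext x
    simp only [gauss]
    push_cast
    congr 1
    ring
  rw [e, h]
  ext x
  have h1 : ((t ^ 2 : ℝ) : ℂ) ^ (1 / 2 : ℂ) = (t : ℂ) := by
    rw [show (1 / 2 : ℂ) = ((1 / 2 : ℝ) : ℂ) by push_cast; rfl, ← ofReal_cpow (by positivity),
      ← Real.sqrt_eq_rpow, Real.sqrt_sq ht.le]
  rw [h1]
  simp only [gauss]
  push_cast
  rw [one_div]
  congr 2
  rw [inv_pow, div_eq_mul_inv]
  ring

theorem evenExtension_ae_eq (f : HalfLineL2) :
    ∀ᵐ x : ℝ, evenExtension f x = f |x| := (memLp_even f).coeFn_toLp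

theorem cosineTransform_ae_eq (f : HalfLineL2) :
    ∀ᵐ x ∂(volume.restrict (Set.Ioi (0 : ℝ))),
      cosineTransform f x = Lp.fourierTransformₗᵢ ℝ ℂ (evenExtension f) x :=
  LpToLpRestrictCLM_coeFn ℂ (Set.Ioi (0 : ℝ)) (Lp.fourierTransformₗᵢ ℝ ℂ (evenExtension f))

theorem fourierLp_evenExtension_abs (f : HalfLineL2) :
    ∀ᵐ x : ℝ, Lp.fourierTransformₗᵢ ℝ ℂ (evenExtension f) |x| =
      Lp.fourierTransformₗᵢ ℝ ℂ (evenExtension f) x := by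
  have h1 : ∀ᵐ x : ℝ, evenExtension f (-x) = evenExtension f x := by
    have h2 := evenExtension_ae_eq f
    have h3 := (Measure.measurePreserving_neg (volume : Measure ℝ)).quasiMeasurePreserving.ae h2
    filter_upwards [h2, h3] with x hx hx'
    rw [hx, hx', abs_neg]
  filter_upwards [fourierLp_neg_ae_eq h1] with x hx
  rcases abs_choice x with h | h
  · rw [h]
  · rw [h, hx]

theorem integral_even {g : ℝ → ℂ} (hg : ∀ᵐ x, g |x| = g x) :
    ∫ x, g x = 2 * ∫ x in Set.Ioi (0 : ℝ), g x := by
  have e : ∫ x, g x = ∫ x, g |x| :=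
    integral_congr_ae (by filter_upwards [hg] with x hx; rw [hx])
  have e1 : ∫ x in Set.Ioi (0 : ℝ), g |x| = ∫ x in Set.Ioi (0 : ℝ), g x :=
    setIntegral_congr_fun measurableSet_Ioi fun x hx => by
      simp only [abs_of_pos (Set.mem_Ioi.1 hx)]
  have e2 : ∫ x in Set.Iic (0 : ℝ), g |x| = ∫ x in Set.Ioi (0 : ℝ), g |x| := by
    have := integral_comp_neg_Iic (0 : ℝ) (fun x => g |x|)
    simpa using this
  rw [e]
  by_cases h : Integrable fun x => g |x|
  · rw [← intervalIntegral.integral_Iic_add_Ioi h.integrableOn h.integrableOn, e2, e1, two_mul]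
  · -- Both sides are zero: the even function is not integrable on the half-line either.
    rw [integral_undef h, ← e1, integral_undef, mul_zero]
    intro h1
    refine h ?_
    have h2 : IntegrableOn (fun x : ℝ => g |x|) (Set.Iic 0) := by
      rw [integrableOn_Iic_iff_integrableOn_Iio]
      have : IntegrableOn (fun x : ℝ => g |x|) (Set.Ioi (-0)) := by rw [neg_zero]; exact h1
      simpa using this.comp_neg
    rw [← integrableOn_univ, ← Set.Iic_union_Ioi (a := (0 : ℝ))]
    exact h2.union h1

/-- Parseval's identity for the cosine transform, against a Gaussian. -/
theorem integral_gauss_mul_cosineTransform (f : HalfLineL2) {t : ℝ} (ht : 0 < t) :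
    ∫ x in Set.Ioi (0 : ℝ), (gauss t⁻¹ x : ℂ) * cosineTransform f x =
      t * ∫ x in Set.Ioi (0 : ℝ), (gauss t x : ℂ) * f x := by
  set e := evenExtension f
  set F := Lp.fourierTransformₗᵢ ℝ ℂ e
  set Φ := (memLp_gauss ht).toLp
  have hinner : inner ℂ (Lp.fourierTransformₗᵢ ℝ ℂ Φ) F = inner ℂ Φ e :=
    LinearIsometryEquiv.inner_map_map _ _ _
  have hΦ : Φ =ᵐ[volume] fun x => (gauss t x : ℂ) := (memLp_gauss ht).coeFn_toLp
  have hFΦ := fourierLp_toLp_ae_eq (integrable_gauss_ofReal ht) (memLp_gauss ht)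
  rw [fourier_gauss ht] at hFΦ
  rw [L2.inner_def, L2.inner_def] at hinner
  have e1 : ∫ x, inner ℂ (Lp.fourierTransformₗᵢ ℝ ℂ Φ x) (F x) =
      ∫ x, (t⁻¹ : ℂ) * ((gauss t⁻¹ x : ℂ) * F x) := by
    refine integral_congr_ae ?_
    filter_upwards [hFΦ] with x hx
    rw [hx, RCLike.inner_apply, conj_ofReal]
    push_cast
    ring
  have e2 : ∫ x, inner ℂ (Φ x) (e x) = ∫ x, (gauss t x : ℂ) * f |x| := by
    refine integral_congr_ae ?_
    filter_upwards [hΦ, evenExtension_ae_eq f] with x hx hx'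
    rw [hx, hx', RCLike.inner_apply, conj_ofReal, mul_comm]
  rw [e1, e2, integral_const_mul, integral_even, integral_even] at hinner
  rotate_left
  · exact Filter.Eventually.of_forall fun x => by simp only [gauss_abs, abs_abs]
  · filter_upwards [fourierLp_evenExtension_abs f] with x hx
    rw [gauss_abs, hx]
  have e3 : ∫ x in Set.Ioi (0 : ℝ), (gauss t⁻¹ x : ℂ) * cosineTransform f x =
      ∫ x in Set.Ioi (0 : ℝ), (gauss t⁻¹ x : ℂ) * F x :=
    integral_congr_ae (by filter_upwards [cosineTransform_ae_eq f] with x hx; rw [hx])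
  have e4 : ∫ x in Set.Ioi (0 : ℝ), (gauss t x : ℂ) * f |x| =
      ∫ x in Set.Ioi (0 : ℝ), (gauss t x : ℂ) * f x :=
    setIntegral_congr_fun measurableSet_Ioi fun x hx => by
      simp only [abs_of_pos (Set.mem_Ioi.1 hx)]
  rw [e3, ← e4]
  have ht' : (t : ℂ) ≠ 0 := ofReal_ne_zero.2 ht.ne'
  have h2 : (t : ℂ) * (t⁻¹ : ℂ) = 1 := mul_inv_cancel₀ ht'
  linear_combination (t : ℂ) / 2 * hinner -
    (∫ x in Set.Ioi (0 : ℝ), (gauss t⁻¹ x : ℂ) * F x) * h2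

/-! ### The Mellin transform as an isometry, and completeness of the space `L` -/

theorem integral_comp_exp {E : Type*} [NormedAddCommGroup E] [NormedSpace ℝ E] (g : ℝ → E) :
    ∫ u, Real.exp u • g (Real.exp u) = ∫ x in Set.Ioi (0 : ℝ), g x := by
  have himg : Real.exp '' Set.univ = Set.Ioi 0 := by rw [Set.image_univ, Real.range_exp]
  have key := integral_image_eq_integral_abs_deriv_smul MeasurableSet.univ
    (fun x _ => (Real.hasDerivAt_exp x).hasDerivWithinAt) Real.exp_injective.injOn g
  rw [himg] at key
  simpa using key.symm

theorem integrable_comp_exp {E : Type*} [NormedAddCommGroup E] [NormedSpace ℝ E] (g : ℝ → E) :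
    IntegrableOn g (Set.Ioi 0) ↔ Integrable fun u => Real.exp u • g (Real.exp u) := by
  have himg : Real.exp '' Set.univ = Set.Ioi 0 := by rw [Set.image_univ, Real.range_exp]
  have key := integrableOn_image_iff_integrableOn_abs_deriv_smul MeasurableSet.univ
    (fun x _ => (Real.hasDerivAt_exp x).hasDerivWithinAt) Real.exp_injective.injOn g
  rw [himg] at key
  simpa using key

theorem logSubstitution_ae_eq (f : HalfLineL2) :
    ∀ᵐ u : ℝ, logSubstitution f u = (Real.exp (u / 2) : ℂ) * f (Real.exp u) :=
  (memLp_exp f).coeFn_toLp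

theorem inner_mellinTransform (f g : HalfLineL2) :
    inner ℂ (mellinTransform f) (mellinTransform g) = inner ℂ f g := by
  have h1 : inner ℂ (mellinTransform f) (mellinTransform g) =
      inner ℂ (logSubstitution f) (logSubstitution g) :=
    LinearIsometryEquiv.inner_map_map (Lp.fourierTransformₗᵢ ℝ ℂ) _ _
  rw [h1, L2.inner_def, L2.inner_def, ← integral_comp_exp]
  refine integral_congr_ae ?_
  filter_upwards [logSubstitution_ae_eq f, logSubstitution_ae_eq g] with u hu hu'
  rw [hu, hu', RCLike.inner_apply, RCLike.inner_apply, real_smul, map_mul, conj_ofReal]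
  have : Real.exp u = Real.exp (u / 2) * Real.exp (u / 2) := by rw [← Real.exp_add, add_halves]
  rw [this]
  push_cast
  ring

theorem norm_mellinTransform (f : HalfLineL2) : ‖mellinTransform f‖ = ‖f‖ := by
  rw [@norm_eq_sqrt_re_inner ℂ _ _ _ _ f, @norm_eq_sqrt_re_inner ℂ _ _ _ _ (mellinTransform f),
    inner_mellinTransform]

/-- The Mellin transform as a linear isometry. -/
noncomputable def mellinIsometry : HalfLineL2 →ₗᵢ[ℂ] CriticalLineL2 :=
  ⟨mellinTransform, norm_mellinTransform⟩

theorem norm_evenExtension (f : HalfLineL2) : ‖evenExtension f‖ ^ 2 = 2 * ‖f‖ ^ 2 := by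
  rw [← @inner_self_eq_norm_sq ℂ, ← @inner_self_eq_norm_sq ℂ, L2.inner_def, L2.inner_def]
  have e1 : ∫ x, inner ℂ (evenExtension f x) (evenExtension f x) =
      ∫ x, inner ℂ (f |x|) (f |x|) := by
    refine integral_congr_ae ?_
    filter_upwards [evenExtension_ae_eq f] with x hx
    rw [hx]
  rw [e1, integral_even (Filter.Eventually.of_forall fun x => by simp only [abs_abs])]
  have e2 : ∫ x in Set.Ioi (0 : ℝ), inner ℂ (f |x|) (f |x|) =
      ∫ x in Set.Ioi (0 : ℝ), inner ℂ (f x) (f x) :=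
    setIntegral_congr_fun measurableSet_Ioi fun x hx => by
      simp only [abs_of_pos (Set.mem_Ioi.1 hx)]
  rw [e2]
  simp

theorem norm_cosineTransform_le (f : HalfLineL2) : ‖cosineTransform f‖ ≤ 2 * ‖f‖ := by
  have h1 : ‖cosineTransform f‖ ≤ ‖evenExtension f‖ := by
    have h2 : ‖cosineTransform f‖ ≤ ‖Lp.fourierTransformₗᵢ ℝ ℂ (evenExtension f)‖ := by
      have e : cosineTransform f = ((Lp.memLp (Lp.fourierTransformₗᵢ ℝ ℂ (evenExtension f))).restrict
        (Set.Ioi (0 : ℝ))).toLp _ := rfl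
      rw [e]
      exact norm_Lp_toLp_restrict_le _ _
    rwa [LinearIsometryEquiv.norm_map] at h2
  refine h1.trans (le_of_sq_le_sq ?_ (by positivity))
  rw [norm_evenExtension]
  nlinarith [sq_nonneg ‖f‖]

theorem continuous_cosineTransform : Continuous cosineTransform :=
  (LinearMap.mkContinuous cosineTransform 2 norm_cosineTransform_le).continuous

theorem mem_constantNearZero {f : HalfLineL2} : f ∈ constantNearZero ↔
    ∃ c : ℂ, ∀ᵐ x ∂(volume.restrict (Set.Ioo (0 : ℝ) 1)), f x = c := Iff.rfl

/-- The functions constant near `0` form the preimage of a line under restriction to `(0, 1)`. -/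
theorem isClosed_constantNearZero : IsClosed (constantNearZero : Set HalfLineL2) := by
  set μ := (volume : Measure ℝ).restrict (Set.Ioi (0 : ℝ))
  have hμ : μ.restrict (Set.Ioo 0 1) = volume.restrict (Set.Ioo 0 1) := by
    rw [Measure.restrict_restrict measurableSet_Ioo, Set.inter_eq_left.2 fun x hx => hx.1]
  have : IsFiniteMeasure (μ.restrict (Set.Ioo (0 : ℝ) 1)) := by
    rw [hμ]; infer_instance
  set R := LpToLpRestrictCLM ℝ ℂ ℂ μ 2 (Set.Ioo (0 : ℝ) 1)
  set one : Lp ℂ 2 (μ.restrict (Set.Ioo (0 : ℝ) 1)) := (memLp_const (1 : ℂ)).toLp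
  have e : (constantNearZero : Set HalfLineL2) = R ⁻¹' (Submodule.span ℂ {one} : Submodule ℂ _) := by
    ext f
    simp only [SetLike.mem_coe, Set.mem_preimage, Submodule.mem_span_singleton,
      mem_constantNearZero]
    have hR : R f =ᵐ[μ.restrict (Set.Ioo (0 : ℝ) 1)] f := LpToLpRestrictCLM_coeFn ℂ _ f
    have hone : one =ᵐ[μ.restrict (Set.Ioo (0 : ℝ) 1)] fun _ => (1 : ℂ) :=
      (memLp_const (1 : ℂ)).coeFn_toLp
    rw [← hμ]
    refine exists_congr fun c => ⟨fun h => ?_, fun h => ?_⟩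
    · refine Lp.ext ?_
      filter_upwards [h, hR, hone, Lp.coeFn_smul c one] with x h1 h2 h3 h4
      rw [h4, h2, h1, Pi.smul_apply, h3, smul_eq_mul, mul_one]
    · rw [← h] at hR
      filter_upwards [hR, hone, Lp.coeFn_smul c one] with x h2 h3 h4
      rw [← h2, h4, Pi.smul_apply, h3, smul_eq_mul, mul_one]
  rw [e]
  exact (Submodule.closed_of_finiteDimensional _).preimage R.continuous

instance completeSpace_spaceL : CompleteSpace spaceL := by
  have hcl : IsClosed ((constantNearZero ⊓ constantNearZero.comap cosineTransform :
      Submodule ℂ HalfLineL2) : Set HalfLineL2) := by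
    rw [Submodule.coe_inf]
    exact isClosed_constantNearZero.inter
      (isClosed_constantNearZero.preimage continuous_cosineTransform)
  have := hcl.isComplete
  have h : IsComplete (spaceL : Set CriticalLineL2) := (mellinIsometry.isComplete_map_iff
    (p := constantNearZero ⊓ constantNearZero.comap cosineTransform)).2 this
  exact h.completeSpace_coe

end BurnolZeta

/-! ### Gaussian transforms of functions constant near zero -/

namespace BurnolZeta

open Complex

/-- The Cauchy-Schwarz inequality for the integral of the product of the norms. -/
theorem integral_norm_mul_norm_sq_le {μ : Measure ℝ} (f : Lp ℂ 2 μ) {g : ℝ → ℝ}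
    (hg : MemLp g 2 μ) : (∫ x, ‖f x‖ * ‖g x‖ ∂μ) ^ 2 ≤ ‖f‖ ^ 2 * ∫ x, ‖g x‖ ^ 2 ∂μ := by
  set F := (Lp.memLp f).norm.toLp
  set G := hg.norm.toLp
  have hF : F =ᵐ[μ] fun x => ‖f x‖ := (Lp.memLp f).norm.coeFn_toLp
  have hG : G =ᵐ[μ] fun x => ‖g x‖ := hg.norm.coeFn_toLp
  have e1 : inner ℝ F G = ∫ x, ‖f x‖ * ‖g x‖ ∂μ := by
    rw [L2.inner_def]
    refine integral_congr_ae ?_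
    filter_upwards [hF, hG] with x h1 h2
    rw [h1, h2]
    simp [mul_comm]
  have e2 : ‖F‖ = ‖f‖ := by
    rw [Lp.norm_toLp, eLpNorm_norm, Lp.norm_def]
  have e3 : ‖G‖ ^ 2 = ∫ x, ‖g x‖ ^ 2 ∂μ := by
    rw [← @inner_self_eq_norm_sq ℝ, L2.inner_def, RCLike.re_to_real]
    refine integral_congr_ae ?_
    filter_upwards [hG] with x h2
    rw [h2]
    simp
  have h := abs_real_inner_le_norm F G
  rw [← e1, ← e2, ← e3, ← mul_pow]
  exact sq_le_sq' (abs_le.1 h).1 (abs_le.1 h).2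

theorem norm_sq_eq_integral {μ : Measure ℝ} (f : Lp ℂ 2 μ) : ‖f‖ ^ 2 = ∫ x, ‖f x‖ ^ 2 ∂μ := by
  rw [← @inner_self_eq_norm_sq ℂ, L2.inner_def]
  have : ∫ x, inner ℂ (f x) (f x) ∂μ = ((∫ x, ‖f x‖ ^ 2 ∂μ : ℝ) : ℂ) := by
    rw [← integral_complex_ofReal]
    refine integral_congr_ae (Filter.Eventually.of_forall fun x => ?_)
    simp
  rw [this]
  simp

theorem norm_const_le {f : HalfLineL2} {a : ℂ}
    (ha : ∀ᵐ x ∂(volume.restrict (Set.Ioo (0 : ℝ) 1)), f x = a) : ‖a‖ ≤ ‖f‖ := by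
  refine le_of_sq_le_sq ?_ (norm_nonneg _)
  rw [norm_sq_eq_integral]
  have h1 : ∫ x in Set.Ioo (0 : ℝ) 1, ‖f x‖ ^ 2 = ‖a‖ ^ 2 := by
    rw [integral_congr_ae (g := fun _ => ‖a‖ ^ 2) (by filter_upwards [ha] with x hx; rw [hx])]
    simp
  rw [← h1]
  exact setIntegral_mono_set
    ((memLp_two_iff_integrable_sq_norm (Lp.aestronglyMeasurable f)).1 (Lp.memLp f))
    (Filter.Eventually.of_forall fun x => by positivity)
    (ae_of_all _ fun x hx => hx.1)

theorem integrableOn_gauss_mul (f : HalfLineL2) {t : ℝ} (ht : 0 < t) :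
    IntegrableOn (fun x => (gauss t x : ℂ) * f x) (Set.Ioi 0) :=
  ((memLp_gauss ht).restrict _).integrable_mul (Lp.memLp f)

/-- The Gaussian transform `t ↦ 2 ∫_0^∞ f(x) e^{-π t² x²} dx`. -/
noncomputable def gaussTransform (f : HalfLineL2) (t : ℝ) : ℂ :=
  2 * ∫ x in Set.Ioi (0 : ℝ), (gauss t x : ℂ) * f x

/-- For `f` equal to `a` on `(0, 1)`, the rapidly decreasing part of the Gaussian transform at
infinity, extended by zero to `t ≤ 1`. -/
noncomputable def gaussTail (f : HalfLineL2) (a : ℂ) : ℝ → ℂ :=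
  (Set.Ioi 1).indicator fun t => ∫ x in Set.Ioi (1 : ℝ), 2 * ((gauss t x : ℂ) * (f x - a))

theorem integral_gauss_Ioi {t : ℝ} (ht : 0 < t) :
    ∫ x in Set.Ioi (0 : ℝ), (gauss t x : ℂ) = (2 * t : ℂ)⁻¹ := by
  have e : ∫ x in Set.Ioi (0 : ℝ), gauss t x = (2 * t)⁻¹ := by
    have := integral_gaussian_Ioi (Real.pi * t ^ 2)
    rw [show (fun x : ℝ => gauss t x) = fun x : ℝ => Real.exp (-(Real.pi * t ^ 2) * x ^ 2) by
      ext x; simp [gauss], this, div_mul_eq_div_div, div_self Real.pi_pos.ne',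
      Real.sqrt_div (by norm_num), Real.sqrt_one, Real.sqrt_sq ht.le]
    field_simp
  rw [integral_complex_ofReal, e]
  push_cast
  rfl

theorem setIntegral_Ioi_zero_split {g : ℝ → ℂ} (hg : IntegrableOn g (Set.Ioi 0)) :
    ∫ x in Set.Ioi (0 : ℝ), g x = (∫ x in Set.Ioc (0 : ℝ) 1, g x) + ∫ x in Set.Ioi (1 : ℝ), g x := by
  rw [← Set.Ioc_union_Ioi_eq_Ioi (zero_le_one (α := ℝ))] at hg ⊢
  exact setIntegral_union (Set.Ioc_disjoint_Ioi le_rfl) measurableSet_Ioi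
    (hg.mono_set Set.subset_union_left) (hg.mono_set Set.subset_union_right)

theorem gaussTransform_eq {f : HalfLineL2} {a : ℂ}
    (ha : ∀ᵐ x ∂(volume.restrict (Set.Ioo (0 : ℝ) 1)), f x = a) {t : ℝ} (ht : 1 < t) :
    gaussTransform f t = a / t + gaussTail f a t := by
  have ht0 : 0 < t := by linarith
  have hi1 := integrableOn_gauss_mul f ht0
  have hi2 : IntegrableOn (fun x => (gauss t x : ℂ) * a) (Set.Ioi 0) :=
    ((integrable_gauss_ofReal ht0).mul_const a).integrableOn
  have hi : IntegrableOn (fun x => (gauss t x : ℂ) * (f x - a)) (Set.Ioi 0) :=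
    (hi1.sub hi2).congr (Filter.Eventually.of_forall fun x => by simp [mul_sub])
  have h0 : ∫ x in Set.Ioc (0 : ℝ) 1, (gauss t x : ℂ) * (f x - a) = 0 := by
    rw [integral_Ioc_eq_integral_Ioo]
    refine integral_eq_zero_of_ae ?_
    filter_upwards [ha] with x hx
    simp [hx]
  have h1 : ∫ x in Set.Ioi (0 : ℝ), (gauss t x : ℂ) * (f x - a) =
      ∫ x in Set.Ioi (1 : ℝ), (gauss t x : ℂ) * (f x - a) := by
    rw [setIntegral_Ioi_zero_split hi, h0, zero_add]
  have h2 : ∫ x in Set.Ioi (0 : ℝ), (gauss t x : ℂ) * (f x - a) =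
      (∫ x in Set.Ioi (0 : ℝ), (gauss t x : ℂ) * f x) - (2 * t : ℂ)⁻¹ * a := by
    rw [← integral_gauss_Ioi ht0, ← integral_mul_const, ← integral_sub hi1 hi2]
    simp only [mul_sub]
  rw [gaussTail, Set.indicator_of_mem (Set.mem_Ioi.2 ht), integral_const_mul, ← h1, h2,
    gaussTransform]
  have : (t : ℂ) ≠ 0 := ofReal_ne_zero.2 ht0.ne'
  field_simp
  ring

theorem gaussTransform_cosineTransform (f : HalfLineL2) {t : ℝ} (ht : 0 < t) :
    gaussTransform f t = (t : ℂ)⁻¹ * gaussTransform (cosineTransform f) t⁻¹ := by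
  have h := integral_gauss_mul_cosineTransform f ht
  have : (t : ℂ) ≠ 0 := ofReal_ne_zero.2 ht.ne'
  rw [gaussTransform, gaussTransform, h]
  field_simp

theorem gaussTail_of_le {f : HalfLineL2} {a : ℂ} {t : ℝ} (ht : t ≤ 1) : gaussTail f a t = 0 :=
  Set.indicator_of_notMem (by simpa using ht) _

theorem stronglyMeasurable_gaussTail (f : HalfLineL2) (a : ℂ) :
    StronglyMeasurable (gaussTail f a) := by
  refine StronglyMeasurable.indicator ?_ measurableSet_Ioi
  refine StronglyMeasurable.integral_prod_right
    (f := fun t x => 2 * ((gauss t x : ℂ) * (f x - a))) ?_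
  have h1 : StronglyMeasurable fun p : ℝ × ℝ => (gauss p.1 p.2 : ℂ) := by
    refine Continuous.stronglyMeasurable ?_
    unfold gauss
    fun_prop
  have h2 : StronglyMeasurable fun p : ℝ × ℝ => f p.2 - a :=
    ((Lp.stronglyMeasurable f).comp_measurable measurable_snd).sub stronglyMeasurable_const
  exact (h1.mul h2).const_mul 2

/-- The Gaussian tails decay exponentially, with a constant that is uniform in the function. -/
theorem exists_norm_gaussTail_le : ∃ C > 0, ∀ (f : HalfLineL2) (a : ℂ),
    (∀ᵐ x ∂(volume.restrict (Set.Ioo (0 : ℝ) 1)), f x = a) → ∀ t : ℝ,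
    ‖gaussTail f a t‖ ≤ C * ‖f‖ * Real.exp (-t) := by
  set q : ℝ → ℝ := fun x => Real.exp (-1 * x ^ 2) with hq
  have hqi : Integrable q := integrable_exp_neg_mul_sq one_pos
  have hqc : Continuous q := by rw [hq]; fun_prop
  have hq2 : Integrable fun x => ‖q x‖ ^ 2 := by
    refine (integrable_exp_neg_mul_sq (b := 2) two_pos).congr
      (Filter.Eventually.of_forall fun x => ?_)
    simp only [hq, Real.norm_eq_abs, Real.abs_exp]
    rw [← Real.exp_nat_mul]
    push_cast
    ring_nf
  have hqL : MemLp q 2 (volume.restrict (Set.Ioi (0 : ℝ))) :=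
    ((memLp_two_iff_integrable_sq_norm hqc.aestronglyMeasurable).2 hq2).restrict _
  set K := √(∫ x in Set.Ioi (0 : ℝ), ‖q x‖ ^ 2) with hK
  set J := ∫ x in Set.Ioi (0 : ℝ), ‖q x‖ with hJ
  have hJ0 : 0 ≤ J := integral_nonneg fun _ => norm_nonneg _
  have hK0 : 0 ≤ K := Real.sqrt_nonneg _
  refine ⟨2 * (K + J) + 1, by positivity, fun f a ha t => ?_⟩
  rcases le_or_gt t 1 with ht | ht
  · rw [gaussTail_of_le ht, norm_zero]
    positivity
  have ht0 : 0 < t := by linarith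
  have hfq : IntegrableOn (fun x => ‖f x‖ * ‖q x‖) (Set.Ioi 0) :=
    (Lp.memLp f).norm.integrable_mul hqL.norm
  have haq : IntegrableOn (fun x => ‖a‖ * ‖q x‖) (Set.Ioi 0) := (hqi.norm.const_mul _).integrableOn
  have hCS : ∫ x in Set.Ioi (0 : ℝ), ‖f x‖ * ‖q x‖ ≤ ‖f‖ * K := by
    refine le_of_sq_le_sq ?_ (by positivity)
    rw [mul_pow, hK, Real.sq_sqrt (integral_nonneg fun _ => by positivity)]
    exact integral_norm_mul_norm_sq_le f hqL
  have hsub : Set.Ioi (1 : ℝ) ⊆ Set.Ioi 0 := Set.Ioi_subset_Ioi zero_le_one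
  rw [gaussTail, Set.indicator_of_mem (Set.mem_Ioi.2 ht)]
  have hpt : ∀ x ∈ Set.Ioi (1 : ℝ), ‖2 * ((gauss t x : ℂ) * (f x - a))‖ ≤
      2 * Real.exp (-t) * (‖f x‖ * ‖q x‖ + ‖a‖ * ‖q x‖) := by
    intro x hx
    have hx1 : 1 < x := hx
    have hg : gauss t x ≤ Real.exp (-t) * q x := by
      simp only [hq, gauss]
      rw [← Real.exp_add, Real.exp_le_exp]
      have h3 := Real.pi_gt_three
      have ht2 : t ≤ t ^ 2 := by nlinarith
      have hx2 : 1 ≤ x ^ 2 := one_le_pow₀ hx1.le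
      have h4 : t ≤ t ^ 2 * x ^ 2 := by nlinarith
      have h5 : x ^ 2 ≤ t ^ 2 * x ^ 2 := le_mul_of_one_le_left (sq_nonneg x) (by linarith)
      nlinarith [mul_nonneg (sq_nonneg t) (sq_nonneg x)]
    have hqn : ‖q x‖ = q x := by simp [hq]
    rw [norm_mul, norm_mul, norm_real, Real.norm_of_nonneg (gauss_pos t x).le, hqn]
    have h6 : ‖f x - a‖ ≤ ‖f x‖ + ‖a‖ := norm_sub_le _ _
    have h7 : 0 ≤ q x := (Real.exp_pos _).le
    calc ‖(2 : ℂ)‖ * (gauss t x * ‖f x - a‖)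
        ≤ 2 * ((Real.exp (-t) * q x) * (‖f x‖ + ‖a‖)) := by
          rw [norm_ofNat]; gcongr
      _ = _ := by ring
  calc ‖∫ x in Set.Ioi (1 : ℝ), 2 * ((gauss t x : ℂ) * (f x - a))‖
      ≤ ∫ x in Set.Ioi (1 : ℝ), 2 * Real.exp (-t) * (‖f x‖ * ‖q x‖ + ‖a‖ * ‖q x‖) :=
        norm_integral_le_of_norm_le (((hfq.add haq).mono_set hsub).const_mul _)
          ((ae_restrict_iff' measurableSet_Ioi).2 (Filter.Eventually.of_forall hpt))
    _ ≤ ∫ x in Set.Ioi (0 : ℝ), 2 * Real.exp (-t) * (‖f x‖ * ‖q x‖ + ‖a‖ * ‖q x‖) :=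
        setIntegral_mono_set ((hfq.add haq).const_mul _)
          (Filter.Eventually.of_forall fun x => by
            simp only [Pi.zero_apply]; positivity) (ae_of_all _ hsub)
    _ = 2 * Real.exp (-t) * ((∫ x in Set.Ioi (0 : ℝ), ‖f x‖ * ‖q x‖) + ‖a‖ * J) := by
        rw [integral_const_mul, integral_add hfq haq, integral_const_mul]
    _ ≤ 2 * Real.exp (-t) * (‖f‖ * K + ‖f‖ * J) := by
        gcongr
        exact norm_const_le ha
    _ ≤ _ := by nlinarith [Real.exp_pos (-t), norm_nonneg f,
        mul_nonneg (Real.exp_pos (-t)).le (norm_nonneg f)]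

end BurnolZeta

/-! ### Mellin transforms of Gaussian transforms -/

namespace BurnolZeta

open Complex

theorem hasMellin_gauss {s : ℂ} (hs : 0 < s.re) {x : ℝ} (hx : 0 < x) :
    HasMellin (fun t => (gauss t x : ℂ)) s ((x : ℂ) ^ (-s) * (Gammaℝ s / 2)) := by
  set e : ℝ → ℂ := fun u => (Real.exp (-u) : ℂ) with he
  have hs2 : 0 < (s / 2).re := by simp [hs]
  have hec : MellinConvergent e (s / 2) := by
    have := Complex.GammaIntegral_convergent hs2
    refine this.congr (Filter.Eventually.of_forall fun u => ?_)
    simp [he, mul_comm]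
  have hem : mellin e (s / 2) = Gamma (s / 2) := by
    rw [Complex.Gamma_eq_integral hs2, Complex.GammaIntegral_eq_mellin]
  set h : ℝ → ℂ := fun t => e (t ^ (2 : ℝ)) with hh
  have hs2' : s / ((2 : ℝ) : ℂ) = s / 2 := by push_cast; rfl
  have hhc : MellinConvergent h s := by
    rw [hh, MellinConvergent.comp_rpow two_ne_zero, hs2']
    exact hec
  have hhm : mellin h s = Gamma (s / 2) / 2 := by
    rw [hh, mellin_comp_rpow, hs2', hem]
    simp
    ring
  have ha : 0 < √Real.pi * x := by positivity
  have hg : (fun t => (gauss t x : ℂ)) = fun t => h (√Real.pi * x * t) := by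
    ext t
    simp only [hh, he, gauss, ofReal_exp]
    rw [Real.rpow_two, mul_pow, mul_pow, Real.sq_sqrt Real.pi_pos.le]
    congr 2
    ring
  rw [hg]
  refine ⟨(MellinConvergent.comp_mul_left ha).2 hhc, ?_⟩
  rw [mellin_comp_mul_left _ _ ha, hhm, ofReal_mul,
    mul_cpow_ofReal_nonneg (Real.sqrt_nonneg _) hx.le, Gammaℝ_def]
  have : ((√Real.pi : ℝ) : ℂ) ^ (-s) = (Real.pi : ℂ) ^ (-s / 2) := by
    rw [Real.sqrt_eq_rpow, ← cpow_mul_ofReal_nonneg Real.pi_pos.le]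
    congr 1
    push_cast
    ring
  rw [this, smul_eq_mul]
  ring

/-- The Mellin transform of a Gaussian transform, by Fubini's theorem. -/
theorem hasMellin_gaussTransform {f : ℝ → ℂ} {s : ℂ} (hs : 0 < s.re)
    (hf : AEStronglyMeasurable f (volume.restrict (Set.Ioi 0)))
    (hfi : IntegrableOn (fun x : ℝ => ‖f x‖ * x ^ (-s.re)) (Set.Ioi 0)) :
    HasMellin (fun t => 2 * ∫ x in Set.Ioi (0 : ℝ), (gauss t x : ℂ) * f x) s
      (Gammaℝ s * ∫ x in Set.Ioi (0 : ℝ), f x * (x : ℂ) ^ (-s)) := by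
  set μ := (volume : Measure ℝ).restrict (Set.Ioi 0) with hμ
  set H : ℝ → ℝ → ℂ := fun t x => (t : ℂ) ^ (s - 1) * (2 * ((gauss t x : ℂ) * f x)) with hH
  have hpos : ∀ᵐ x ∂μ, 0 < x := ae_restrict_mem measurableSet_Ioi
  have hHm : AEStronglyMeasurable (Function.uncurry H) (μ.prod μ) := by
    refine AEStronglyMeasurable.mul ?_ ((AEStronglyMeasurable.mul ?_ ?_).const_mul 2)
    · have : AEStronglyMeasurable (fun t : ℝ => (t : ℂ) ^ (s - 1)) μ :=
        ((measurable_ofReal).pow_const _).aestronglyMeasurable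
      exact this.comp_fst
    · refine Continuous.aestronglyMeasurable ?_
      unfold gauss
      fun_prop
    · exact hf.comp_snd
  have hnorm : ∀ᵐ x ∂μ, Integrable (fun t => H t x) μ ∧
      ∫ t, ‖H t x‖ ∂μ = ‖f x‖ * x ^ (-s.re) * ‖Gammaℝ s.re‖ := by
    filter_upwards [hpos] with x hx
    have h1 := hasMellin_gauss hs hx
    have h2 := hasMellin_gauss (s := (s.re : ℂ)) (by simpa using hs) hx
    refine ⟨?_, ?_⟩
    · have := h1.1.mul_const (2 * f x)
      refine this.congr (Filter.Eventually.of_forall fun t => ?_)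
      simp only [hH, smul_eq_mul]
      ring
    · have e1 : ∫ t, ‖(t : ℂ) ^ (s - 1) * (gauss t x : ℂ)‖ ∂μ =
          ‖mellin (fun t => (gauss t x : ℂ)) s.re‖ := by
        have e2 : mellin (fun t => (gauss t x : ℂ)) s.re =
            ((∫ t, ‖(t : ℂ) ^ (s - 1) * (gauss t x : ℂ)‖ ∂μ : ℝ) : ℂ) := by
          rw [← integral_complex_ofReal, mellin]
          refine integral_congr_ae ?_
          filter_upwards [hpos] with t ht
          rw [norm_mul, norm_cpow_eq_rpow_re_of_pos ht, norm_real,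
            Real.norm_of_nonneg (gauss_pos t x).le, sub_re, one_re, ofReal_mul,
            ofReal_cpow ht.le, smul_eq_mul]
          push_cast
          rfl
        rw [e2, norm_real, Real.norm_of_nonneg (integral_nonneg fun _ => norm_nonneg _)]
      have e3 : ∀ t, ‖H t x‖ = ‖(t : ℂ) ^ (s - 1) * (gauss t x : ℂ)‖ * (2 * ‖f x‖) := by
        intro t
        simp only [hH, norm_mul, norm_ofNat]
        ring
      simp only [e3]
      rw [integral_mul_const, e1, h2.2, norm_mul, norm_div, norm_cpow_eq_rpow_re_of_pos hx]
      simp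
      ring
  have hHi : Integrable (Function.uncurry H) (μ.prod μ) := by
    rw [integrable_prod_iff' hHm]
    refine ⟨hnorm.mono fun x hx => hx.1, ?_⟩
    refine (hfi.mul_const ‖Gammaℝ s.re‖).congr ?_
    filter_upwards [hnorm] with x hx
    exact hx.2.symm
  have hin : ∀ t : ℝ, ∫ x, H t x ∂μ =
      (t : ℂ) ^ (s - 1) • (2 * ∫ x in Set.Ioi (0 : ℝ), (gauss t x : ℂ) * f x) := by
    intro t
    simp only [hH]
    rw [integral_const_mul, integral_const_mul, smul_eq_mul]
  refine ⟨?_, ?_⟩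
  · have := hHi.integral_prod_left
    exact this.congr (Filter.Eventually.of_forall hin)
  · have h1 := integral_integral_swap hHi
    simp only [hin] at h1
    rw [mellin, h1, ← integral_const_mul]
    refine integral_congr_ae ?_
    filter_upwards [hpos] with x hx
    have h2 := (hasMellin_gauss hs hx).2
    have e : ∀ t : ℝ, H t x = (t : ℂ) ^ (s - 1) • (gauss t x : ℂ) * (2 * f x) := fun t => by
      simp only [hH, smul_eq_mul]; ring
    simp only [e]
    rw [integral_mul_const]
    have h3 : ∫ t, (t : ℂ) ^ (s - 1) • (gauss t x : ℂ) ∂μ = mellin (fun t => (gauss t x : ℂ)) s := rfl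
    rw [h3, h2]
    ring

/-! ### Mellin transforms of the Gaussian tails -/

theorem gaussTail_isBigO_top (f : HalfLineL2) {a : ℂ}
    (ha : ∀ᵐ x ∂(volume.restrict (Set.Ioo (0 : ℝ) 1)), f x = a) :
    gaussTail f a =O[Filter.atTop] fun t => Real.exp (-1 * t) := by
  obtain ⟨C, -, hC⟩ := exists_norm_gaussTail_le
  refine Asymptotics.IsBigO.of_bound (C * ‖f‖) (Filter.Eventually.of_forall fun t => ?_)
  rw [Real.norm_of_nonneg (Real.exp_pos _).le, neg_one_mul]
  exact hC f a ha t

theorem gaussTail_isBigO_zero (f : HalfLineL2) (a : ℂ) (b : ℝ) :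
    gaussTail f a =O[𝓝[>] 0] fun t : ℝ => t ^ (-b) := by
  have : gaussTail f a =ᶠ[𝓝[>] 0] fun _ => 0 := by
    filter_upwards [nhdsWithin_le_nhds (Iio_mem_nhds one_pos)] with t ht
    exact gaussTail_of_le (le_of_lt ht)
  exact this.trans_isBigO (Asymptotics.isBigO_zero _ _)

theorem locallyIntegrableOn_gaussTail (f : HalfLineL2) {a : ℂ}
    (ha : ∀ᵐ x ∂(volume.restrict (Set.Ioo (0 : ℝ) 1)), f x = a) :
    LocallyIntegrableOn (gaussTail f a) (Set.Ioi 0) := by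
  obtain ⟨C, hC0, hC⟩ := exists_norm_gaussTail_le
  have : Integrable (gaussTail f a) := by
    have h1 : IntegrableOn (fun t : ℝ => C * ‖f‖ * Real.exp (-t)) (Set.Ioi 1) :=
      (integrableOn_exp_neg_Ioi 1).const_mul _
    have h2 : IntegrableOn (gaussTail f a) (Set.Ioi 1) :=
      Integrable.mono' h1 (stronglyMeasurable_gaussTail f a).aestronglyMeasurable
        (Filter.Eventually.of_forall fun t => hC f a ha t)
    have h3 : (Set.Ioi (1 : ℝ)).indicator (gaussTail f a) = gaussTail f a := by
      rw [gaussTail, Set.indicator_indicator, Set.inter_self]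
    rw [← h3]
    exact (integrable_indicator_iff measurableSet_Ioi).2 h2
  exact this.locallyIntegrable.locallyIntegrableOn _

theorem mellinConvergent_gaussTail (f : HalfLineL2) {a : ℂ}
    (ha : ∀ᵐ x ∂(volume.restrict (Set.Ioo (0 : ℝ) 1)), f x = a) (s : ℂ) :
    MellinConvergent (gaussTail f a) s :=
  mellinConvergent_of_isBigO_rpow_exp one_pos (locallyIntegrableOn_gaussTail f ha)
    (gaussTail_isBigO_top f ha) (gaussTail_isBigO_zero f a (s.re - 1)) (by linarith)

theorem differentiable_mellin_gaussTail (f : HalfLineL2) {a : ℂ}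
    (ha : ∀ᵐ x ∂(volume.restrict (Set.Ioo (0 : ℝ) 1)), f x = a) :
    Differentiable ℂ (mellin (gaussTail f a)) := fun s =>
  mellin_differentiableAt_of_isBigO_rpow_exp one_pos (locallyIntegrableOn_gaussTail f ha)
    (gaussTail_isBigO_top f ha) (gaussTail_isBigO_zero f a (s.re - 1)) (by linarith)

/-- The Mellin transforms of the Gaussian tails are bounded on left half-planes. -/
theorem exists_norm_mellin_gaussTail_le (b : ℝ) : ∃ C > 0, ∀ (f : HalfLineL2) (a : ℂ),
    (∀ᵐ x ∂(volume.restrict (Set.Ioo (0 : ℝ) 1)), f x = a) → ∀ s : ℂ, s.re ≤ b →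
    ‖mellin (gaussTail f a) s‖ ≤ C * ‖f‖ := by
  obtain ⟨C, hC0, hC⟩ := exists_norm_gaussTail_le
  set b' := max b 1 with hb'
  have hb0 : 0 < b' := lt_max_of_lt_right one_pos
  set J := ∫ t in Set.Ioi (0 : ℝ), Real.exp (-t) * t ^ (b' - 1) with hJ
  have hJi : IntegrableOn (fun t : ℝ => Real.exp (-t) * t ^ (b' - 1)) (Set.Ioi 0) :=
    Real.GammaIntegral_convergent hb0
  have hJ0 : 0 ≤ J := setIntegral_nonneg measurableSet_Ioi fun t ht =>
    mul_nonneg (Real.exp_pos _).le (Real.rpow_nonneg (le_of_lt ht) _)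
  refine ⟨C * J + 1, by positivity, fun f a ha s hs => ?_⟩
  have h1 : ‖mellin (gaussTail f a) s‖ ≤
      ∫ t in Set.Ioi (0 : ℝ), C * ‖f‖ * (Real.exp (-t) * t ^ (b' - 1)) := by
    refine norm_integral_le_of_norm_le (hJi.const_mul _)
      ((ae_restrict_iff' measurableSet_Ioi).2 (Filter.Eventually.of_forall fun t ht => ?_))
    have ht0 : 0 < t := ht
    rw [norm_smul, norm_cpow_eq_rpow_re_of_pos ht0, sub_re, one_re]
    rcases le_or_gt t 1 with h | h
    · rw [gaussTail_of_le h, norm_zero, mul_zero]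
      positivity
    · have h2 : t ^ (s.re - 1) ≤ t ^ (b' - 1) :=
        Real.rpow_le_rpow_of_exponent_le h.le (by linarith [le_max_left b 1])
      calc t ^ (s.re - 1) * ‖gaussTail f a t‖
          ≤ t ^ (b' - 1) * (C * ‖f‖ * Real.exp (-t)) := by
            gcongr
            exact hC f a ha t
        _ = _ := by ring
  rw [integral_const_mul] at h1
  refine h1.trans ?_
  nlinarith [norm_nonneg f]

end BurnolZeta

/-! ### Analytic continuation of the elements of `L` -/

namespace BurnolZeta

open Complex

/-- A pair of functions in `L²(0,∞)`, constant on `(0, 1)`, that correspond to each other under the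
cosine transform; the latter is recorded by the functional equation of the Gaussian transforms, a
relation that is symmetric in the two functions. -/
structure CosinePair where
  /-- the first function -/
  f : HalfLineL2
  /-- the second function -/
  f' : HalfLineL2
  /-- the constant value of the first function on `(0, 1)` -/
  a : ℂ
  /-- the constant value of the second function on `(0, 1)` -/
  a' : ℂ
  hf : ∀ᵐ x ∂(volume.restrict (Set.Ioo (0 : ℝ) 1)), f x = a
  hf' : ∀ᵐ x ∂(volume.restrict (Set.Ioo (0 : ℝ) 1)), f' x = a'
  feq : ∀ t : ℝ, 0 < t → gaussTransform f t = (t : ℂ)⁻¹ * gaussTransform f' t⁻¹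

/-- A function in the domain of the space `L`, paired with its cosine transform. -/
theorem exists_cosinePair {f : HalfLineL2}
    (hf : f ∈ constantNearZero ⊓ constantNearZero.comap cosineTransform) :
    ∃ p : CosinePair, p.f = f ∧ p.f' = cosineTransform f := by
  obtain ⟨⟨a, ha⟩, ⟨b, hb⟩⟩ := hf
  exact ⟨⟨f, cosineTransform f, a, b, ha, hb, fun t ht => gaussTransform_cosineTransform f ht⟩,
    rfl, rfl⟩

namespace CosinePair

variable (p : CosinePair)

/-- The pair in the reverse order. -/
def swap : CosinePair where
  f := p.f'
  f' := p.f
  a := p.a'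
  a' := p.a
  hf := p.hf'
  hf' := p.hf
  feq t ht := by
    rw [p.feq t⁻¹ (inv_pos.2 ht), inv_inv]
    have : (t : ℂ) ≠ 0 := ofReal_ne_zero.2 ht.ne'
    push_cast
    field_simp

/-- The entire part of the completed Mellin transform `Γ_ℝ(s) f̂(s)`. -/
noncomputable def lam (s : ℂ) : ℂ :=
  mellin (gaussTail p.f p.a) s + mellin (gaussTail p.f' p.a') (1 - s)

theorem swap_lam (s : ℂ) : p.swap.lam s = p.lam (1 - s) := by
  simp only [lam, swap, sub_sub_cancel]
  rw [add_comm]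

theorem differentiable_lam : Differentiable ℂ p.lam := by
  have h1 := differentiable_mellin_gaussTail p.f p.hf
  have h2 := differentiable_mellin_gaussTail p.f' p.hf'
  exact h1.add (h2.comp (differentiable_id.const_sub 1))

/-- The entire function `s (1 - s) Γ_ℝ(s) f̂(s)`. -/
noncomputable def completed (s : ℂ) : ℂ := s * (1 - s) * p.lam s + p.a * s + p.a' * (1 - s)

theorem swap_completed (s : ℂ) : p.swap.completed s = p.completed (1 - s) := by
  simp only [completed, swap_lam, sub_sub_cancel]
  simp only [swap]
  ring

theorem differentiable_completed : Differentiable ℂ p.completed := by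
  have := p.differentiable_lam
  unfold completed
  fun_prop

/-- The entire function `(1 - s) f̂(s)`. In the last term `1 / (s Γ_ℝ(s))` is written as
`1 / (2π Γ_ℝ(s + 2))`, which is regular at `s = 0`. -/
noncomputable def numerator (s : ℂ) : ℂ :=
  (1 - s) * p.lam s * (Gammaℝ s)⁻¹ + p.a * (Gammaℝ s)⁻¹ +
    p.a' * (1 - s) * ((Gammaℝ (s + 2))⁻¹ * (2 * Real.pi : ℂ)⁻¹)

theorem differentiable_numerator : Differentiable ℂ p.numerator := by
  have h1 := p.differentiable_lam
  have h2 := differentiable_Gammaℝ_inv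
  have h3 : Differentiable ℂ fun s => (Gammaℝ (s + 2))⁻¹ :=
    h2.comp (differentiable_id.add_const 2)
  unfold numerator
  fun_prop

/-- The meromorphic continuation of the Mellin transform of the first function of the pair. -/
noncomputable def ext (s : ℂ) : ℂ := p.numerator s / (1 - s)

theorem differentiableOn_ext : DifferentiableOn ℂ p.ext {1}ᶜ := fun s hs =>
  ((p.differentiable_numerator s).div ((differentiableAt_const 1).sub differentiableAt_id)
    (sub_ne_zero.2 (Ne.symm hs))).differentiableWithinAt

theorem meromorphicAt_ext : MeromorphicAt p.ext 1 :=
  (p.differentiable_numerator.analyticAt 1).meromorphicAt.div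
    (((differentiable_const 1).sub differentiable_id).analyticAt 1).meromorphicAt

theorem numerator_eq {s : ℂ} (hs : s ≠ 0) : s * p.numerator s = (Gammaℝ s)⁻¹ * p.completed s := by
  rw [numerator, completed, Gammaℝ_add_two hs]
  have : (Real.pi : ℂ) ≠ 0 := ofReal_ne_zero.2 Real.pi_ne_zero
  have e : (Gammaℝ s * s / 2 / Real.pi)⁻¹ * (2 * Real.pi : ℂ)⁻¹ = (Gammaℝ s)⁻¹ * s⁻¹ := by
    by_cases hG : Gammaℝ s = 0
    · simp [hG]
    · field_simp
  rw [e]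
  field_simp

theorem completed_eq {s : ℂ} (h0 : s ≠ 0) (h1 : s ≠ 1) (hG : Gammaℝ s ≠ 0) :
    p.completed s = s * (1 - s) * Gammaℝ s * p.ext s := by
  have h2 : 1 - s ≠ 0 := sub_ne_zero.2 h1.symm
  have h3 := p.numerator_eq h0
  rw [ext]
  field_simp
  rw [mul_right_comm, h3]
  field_simp

/-- The completed Mellin transform in the strip `1/2 < re s < 1`. -/
theorem Gammaℝ_mul_integral_eq {s : ℂ} (h1 : 1 / 2 < s.re) (h2 : s.re < 1)
    (hi : IntegrableOn (fun x : ℝ => ‖p.f x‖ * x ^ (-s.re)) (Set.Ioi 0)) :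
    Gammaℝ s * ∫ x in Set.Ioi (0 : ℝ), p.f x * (x : ℂ) ^ (-s) =
      p.lam s + p.a / (1 - s) + p.a' / s := by
  have hs : 0 < s.re := by linarith
  have hm := hasMellin_gaussTransform hs (Lp.aestronglyMeasurable p.f) hi
  rw [← hm.2]
  set T := gaussTail p.f p.a
  set T' := gaussTail p.f' p.a'
  -- On `t < 1` the functional equation reduces the Gaussian transform to the other tail.
  set k₁ : ℝ → ℂ := fun t => (t : ℂ) ^ (-1 : ℂ) • T' t⁻¹
  set k₂ : ℝ → ℂ := (Set.Ioi 1).indicator fun t => p.a * (t : ℂ) ^ (-1 : ℂ)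
  set k₃ : ℝ → ℂ := fun t => p.a' • (Set.Ioc 0 1).indicator (fun _ => (1 : ℂ)) t
  have e : ∀ᵐ t ∂(volume.restrict (Set.Ioi (0 : ℝ))),
      gaussTransform p.f t = ((T t + k₁ t) + k₂ t) + k₃ t := by
    have hne : ∀ᵐ t ∂(volume.restrict (Set.Ioi (0 : ℝ))), t ≠ 1 :=
      ae_restrict_of_ae (by simp [ae_iff])
    filter_upwards [hne, ae_restrict_mem measurableSet_Ioi] with t ht1 ht0
    have ht0' : 0 < t := ht0
    have htc : (t : ℂ) ≠ 0 := ofReal_ne_zero.2 ht0'.ne'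
    rcases lt_or_gt_of_ne ht1 with h | h
    · have hinv : 1 < t⁻¹ := (one_lt_inv₀ ht0').2 h
      rw [p.feq t ht0', gaussTransform_eq p.hf' hinv]
      have hk2 : k₂ t = 0 := Set.indicator_of_notMem (by simpa using h.le) _
      have hk3 : k₃ t = p.a' := by
        simp only [k₃]
        rw [Set.indicator_of_mem (show t ∈ Set.Ioc (0 : ℝ) 1 from ⟨ht0', h.le⟩)]
        simp
      have hT : T t = 0 := gaussTail_of_le h.le
      rw [hk2, hk3, hT]
      simp only [k₁, cpow_neg_one, smul_eq_mul]
      push_cast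
      field_simp
      ring
    · have hinv : t⁻¹ ≤ 1 := (inv_le_one₀ ht0').2 h.le
      rw [gaussTransform_eq p.hf h]
      have hk2 : k₂ t = p.a * (t : ℂ) ^ (-1 : ℂ) := Set.indicator_of_mem h _
      have hk3 : k₃ t = 0 := by
        simp only [k₃]
        rw [Set.indicator_of_notMem (by simp [h])]
        simp
      have hk1 : k₁ t = 0 := by
        simp only [k₁]
        rw [show T' t⁻¹ = 0 from gaussTail_of_le hinv, smul_zero]
      rw [hk1, hk2, hk3, cpow_neg_one]
      simp only [T]
      ring
  have m0 : MellinConvergent T s := mellinConvergent_gaussTail p.f p.hf s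
  have m1 : HasMellin k₁ s (mellin T' (1 - s)) := by
    constructor
    · have : MellinConvergent (fun t => T' t⁻¹) (s + -1) := by
        have h3 : MellinConvergent T' ((s + -1) / ((-1 : ℝ) : ℂ)) :=
          mellinConvergent_gaussTail p.f' p.hf' _
        have h4 := (MellinConvergent.comp_rpow (f := T') (s := s + -1)
          (show (-1 : ℝ) ≠ 0 by norm_num)).2 h3
        simpa only [Real.rpow_neg_one] using h4
      exact MellinConvergent.cpow_smul.2 this
    · rw [mellin_cpow_smul, mellin_comp_inv]
      congr 1
      ring
  have m2 : HasMellin k₂ s (p.a / (1 - s)) := by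
    have hre : (s - 2).re < -1 := by simp; linarith
    have h3 := integrableOn_Ioi_cpow_of_lt hre one_pos
    have h4 := integral_Ioi_cpow_of_lt hre one_pos
    have h5 : ∀ t : ℝ, (t : ℂ) ^ (s - 1) • k₂ t =
        (Set.Ioi (1 : ℝ)).indicator (fun t : ℝ => p.a * (t : ℂ) ^ (s - 2)) t := by
      intro t
      by_cases ht : t ∈ Set.Ioi (1 : ℝ)
      · have htc : (t : ℂ) ≠ 0 :=
          ofReal_ne_zero.2 (ne_of_gt (zero_lt_one.trans (Set.mem_Ioi.1 ht)))
        simp only [k₂]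
        rw [Set.indicator_of_mem ht, Set.indicator_of_mem ht, smul_eq_mul, mul_left_comm,
          ← cpow_add _ _ htc]
        congr 2
        ring
      · simp only [k₂]
        rw [Set.indicator_of_notMem ht, Set.indicator_of_notMem ht, smul_zero]
    have hsub : Set.Ioi (1 : ℝ) ⊆ Set.Ioi 0 := Set.Ioi_subset_Ioi zero_le_one
    constructor
    · rw [MellinConvergent]
      simp only [h5]
      rw [IntegrableOn, integrable_indicator_iff measurableSet_Ioi, IntegrableOn,
        Measure.restrict_restrict_of_subset hsub]
      exact h3.const_mul _
    · rw [mellin]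
      simp only [h5]
      rw [setIntegral_indicator measurableSet_Ioi, Set.inter_eq_right.2 hsub, integral_const_mul, h4]
      have h6 : 1 - s ≠ 0 := fun h => by
        have := congrArg re h
        simp at this
        linarith
      have h7 : s - 2 + 1 = -(1 - s) := by ring
      rw [h7, ofReal_one, one_cpow]
      field_simp
  have m3 : HasMellin k₃ s (p.a' / s) := by
    have h3 := hasMellin_one_Ioc hs
    have h4 := hasMellin_const_smul h3.1 p.a'
    rw [h3.2, smul_eq_mul, mul_one_div] at h4
    exact h4
  have s1 := hasMellin_add m0 m1.1
  have s2 := hasMellin_add s1.1 m2.1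
  have s3 := hasMellin_add s2.1 m3.1
  have hfin : mellin (gaussTransform p.f) s =
      mellin (fun t => ((T t + k₁ t) + k₂ t) + k₃ t) s := by
    refine integral_congr_ae ?_
    filter_upwards [e] with t ht
    rw [ht]
  have hdef : (fun t => 2 * ∫ x in Set.Ioi (0 : ℝ), (gauss t x : ℂ) * p.f x) =
      gaussTransform p.f := rfl
  rw [hdef, hfin, s3.2, s2.2, s1.2, m1.2, m2.2, m3.2]
  rfl

end CosinePair

end BurnolZeta

/-! ### The Mellin integral to the right of the critical line, and growth estimates -/

namespace BurnolZeta

open Complex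

/-- The integral `∫_1^∞ f(x) x^{-s} dx`, which converges for `re s > 1/2`. -/
noncomputable def rightMellin (f : HalfLineL2) (s : ℂ) : ℂ :=
  ∫ x in Set.Ioi (1 : ℝ), f x * (x : ℂ) ^ (-s)

theorem integrableOn_norm_mul_rpow (f : HalfLineL2) {σ : ℝ} (hσ : 1 / 2 < σ) :
    IntegrableOn (fun x => ‖f x‖ * x ^ (-σ)) (Set.Ioi 1) ∧
      ∫ x in Set.Ioi (1 : ℝ), ‖f x‖ * x ^ (-σ) ≤ ‖f‖ / √(2 * σ - 1) := by
  have hsub : Set.Ioi (1 : ℝ) ⊆ Set.Ioi 0 := Set.Ioi_subset_Ioi zero_le_one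
  set g : ℝ → ℝ := (Set.Ioi 1).indicator fun x => x ^ (-σ) with hg
  have hlt : -(2 * σ) < -1 := by linarith
  have hg2 : ∀ x, ‖g x‖ ^ 2 = (Set.Ioi 1).indicator (fun x : ℝ => x ^ (-(2 * σ))) x := by
    intro x
    by_cases hx : x ∈ Set.Ioi (1 : ℝ)
    · have hx0 : 0 < x := zero_lt_one.trans hx
      rw [hg, Set.indicator_of_mem hx, Set.indicator_of_mem hx, Real.norm_eq_abs, sq_abs,
        ← Real.rpow_natCast, ← Real.rpow_mul hx0.le]
      congr 1
      push_cast
      ring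
    · rw [hg, Set.indicator_of_notMem hx, Set.indicator_of_notMem hx]
      simp
  have hgm : AEStronglyMeasurable g (volume.restrict (Set.Ioi 0)) := by
    refine (Measurable.indicator ?_ measurableSet_Ioi).aestronglyMeasurable
    fun_prop
  have hgL : MemLp g 2 (volume.restrict (Set.Ioi (0 : ℝ))) := by
    rw [memLp_two_iff_integrable_sq_norm hgm]
    simp only [hg2]
    rw [integrable_indicator_iff measurableSet_Ioi, IntegrableOn,
      Measure.restrict_restrict_of_subset hsub]
    exact integrableOn_Ioi_rpow_of_lt hlt one_pos
  have hI : ∫ x in Set.Ioi (0 : ℝ), ‖g x‖ ^ 2 = (2 * σ - 1)⁻¹ := by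
    simp only [hg2]
    rw [setIntegral_indicator measurableSet_Ioi, Set.inter_eq_right.2 hsub,
      integral_Ioi_rpow_of_lt hlt one_pos, Real.one_rpow]
    rw [show -(2 * σ) + 1 = -(2 * σ - 1) by ring, neg_div_neg_eq, one_div]
  have e : ∀ x, ‖f x‖ * ‖g x‖ = (Set.Ioi 1).indicator (fun x => ‖f x‖ * x ^ (-σ)) x := by
    intro x
    by_cases hx : x ∈ Set.Ioi (1 : ℝ)
    · have hx0 : 0 < x := zero_lt_one.trans hx
      rw [hg, Set.indicator_of_mem hx, Set.indicator_of_mem hx,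
        Real.norm_of_nonneg (Real.rpow_nonneg hx0.le _)]
    · rw [hg, Set.indicator_of_notMem hx, Set.indicator_of_notMem hx]
      simp
  have hi : IntegrableOn (fun x => ‖f x‖ * ‖g x‖) (Set.Ioi 0) :=
    (Lp.memLp f).norm.integrable_mul hgL.norm
  have hCS := integral_norm_mul_norm_sq_le f hgL
  simp only [e] at hi hCS
  rw [IntegrableOn, integrable_indicator_iff measurableSet_Ioi, IntegrableOn,
    Measure.restrict_restrict_of_subset hsub] at hi
  rw [setIntegral_indicator measurableSet_Ioi, Set.inter_eq_right.2 hsub, hI] at hCS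
  refine ⟨hi, le_of_sq_le_sq ?_ (by positivity)⟩
  rwa [div_pow, Real.sq_sqrt (by linarith), div_eq_mul_inv]

theorem norm_mul_cpow_neg (z s : ℂ) {x : ℝ} (hx : 1 < x) :
    ‖z * (x : ℂ) ^ (-s)‖ = ‖z‖ * x ^ (-s.re) := by
  rw [norm_mul, norm_cpow_eq_rpow_re_of_pos (zero_lt_one.trans hx), neg_re]

theorem aestronglyMeasurable_mul_cpow (f : HalfLineL2) (s : ℂ) :
    AEStronglyMeasurable (fun x : ℝ => f x * (x : ℂ) ^ (-s)) (volume.restrict (Set.Ioi 0)) := by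
  refine (Lp.aestronglyMeasurable f).mul (Measurable.aestronglyMeasurable ?_)
  fun_prop

theorem integrableOn_mul_cpow (f : HalfLineL2) {s : ℂ} (hs : 1 / 2 < s.re) :
    IntegrableOn (fun x : ℝ => f x * (x : ℂ) ^ (-s)) (Set.Ioi 1) := by
  refine (integrableOn_norm_mul_rpow f hs).1.mono'
    ((aestronglyMeasurable_mul_cpow f s).mono_set (Set.Ioi_subset_Ioi zero_le_one)) ?_
  filter_upwards [ae_restrict_mem measurableSet_Ioi] with x hx
  exact (norm_mul_cpow_neg _ _ hx).le

theorem norm_rightMellin_le (f : HalfLineL2) {s : ℂ} (hs : 1 / 2 < s.re) :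
    ‖rightMellin f s‖ ≤ ‖f‖ / √(2 * s.re - 1) := by
  have h := integrableOn_norm_mul_rpow f hs
  refine le_trans (norm_integral_le_of_norm_le h.1 ?_) h.2
  filter_upwards [ae_restrict_mem measurableSet_Ioi] with x hx
  exact (norm_mul_cpow_neg _ _ hx).le

theorem differentiableAt_rightMellin (f : HalfLineL2) {s : ℂ} (hs : 1 / 2 < s.re) :
    DifferentiableAt ℂ (rightMellin f) s := by
  set ε := (s.re - 1 / 2) / 2 with hε
  have hε0 : 0 < ε := by rw [hε]; linarith
  have hsub : Set.Ioi (1 : ℝ) ⊆ Set.Ioi 0 := Set.Ioi_subset_Ioi zero_le_one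
  have hb := (integrableOn_norm_mul_rpow f (σ := 1 / 2 + ε / 2) (by linarith)).1.mul_const (2 / ε)
  refine (hasDerivAt_integral_of_dominated_loc_of_deriv_le (Metric.ball_mem_nhds s hε0)
    (F' := fun z x => f x * ((x : ℂ) ^ (-z) * Complex.log x * -1))
    (Filter.Eventually.of_forall fun z => (aestronglyMeasurable_mul_cpow f z).mono_set hsub)
    (integrableOn_mul_cpow f hs) ?_ ?_ hb ?_).2.differentiableAt
  · refine ((Lp.aestronglyMeasurable f).mono_set hsub).mul (Measurable.aestronglyMeasurable ?_)
    fun_prop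
  · filter_upwards [ae_restrict_mem measurableSet_Ioi] with x hx z hz
    have hx1 : 1 < x := hx
    have hx0 : 0 < x := by linarith
    have hz1 : 1 / 2 + ε ≤ z.re := by
      have h1 : |(z - s).re| ≤ ‖z - s‖ := abs_re_le_norm _
      have h2 : ‖z - s‖ < ε := by simpa [dist_eq_norm] using hz
      have h3 := (abs_le.1 h1).1
      simp only [sub_re] at h3
      linarith
    have hl : Real.log x ≤ x ^ (ε / 2) / (ε / 2) := Real.log_le_rpow_div hx0.le (by positivity)
    have hl0 : 0 ≤ Real.log x := Real.log_nonneg hx1.le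
    rw [norm_mul, norm_mul, norm_mul, norm_cpow_eq_rpow_re_of_pos hx0, ← ofReal_log hx0.le,
      norm_real, Real.norm_of_nonneg hl0, norm_neg, norm_one, mul_one, neg_re, mul_assoc]
    refine mul_le_mul_of_nonneg_left ?_ (norm_nonneg _)
    calc x ^ (-z.re) * Real.log x ≤ x ^ (-(1 / 2 + ε)) * (x ^ (ε / 2) / (ε / 2)) := by
          gcongr
          exact hx1.le
      _ = x ^ (-(1 / 2 + ε / 2)) * (2 / ε) := by
          rw [mul_div_assoc', ← Real.rpow_add hx0, div_div_eq_mul_div, mul_div_assoc]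
          congr 2
          ring
  · filter_upwards [ae_restrict_mem measurableSet_Ioi] with x hx z hz
    have hx0 : (x : ℂ) ≠ 0 := ofReal_ne_zero.2 (zero_lt_one.trans hx).ne'
    exact ((hasDerivAt_neg z).const_cpow (Or.inl hx0)).const_mul _

theorem integrableOn_Ioc_cpow {s : ℂ} (hs : s.re < 1) :
    IntegrableOn (fun x : ℝ => (x : ℂ) ^ (-s)) (Set.Ioc 0 1) ∧
      ∫ x in Set.Ioc (0 : ℝ) 1, (x : ℂ) ^ (-s) = (1 - s)⁻¹ := by
  have h1 : -1 < (-s).re := by simp; linarith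
  have hne : -s + 1 ≠ 0 := fun h => by
    have := congrArg re h
    simp at this
    linarith
  refine ⟨(intervalIntegrable_iff_integrableOn_Ioc_of_le zero_le_one).1
    (intervalIntegral.intervalIntegrable_cpow' h1), ?_⟩
  rw [← intervalIntegral.integral_of_le zero_le_one, integral_cpow (Or.inl h1)]
  rw [ofReal_one, one_cpow, ofReal_zero, zero_cpow hne, sub_zero, neg_add_eq_sub, one_div]

namespace CosinePair

variable (p : CosinePair)

theorem ae_eq_Ioc : ∀ᵐ x ∂(volume.restrict (Set.Ioc (0 : ℝ) 1)), p.f x = p.a := by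
  rw [← Measure.restrict_congr_set Ioo_ae_eq_Ioc]
  exact p.hf

theorem integral_Ioi_eq {s : ℂ} (h1 : 1 / 2 < s.re) (h2 : s.re < 1) :
    IntegrableOn (fun x : ℝ => p.f x * (x : ℂ) ^ (-s)) (Set.Ioi 0) ∧
    ∫ x in Set.Ioi (0 : ℝ), p.f x * (x : ℂ) ^ (-s) = p.a / (1 - s) + rightMellin p.f s := by
  have e : (fun x : ℝ => p.f x * (x : ℂ) ^ (-s)) =ᵐ[volume.restrict (Set.Ioc 0 1)]
      fun x : ℝ => p.a * (x : ℂ) ^ (-s) := by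
    filter_upwards [p.ae_eq_Ioc] with x hx
    rw [hx]
  have h3 := integrableOn_Ioc_cpow h2
  have hi : IntegrableOn (fun x : ℝ => p.f x * (x : ℂ) ^ (-s)) (Set.Ioi 0) := by
    refine IntegrableOn.mono_set (IntegrableOn.union ((h3.1.const_mul p.a).congr e.symm)
      (integrableOn_mul_cpow p.f h1)) ?_
    rw [Set.Ioc_union_Ioi_eq_Ioi (zero_le_one (α := ℝ))]
  refine ⟨hi, ?_⟩
  rw [setIntegral_Ioi_zero_split hi, integral_congr_ae e, integral_const_mul, h3.2, rightMellin,
    div_eq_mul_inv]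

/-- In the half-plane `re s > 1/2` the continuation is given by a convergent integral. -/
theorem numerator_eq_rightMellin {s : ℂ} (hs : 1 / 2 < s.re) :
    p.numerator s = p.a + (1 - s) * rightMellin p.f s := by
  have hU : IsOpen {s : ℂ | 1 / 2 < s.re} := isOpen_lt continuous_const continuous_re
  have hpre : IsPreconnected {s : ℂ | 1 / 2 < s.re} :=
    (convex_halfSpace_re_gt (1 / 2)).isPreconnected
  have hA : AnalyticOnNhd ℂ p.numerator {s : ℂ | 1 / 2 < s.re} := fun z _ =>
    p.differentiable_numerator.analyticAt z
  have hB : AnalyticOnNhd ℂ (fun s => p.a + (1 - s) * rightMellin p.f s)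
      {s : ℂ | 1 / 2 < s.re} := by
    refine DifferentiableOn.analyticOnNhd (fun z hz => ?_) hU
    have := differentiableAt_rightMellin p.f hz
    exact DifferentiableAt.differentiableWithinAt (by fun_prop)
  have h0 : ((3 / 4 : ℝ) : ℂ) ∈ {s : ℂ | 1 / 2 < s.re} := by
    simp only [Set.mem_ofPred_eq, ofReal_re]
    norm_num
  refine hA.eqOn_of_preconnected_of_eventuallyEq hB hpre h0 ?_ hs
  have hnhds : {s : ℂ | 1 / 2 < s.re ∧ s.re < 1} ∈ 𝓝 ((3 / 4 : ℝ) : ℂ) := by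
    refine (hU.inter (isOpen_lt continuous_re continuous_const)).mem_nhds ⟨h0, ?_⟩
    simp only [Set.mem_ofPred_eq, ofReal_re]
    norm_num
  filter_upwards [hnhds] with z hz
  have hz0 : z ≠ 0 := fun h => by
    have := hz.1
    rw [h] at this
    norm_num at this
  have hz1 : 1 - z ≠ 0 := fun h => by
    have h5 := congrArg re h
    have := hz.2
    simp at h5
    linarith
  have hG : Gammaℝ z ≠ 0 := Gammaℝ_ne_zero_of_re_pos (by linarith [hz.1])
  obtain ⟨hi, hI⟩ := p.integral_Ioi_eq hz.1 hz.2
  have hi' : IntegrableOn (fun x : ℝ => ‖p.f x‖ * x ^ (-z.re)) (Set.Ioi 0) := by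
    refine hi.norm.congr ?_
    filter_upwards [ae_restrict_mem measurableSet_Ioi] with x hx
    rw [norm_mul, norm_cpow_eq_rpow_re_of_pos hx, neg_re]
  have h3 := p.Gammaℝ_mul_integral_eq hz.1 hz.2 hi'
  rw [hI] at h3
  refine mul_left_cancel₀ hz0 ?_
  rw [p.numerator_eq hz0, completed]
  have h4 : p.lam z = Gammaℝ z * (p.a / (1 - z) + rightMellin p.f z) - p.a / (1 - z) - p.a' / z := by
    rw [h3]
    ring
  rw [h4]
  field_simp
  ring

theorem ext_eq_rightMellin {s : ℂ} (hs : 1 / 2 < s.re) (h1 : s ≠ 1) :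
    p.ext s = p.a / (1 - s) + rightMellin p.f s := by
  have : 1 - s ≠ 0 := sub_ne_zero.2 h1.symm
  rw [ext, p.numerator_eq_rightMellin hs]
  field_simp

theorem exists_norm_completed_le : ∃ A : ℝ, ∀ s : ℂ, -3 ≤ s.re → s.re ≤ 9 →
    ‖p.completed s‖ ≤ A * (1 + |s.im|) ^ 2 := by
  obtain ⟨C, hC, h⟩ := exists_norm_mellin_gaussTail_le 9
  set M := C * ‖p.f‖ + C * ‖p.f'‖ with hM
  have hM0 : 0 ≤ M := by positivity
  refine ⟨9 * 10 * M + 9 * ‖p.a‖ + 10 * ‖p.a'‖, fun s h1 h2 => ?_⟩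
  have hl : ‖p.lam s‖ ≤ M :=
    (norm_add_le _ _).trans (add_le_add (h _ _ p.hf s h2)
      (h _ _ p.hf' (1 - s) (by simp; linarith)))
  have ht := abs_nonneg s.im
  have hs : ‖s‖ ≤ 9 * (1 + |s.im|) := by
    have := norm_le_abs_re_add_abs_im s
    have : |s.re| ≤ 9 := abs_le.2 ⟨by linarith, h2⟩
    linarith
  have hs' : ‖1 - s‖ ≤ 10 * (1 + |s.im|) := by
    have := norm_sub_le 1 s
    rw [norm_one] at this
    linarith
  have hq : 1 + |s.im| ≤ (1 + |s.im|) ^ 2 := by nlinarith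
  calc ‖p.completed s‖ ≤ ‖s‖ * ‖1 - s‖ * ‖p.lam s‖ + ‖p.a‖ * ‖s‖ + ‖p.a'‖ * ‖1 - s‖ := by
        rw [completed, ← norm_mul, ← norm_mul, ← norm_mul, ← norm_mul]
        exact norm_add₃_le
    _ ≤ (9 * (1 + |s.im|)) * (10 * (1 + |s.im|)) * M + ‖p.a‖ * (9 * (1 + |s.im|) ^ 2) +
        ‖p.a'‖ * (10 * (1 + |s.im|) ^ 2) := by
        gcongr
        · exact hs.trans (by linarith)
        · exact hs'.trans (by linarith)
    _ = _ := by ring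

theorem exists_norm_completed_le_of_two_le : ∃ K : ℝ, ∀ s : ℂ, 2 ≤ s.re →
    ‖p.completed s‖ ≤ K / √s.re * ‖s * (1 - s) * Gammaℝ s‖ := by
  refine ⟨2 * ‖p.a‖ + ‖p.f‖, fun s hs => ?_⟩
  have h0 : s ≠ 0 := fun h => by
    rw [h, zero_re] at hs
    linarith
  have h1 : s ≠ 1 := fun h => by
    rw [h, one_re] at hs
    linarith
  rw [p.completed_eq h0 h1 (Gammaℝ_ne_zero_of_re_pos (by linarith)), norm_mul,
    mul_comm (_ / _)]
  refine mul_le_mul_of_nonneg_left ?_ (norm_nonneg _)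
  rw [p.ext_eq_rightMellin (by linarith) h1, add_div]
  have hsq : 0 < √s.re := Real.sqrt_pos.2 (by linarith)
  refine (norm_add_le _ _).trans (add_le_add ?_ ?_)
  · have h2 : √s.re / 2 ≤ ‖1 - s‖ := by
      have h3 : s.re - 1 ≤ ‖1 - s‖ := by
        rw [norm_sub_rev]
        simpa using re_le_norm (s - 1)
      have h4 : √s.re ≤ s.re := by
        rw [Real.sqrt_le_left (by linarith)]
        nlinarith
      linarith
    rw [norm_div, div_eq_mul_inv, show 2 * ‖p.a‖ / √s.re = ‖p.a‖ * (2 / √s.re) by ring]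
    refine mul_le_mul_of_nonneg_left ?_ (norm_nonneg _)
    calc ‖1 - s‖⁻¹ ≤ (√s.re / 2)⁻¹ := by gcongr
      _ = _ := by field_simp
  · refine (norm_rightMellin_le p.f (by linarith)).trans ?_
    gcongr
    linarith

/-- On bounded sets the continuation is controlled by the `L²` norms. -/
theorem exists_norm_numerator_le (R : ℝ) : ∃ C : ℝ, ∀ p : CosinePair, ∀ s : ℂ, ‖s‖ ≤ R →
    ‖p.numerator s‖ ≤ C * (‖p.f‖ + ‖p.f'‖) := by
  obtain ⟨C, hC, h⟩ := exists_norm_mellin_gaussTail_le (R + 1)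
  have hb : ∀ u : ℂ → ℂ, Continuous u → ∃ D : ℝ, 0 ≤ D ∧ ∀ s : ℂ, ‖s‖ ≤ R → ‖u s‖ ≤ D := by
    intro u hu
    obtain ⟨D, hD⟩ := (isCompact_closedBall (0 : ℂ) R).exists_bound_of_continuousOn hu.continuousOn
    exact ⟨max D 0, le_max_right _ _, fun s hs => (hD s (by simpa using hs)).trans (le_max_left _ _)⟩
  obtain ⟨D₁, hD₁, h₁⟩ := hb (fun s => (1 - s) * (Gammaℝ s)⁻¹) (by
    have := differentiable_Gammaℝ_inv.continuous
    fun_prop)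
  obtain ⟨D₂, hD₂, h₂⟩ := hb (fun s => (Gammaℝ s)⁻¹) differentiable_Gammaℝ_inv.continuous
  obtain ⟨D₃, hD₃, h₃⟩ := hb
    (fun s => (1 - s) * ((Gammaℝ (s + 2))⁻¹ * (2 * Real.pi : ℂ)⁻¹)) (by
    have : Continuous fun s => (Gammaℝ (s + 2))⁻¹ :=
      differentiable_Gammaℝ_inv.continuous.comp (continuous_id.add continuous_const)
    fun_prop)
  refine ⟨D₁ * C + D₂ + D₃, fun p s hs => ?_⟩
  have hre := abs_le.1 ((abs_re_le_norm s).trans hs)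
  have hl : ‖p.lam s‖ ≤ C * ‖p.f‖ + C * ‖p.f'‖ :=
    (norm_add_le _ _).trans (add_le_add (h _ _ p.hf s (by linarith))
      (h _ _ p.hf' (1 - s) (by simp; linarith)))
  have ha := norm_const_le p.hf
  have ha' := norm_const_le p.hf'
  have e : p.numerator s = ((1 - s) * (Gammaℝ s)⁻¹) * p.lam s + (Gammaℝ s)⁻¹ * p.a +
      ((1 - s) * ((Gammaℝ (s + 2))⁻¹ * (2 * Real.pi : ℂ)⁻¹)) * p.a' := by
    rw [numerator]
    ring
  rw [e]
  refine norm_add₃_le.trans ?_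
  rw [norm_mul, norm_mul (Gammaℝ s)⁻¹, norm_mul _ p.a']
  calc _ ≤ D₁ * (C * ‖p.f‖ + C * ‖p.f'‖) + D₂ * ‖p.f‖ + D₃ * ‖p.f'‖ := by
        gcongr
        · exact h₁ s hs
        · exact h₂ s hs
        · exact h₃ s hs
    _ ≤ _ := by nlinarith [mul_nonneg hD₂ (norm_nonneg p.f'), mul_nonneg hD₃ (norm_nonneg p.f)]

end CosinePair

end BurnolZeta

/-! ### The boundary values on the critical line -/

namespace BurnolZeta

open Complex FourierTransform Filter

theorem criticalPoint_re (τ : ℝ) : (criticalPoint τ).re = 1 / 2 := by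
  simp [criticalPoint]

theorem criticalPoint_im (τ : ℝ) : (criticalPoint τ).im = 2 * Real.pi * τ := by
  simp [criticalPoint]

theorem ofReal_exp_cpow (u : ℝ) (z : ℂ) : ((Real.exp u : ℝ) : ℂ) ^ z = Complex.exp (u * z) := by
  rw [cpow_def_of_ne_zero (ofReal_ne_zero.2 (Real.exp_pos u).ne'),
    ← ofReal_log (Real.exp_pos u).le, Real.log_exp]

/-- Where the integral converges absolutely, it gives the `L²` Mellin transform. -/
theorem mellinTransform_ae_eq_integral (f : HalfLineL2)
    (hi : IntegrableOn (fun x => ‖f x‖ * x ^ (-(1 / 2) : ℝ)) (Set.Ioi 0)) :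
    ∀ᵐ τ : ℝ, mellinTransform f τ =
      ∫ x in Set.Ioi (0 : ℝ), f x * (x : ℂ) ^ (-criticalPoint τ) := by
  set w : ℝ → ℂ := fun u => (Real.exp (u / 2) : ℂ) * f (Real.exp u) with hw
  have hwi : Integrable w := by
    have h := (integrable_comp_exp _).1 hi
    refine h.mono (memLp_exp f).1 (Eventually.of_forall fun u => le_of_eq ?_)
    have e : Real.exp u * Real.exp (-(u / 2)) = Real.exp (u / 2) := by
      rw [← Real.exp_add]
      congr 1
      ring
    simp only [hw, norm_mul, smul_eq_mul, norm_real, Real.norm_eq_abs, Real.abs_exp]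
    rw [← Real.exp_mul, Real.abs_exp, abs_of_nonneg (norm_nonneg _), ← e, show u * -(1 / 2) = -(u / 2) by ring]
    ring
  have h := fourierLp_toLp_ae_eq hwi (memLp_exp f)
  have e0 : mellinTransform f = Lp.fourierTransformₗᵢ ℝ ℂ ((memLp_exp f).toLp) := rfl
  rw [e0]
  filter_upwards [h] with τ hτ
  rw [hτ, Real.fourier_real_eq_integral_exp_smul, ← integral_comp_exp]
  refine integral_congr_ae (Eventually.of_forall fun u => ?_)
  simp only [hw, ofReal_exp_cpow, smul_eq_mul, real_smul]
  rw [ofReal_exp, ofReal_exp, mul_left_comm, mul_comm, mul_left_comm (cexp (u : ℂ)), ← Complex.exp_add]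
  rw [mul_comm, mul_assoc, mul_comm (f _), ← mul_assoc, ← Complex.exp_add]
  congr 2
  simp only [criticalPoint]
  push_cast
  ring

namespace CosinePair

variable (p : CosinePair)

/-- On the critical line the continuation agrees with the `L²` Mellin transform: both are limits of
the transforms of the truncations `f(x) min(1, x^{-ε})`, for which the integral converges. -/
theorem mellinTransform_ae_eq_ext :
    ∀ᵐ τ : ℝ, mellinTransform p.f τ = p.ext (criticalPoint τ) := by
  set ε : ℕ → ℝ := fun n => 1 / ((n : ℝ) + 1) with hε
  have hε0 : ∀ n, 0 < ε n := fun n => Nat.one_div_pos_of_nat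
  have hεt : Tendsto ε atTop (𝓝 0) := tendsto_one_div_add_atTop_nhds_zero_nat
  set κ : ℕ → ℝ → ℝ := fun n x => if x ≤ 1 then 1 else x ^ (-ε n) with hκ
  have hκm : ∀ n, Measurable (κ n) := fun n =>
    Measurable.ite measurableSet_Iic measurable_const (by fun_prop)
  have hκ0 : ∀ n x, 0 ≤ κ n x := by
    intro n x
    simp only [hκ]
    split_ifs with h
    · exact zero_le_one
    · exact Real.rpow_nonneg (by linarith) _
  have hκ1 : ∀ n x, κ n x ≤ 1 := by
    intro n x
    simp only [hκ]
    split_ifs with h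
    · exact le_rfl
    · exact Real.rpow_le_one_of_one_le_of_nonpos (by linarith) (by linarith [hε0 n])
  have hκt : ∀ x, Tendsto (fun n => κ n x) atTop (𝓝 1) := by
    intro x
    simp only [hκ]
    split_ifs with h
    · exact tendsto_const_nhds
    · have h1 : Tendsto (fun n => -ε n) atTop (𝓝 0) := by simpa using hεt.neg
      have := (Real.continuousAt_const_rpow (a := x) (b := 0) (by linarith)).tendsto.comp h1
      simpa [Function.comp_def] using this
  have hm : ∀ n, AEStronglyMeasurable (fun x => (κ n x : ℂ) * p.f x)
      (volume.restrict (Set.Ioi 0)) := fun n =>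
    (hκm n).complex_ofReal.aestronglyMeasurable.mul (Lp.aestronglyMeasurable p.f)
  have hL : ∀ n, MemLp (fun x => (κ n x : ℂ) * p.f x) 2 (volume.restrict (Set.Ioi 0)) := fun n =>
    (Lp.memLp p.f).mono (hm n) (Eventually.of_forall fun x => by
      rw [norm_mul, norm_real, Real.norm_of_nonneg (hκ0 n x)]
      exact mul_le_of_le_one_left (norm_nonneg _) (hκ1 n x))
  set F : ℕ → HalfLineL2 := fun n => (hL n).toLp with hF
  have hFae : ∀ n, ∀ᵐ x ∂(volume.restrict (Set.Ioi (0 : ℝ))), F n x = (κ n x : ℂ) * p.f x :=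
    fun n => (hL n).coeFn_toLp
  have hsq := (memLp_two_iff_integrable_sq_norm (Lp.aestronglyMeasurable p.f)).1 (Lp.memLp p.f)
  have hFt : Tendsto F atTop (𝓝 p.f) := by
    rw [tendsto_iff_norm_sub_tendsto_zero]
    have h1 : ∀ n, ‖F n - p.f‖ ^ 2 =
        ∫ x in Set.Ioi (0 : ℝ), (1 - κ n x) ^ 2 * ‖p.f x‖ ^ 2 := by
      intro n
      rw [norm_sq_eq_integral]
      refine integral_congr_ae ?_
      filter_upwards [hFae n, Lp.coeFn_sub (F n) p.f] with x h1 h2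
      rw [h2, Pi.sub_apply, h1, ← mul_pow, ← sub_one_mul, norm_mul, ← ofReal_one, ← ofReal_sub,
        norm_real, Real.norm_eq_abs, abs_sub_comm, abs_of_nonneg (by linarith [hκ1 n x])]
    have h2 : Tendsto (fun n => ‖F n - p.f‖ ^ 2) atTop (𝓝 0) := by
      simp only [h1]
      have h0 : ∫ x in Set.Ioi (0 : ℝ), (0 : ℝ) = 0 := integral_zero ℝ ℝ
      refine Eq.subst (motive := fun z => Tendsto _ atTop (𝓝 z)) h0 ?_
      refine tendsto_integral_of_dominated_convergence (fun x => ‖p.f x‖ ^ 2) (fun n => ?_) hsq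
        (fun n => Eventually.of_forall fun x => ?_) (Eventually.of_forall fun x => ?_)
      · exact ((measurable_const.sub (hκm n)).pow_const 2).aestronglyMeasurable.mul
          hsq.aestronglyMeasurable
      · rw [norm_mul, norm_pow, norm_pow, norm_norm, Real.norm_eq_abs, sq_abs]
        refine mul_le_of_le_one_left (by positivity) ?_
        have := hκ0 n x
        have := hκ1 n x
        nlinarith
      · have : Tendsto (fun n => (1 - κ n x) ^ 2 * ‖p.f x‖ ^ 2) atTop
            (𝓝 ((1 - 1) ^ 2 * ‖p.f x‖ ^ 2)) :=
          (((hκt x).const_sub 1).pow 2).mul_const _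
        simpa using this
    have h3 := h2.sqrt
    simpa [Real.sqrt_sq (norm_nonneg _)] using h3
  have hMt : Tendsto (fun n => mellinTransform (F n)) atTop (𝓝 (mellinTransform p.f)) :=
    (mellinIsometry.continuous.tendsto p.f).comp hFt
  obtain ⟨φ, hφ, hlim⟩ := (tendstoInMeasure_of_tendsto_Lp hMt).exists_seq_tendsto_ae
  have hformula : ∀ n, ∀ᵐ τ : ℝ, mellinTransform (F n) τ =
      p.a / (1 - criticalPoint τ) + rightMellin p.f (criticalPoint τ + ε n) := by
    intro n
    have hae : ∀ᵐ x ∂(volume.restrict (Set.Ioc (0 : ℝ) 1)), F n x = p.a := by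
      filter_upwards [ae_restrict_of_ae_restrict_of_subset
        (fun x (hx : x ∈ Set.Ioc (0 : ℝ) 1) => hx.1) (hFae n), p.ae_eq_Ioc,
        ae_restrict_mem measurableSet_Ioc] with x h1 h2 h3
      rw [h1, h2]
      simp [hκ, h3.2]
    have hae' : ∀ᵐ x ∂(volume.restrict (Set.Ioi (1 : ℝ))),
        F n x = ((x ^ (-ε n) : ℝ) : ℂ) * p.f x := by
      filter_upwards [ae_restrict_of_ae_restrict_of_subset
        (Set.Ioi_subset_Ioi zero_le_one) (hFae n), ae_restrict_mem measurableSet_Ioi] with x h1 h3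
      rw [h1]
      simp only [hκ]
      rw [if_neg (not_le.2 h3)]
    have hint : ∀ s : ℂ, s.re = 1 / 2 →
        IntegrableOn (fun x => F n x * (x : ℂ) ^ (-s)) (Set.Ioi 0) ∧
        ∫ x in Set.Ioi (0 : ℝ), F n x * (x : ℂ) ^ (-s) =
          p.a / (1 - s) + rightMellin p.f (s + ε n) := by
      intro s hs
      have h3 := integrableOn_Ioc_cpow (s := s) (by rw [hs]; norm_num)
      have e1 : (fun x : ℝ => F n x * (x : ℂ) ^ (-s)) =ᵐ[volume.restrict (Set.Ioc 0 1)]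
          fun x : ℝ => p.a * (x : ℂ) ^ (-s) := by
        filter_upwards [hae] with x hx
        rw [hx]
      have e2 : (fun x : ℝ => F n x * (x : ℂ) ^ (-s)) =ᵐ[volume.restrict (Set.Ioi 1)]
          fun x : ℝ => p.f x * (x : ℂ) ^ (-(s + ε n)) := by
        filter_upwards [hae', ae_restrict_mem measurableSet_Ioi] with x hx h1
        have hx0 : 0 < x := zero_lt_one.trans h1
        rw [hx, neg_add, cpow_add _ _ (ofReal_ne_zero.2 hx0.ne'), ofReal_cpow hx0.le]
        push_cast
        ring
      have hi2 := integrableOn_mul_cpow p.f (s := s + ε n) (by simp [hs, hε0 n])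
      have hi : IntegrableOn (fun x : ℝ => F n x * (x : ℂ) ^ (-s)) (Set.Ioi 0) := by
        refine IntegrableOn.mono_set (IntegrableOn.union ((h3.1.const_mul p.a).congr e1.symm)
          (hi2.congr e2.symm)) ?_
        rw [Set.Ioc_union_Ioi_eq_Ioi (zero_le_one (α := ℝ))]
      refine ⟨hi, ?_⟩
      rw [setIntegral_Ioi_zero_split hi, integral_congr_ae e1, integral_congr_ae e2,
        integral_const_mul, h3.2, rightMellin, div_eq_mul_inv]
    have hi : IntegrableOn (fun x => ‖F n x‖ * x ^ (-(1 / 2) : ℝ)) (Set.Ioi 0) := by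
      refine (hint (1 / 2 : ℂ) (by simp)).1.norm.congr ?_
      filter_upwards [ae_restrict_mem measurableSet_Ioi] with x hx
      rw [norm_mul, norm_cpow_eq_rpow_re_of_pos hx]
      simp
    filter_upwards [mellinTransform_ae_eq_integral (F n) hi] with τ hτ
    rw [hτ, (hint _ (criticalPoint_re τ)).2]
  filter_upwards [hlim, ae_all_iff.2 hformula] with τ h1 h2
  set s := criticalPoint τ with hs
  have hre : s.re = 1 / 2 := criticalPoint_re τ
  have hs1 : s ≠ 1 := fun h => by
    rw [h, one_re] at hre
    norm_num at hre
  have hc : ContinuousAt p.ext s := (p.differentiableOn_ext.differentiableAt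
    (isOpen_compl_singleton.mem_nhds hs1)).continuousAt
  have hsε : Tendsto (fun n => s + (ε n : ℂ)) atTop (𝓝 s) := by
    have := (continuous_ofReal.tendsto 0).comp hεt
    simpa using this.const_add s
  have hlim1 : Tendsto (fun n => p.ext (s + ε n)) atTop (𝓝 (p.ext s)) := hc.tendsto.comp hsε
  have hlim2 : Tendsto (fun n => p.a / (1 - s) - p.a / (1 - (s + ε n))) atTop (𝓝 0) := by
    have h5 : Tendsto (fun n => p.a / (1 - (s + ε n))) atTop (𝓝 (p.a / (1 - s))) :=
      tendsto_const_nhds.div (hsε.const_sub 1) (sub_ne_zero.2 hs1.symm)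
    simpa using h5.const_sub (p.a / (1 - s))
  have hlim3 : Tendsto (fun n => mellinTransform (F n) τ) atTop (𝓝 (p.ext s)) := by
    have h6 := hlim1.add hlim2
    rw [add_zero] at h6
    refine h6.congr' ?_
    filter_upwards [hsε.eventually_ne hs1] with n hn
    rw [h2 n, p.ext_eq_rightMellin (by simp [hre, hε0 n]) hn]
    ring
  exact tendsto_nhds_unique h1 (hlim3.comp hφ.tendsto_atTop)

end CosinePair

end BurnolZeta

/-! ### Zeros of zeta and division of entire functions -/

namespace BurnolZeta

open Complex Filter

/-- An entire function is divisible by a nonzero entire function as soon as the orders of its zeros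
are large enough. -/
theorem exists_entire_quotient {P Q : ℂ → ℂ} (hP : Differentiable ℂ P) (hQ : Differentiable ℂ Q)
    (h : ∀ z, analyticOrderAt Q z ≠ ⊤) (hle : ∀ z, analyticOrderAt Q z ≤ analyticOrderAt P z) :
    ∃ H : ℂ → ℂ, Differentiable ℂ H ∧ ∀ z, P z = H z * Q z := by
  have hloc : ∀ z, ∃ g : ℂ → ℂ, AnalyticAt ℂ g z ∧ ∀ᶠ w in 𝓝 z, P w = g w * Q w := by
    intro z
    obtain ⟨q, hq, hq0, hqe⟩ := (hQ.analyticAt z).analyticOrderAt_ne_top.1 (h z)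
    have hn : (analyticOrderNatAt Q z : ℕ∞) ≤ analyticOrderAt P z := by
      rw [Nat.cast_analyticOrderNatAt (h z)]
      exact hle z
    obtain ⟨p, hp, hpe⟩ := (natCast_le_analyticOrderAt (hP.analyticAt z)).1 hn
    refine ⟨fun w => p w / q w, hp.div hq hq0, ?_⟩
    filter_upwards [hqe, hpe, hq.continuousAt.eventually_ne hq0] with w h1 h2 h3
    rw [h1, h2, smul_eq_mul, smul_eq_mul]
    field_simp
  choose g hg hge using hloc
  have hne : ∀ z, ∀ᶠ w in 𝓝[≠] z, Q w ≠ 0 := fun z =>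
    (hQ.analyticAt z).eventually_eq_zero_or_eventually_ne_zero.resolve_left fun h0 =>
      h z (analyticOrderAt_eq_top.2 h0)
  refine ⟨fun z => g z z, fun z => ?_, fun z => (hge z).self_of_nhds⟩
  have e : (fun z => g z z) =ᶠ[𝓝 z] g z := by
    have h1 := eventually_nhdsWithin_iff.1 (hne z)
    filter_upwards [h1, hge z] with w h2 h3
    by_cases hw : w = z
    · rw [hw]
    · have h4 := (hge w).self_of_nhds
      exact mul_right_cancel₀ (h2 hw) (h4.symm.trans h3)
  exact ((hg z).congr e.symm).differentiableAt

theorem analyticAt_riemannZeta {s : ℂ} (hs : s ≠ 1) : AnalyticAt ℂ riemannZeta s := by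
  refine (DifferentiableOn.analyticOnNhd (s := {1}ᶜ) (fun z hz => ?_) isOpen_compl_singleton) s hs
  exact (differentiableAt_riemannZeta hz).differentiableWithinAt

theorem meromorphicAt_riemannZeta_one : MeromorphicAt riemannZeta 1 := by
  have hd : ∀ᶠ z in 𝓝[≠] (1 : ℂ), DifferentiableAt ℂ (fun s => (s - 1) * riemannZeta s) z := by
    filter_upwards [self_mem_nhdsWithin] with z hz
    exact (differentiableAt_id.sub_const 1).mul (differentiableAt_riemannZeta hz)
  have h := analyticAt_of_differentiable_on_punctured_nhds_of_continuousAt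
    (f := Function.update (fun s => (s - 1) * riemannZeta s) 1 1) (c := 1) ?_ ?_
  · have h1 : MeromorphicAt (fun s => (s - 1) * riemannZeta s) 1 := by
      refine h.meromorphicAt.congr ?_
      filter_upwards [self_mem_nhdsWithin] with z hz
      rw [Function.update_of_ne hz]
    have h2 : MeromorphicAt (fun s : ℂ => (s - 1)⁻¹) 1 :=
      (analyticAt_id.sub analyticAt_const).meromorphicAt.inv
    refine (h2.mul h1).congr ?_
    filter_upwards [self_mem_nhdsWithin] with z hz
    have : z - 1 ≠ 0 := sub_ne_zero.2 hz
    simp only [Pi.mul_apply]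
    field_simp
  · filter_upwards [hd, self_mem_nhdsWithin] with z hz hz1
    refine hz.congr_of_eventuallyEq ?_
    filter_upwards [isOpen_compl_singleton.mem_nhds hz1] with w hw
    rw [Function.update_of_ne hw]
  · rw [continuousAt_update_same]
    exact riemannZeta_residue_one

theorem xi_one : xi 1 = -1 := by simp [xi]

theorem analyticOrderAt_xi_ne_top (z : ℂ) : analyticOrderAt xi z ≠ ⊤ := fun h => by
  have h1 := (AnalyticOnNhd.analyticOrderAt_eq_top_iff_eq_zero z fun w => differentiable_xi.analyticAt w).1 h
  have h2 := congrFun h1 1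
  rw [xi_one] at h2
  norm_num at h2

theorem xi_ne_zero_of_one_le_re {s : ℂ} (hs : 1 ≤ s.re) : xi s ≠ 0 := by
  by_cases h1 : s = 1
  · rw [h1, xi_one]
    norm_num
  have h0 : s ≠ 0 := fun h => by
    rw [h, zero_re] at hs
    linarith
  have hG := Gammaℝ_ne_zero_of_re_pos (s := s) (by linarith)
  rw [xi_eq h0 h1 hG]
  exact mul_ne_zero (mul_ne_zero (mul_ne_zero h0 (sub_ne_zero.2 (Ne.symm h1))) hG)
    (riemannZeta_ne_zero_of_one_le_re hs)

/-- In the critical strip, `xi` is `ζ` times an analytic function without zeros. -/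
theorem xi_eq_of_mem_strip {s : ℂ} (h0 : 0 < s.re) (h1 : s.re < 1) :
    s * (1 - s) * Gammaℝ s ≠ 0 ∧ xi s = s * (1 - s) * Gammaℝ s * riemannZeta s := by
  have hs0 : s ≠ 0 := fun h => by
    rw [h, zero_re] at h0
    linarith
  have hs1 : s ≠ 1 := fun h => by
    rw [h, one_re] at h1
    linarith
  have hG := Gammaℝ_ne_zero_of_re_pos h0
  exact ⟨mul_ne_zero (mul_ne_zero hs0 (sub_ne_zero.2 hs1.symm)) hG, xi_eq hs0 hs1 hG⟩

/-- The zeros of `xi` are the non-trivial zeros of `ζ`. -/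
theorem mem_nontrivialZeros_iff {s : ℂ} : s ∈ nontrivialZeros ↔ xi s = 0 := by
  constructor
  · rintro ⟨hz, h0, h1⟩
    rw [(xi_eq_of_mem_strip h0 h1).2, hz, mul_zero]
  · intro h
    have h1 : s.re < 1 := by
      by_contra! h1
      exact xi_ne_zero_of_one_le_re h1 h
    have h0 : 0 < s.re := by
      by_contra! h0
      refine xi_ne_zero_of_one_le_re (s := 1 - s) (by simp; linarith) ?_
      rw [xi_one_sub, h]
    have h2 := xi_eq_of_mem_strip h0 h1
    rw [h2.2] at h
    exact ⟨(mul_eq_zero.1 h).resolve_left h2.1, h0, h1⟩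

theorem one_sub_mem_nontrivialZeros {ρ : ℂ} (h : ρ ∈ nontrivialZeros) :
    1 - ρ ∈ nontrivialZeros := by
  rw [mem_nontrivialZeros_iff] at h ⊢
  rw [xi_one_sub, h]

theorem ne_one_of_mem_nontrivialZeros {ρ : ℂ} (h : ρ ∈ nontrivialZeros) : ρ ≠ 1 := fun h1 => by
  have h2 := h.2.2
  rw [h1, one_re] at h2
  exact lt_irrefl _ h2

theorem analyticAt_Gammaℝ {s : ℂ} (hs : 0 < s.re) : AnalyticAt ℂ Gammaℝ s := by
  have h := (differentiable_Gammaℝ_inv.analyticAt s).inv (inv_ne_zero (Gammaℝ_ne_zero_of_re_pos hs))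
  refine h.congr (Eventually.of_forall fun z => ?_)
  simp

theorem eventually_mem_strip {s : ℂ} (h0 : 0 < s.re) (h1 : s.re < 1) :
    ∀ᶠ z in 𝓝 s, 0 < z.re ∧ z.re < 1 :=
  ((isOpen_lt continuous_const continuous_re).inter
    (isOpen_lt continuous_re continuous_const)).mem_nhds ⟨h0, h1⟩

theorem analyticOrderAt_strip_factor {s : ℂ} (h0 : 0 < s.re) (h1 : s.re < 1) :
    AnalyticAt ℂ (fun s => s * (1 - s) * Gammaℝ s) s ∧
      analyticOrderAt (fun s => s * (1 - s) * Gammaℝ s) s = 0 := by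
  have hA : AnalyticAt ℂ (fun s => s * (1 - s) * Gammaℝ s) s :=
    (analyticAt_id.mul (analyticAt_const.sub analyticAt_id)).mul (analyticAt_Gammaℝ h0)
  exact ⟨hA, hA.analyticOrderAt_eq_zero.2 (xi_eq_of_mem_strip h0 h1).1⟩

theorem analyticOrderAt_xi_eq {s : ℂ} (h0 : 0 < s.re) (h1 : s.re < 1) :
    analyticOrderAt xi s = analyticOrderAt riemannZeta s := by
  have hs1 : s ≠ 1 := fun h => by
    rw [h, one_re] at h1
    linarith
  obtain ⟨hA, hA0⟩ := analyticOrderAt_strip_factor h0 h1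
  have e : xi =ᶠ[𝓝 s] (fun s => s * (1 - s) * Gammaℝ s) * riemannZeta := by
    filter_upwards [eventually_mem_strip h0 h1] with z hz
    exact (xi_eq_of_mem_strip hz.1 hz.2).2
  rw [analyticOrderAt_congr e, analyticOrderAt_mul hA (analyticAt_riemannZeta hs1), hA0, zero_add]

theorem analyticOrderAt_xi_one_sub (s : ℂ) : analyticOrderAt xi (1 - s) = analyticOrderAt xi s := by
  have h := analyticOrderAt_comp_of_deriv_ne_zero (f := xi) (g := fun z : ℂ => 1 - z) (z₀ := s)
    (analyticAt_const.sub analyticAt_id) (by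
      have : HasDerivAt (fun z : ℂ => 1 - z) (-1) s := by
        simpa using (hasDerivAt_id s).const_sub 1
      rw [this.deriv]
      norm_num)
  rw [← h]
  congr 1
  ext z
  exact xi_one_sub z

theorem analyticOrderAt_riemannZeta_ne_top {ρ : ℂ} (h : ρ ∈ nontrivialZeros) :
    analyticOrderAt riemannZeta ρ ≠ ⊤ := by
  rw [← analyticOrderAt_xi_eq h.2.1 h.2.2]
  exact analyticOrderAt_xi_ne_top ρ

theorem cast_analyticOrderNatAt_riemannZeta {ρ : ℂ} (h : ρ ∈ nontrivialZeros) :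
    (analyticOrderNatAt riemannZeta ρ : ℕ∞) = analyticOrderAt riemannZeta ρ :=
  Nat.cast_analyticOrderNatAt (analyticOrderAt_riemannZeta_ne_top h)

/-- The zeros `ρ` and `1 - ρ` have the same multiplicity. -/
theorem analyticOrderNatAt_riemannZeta_one_sub {ρ : ℂ} (h : ρ ∈ nontrivialZeros) :
    analyticOrderNatAt riemannZeta (1 - ρ) = analyticOrderNatAt riemannZeta ρ := by
  have h' := one_sub_mem_nontrivialZeros h
  rw [analyticOrderNatAt, analyticOrderNatAt, ← analyticOrderAt_xi_eq h.2.1 h.2.2,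
    ← analyticOrderAt_xi_eq h'.2.1 h'.2.2, analyticOrderAt_xi_one_sub]

end BurnolZeta

/-! ### Functions constant near zero and decaying at infinity; division by `s - ρ` -/

namespace BurnolZeta

open Complex Filter

/-- A measurable function on `(0,∞)` that is constant on `(0, 1)` and `O(1/x)` at infinity. Its
Mellin transform converges absolutely in the strip `0 < re s < 1`. -/
structure IsTame (f : ℝ → ℂ) (a : ℂ) : Prop where
  measurable : Measurable f
  eq_const : ∀ x, 0 < x → x < 1 → f x = a
  decay : ∃ C : ℝ, ∀ x, 1 ≤ x → ‖f x‖ ≤ C / x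

namespace IsTame

variable {f g : ℝ → ℂ} {a b : ℂ}

theorem add (hf : IsTame f a) (hg : IsTame g b) : IsTame (fun x => f x + g x) (a + b) := by
  obtain ⟨C, hC⟩ := hf.decay
  obtain ⟨D, hD⟩ := hg.decay
  refine ⟨hf.measurable.add hg.measurable, fun x h0 h1 => ?_, C + D, fun x hx => ?_⟩
  · rw [hf.eq_const x h0 h1, hg.eq_const x h0 h1]
  · rw [add_div]
    exact (norm_add_le _ _).trans (add_le_add (hC x hx) (hD x hx))

theorem const_mul (hf : IsTame f a) (c : ℂ) : IsTame (fun x => c * f x) (c * a) := by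
  obtain ⟨C, hC⟩ := hf.decay
  refine ⟨hf.measurable.const_mul c, fun x h0 h1 => ?_, ‖c‖ * C, fun x hx => ?_⟩
  · rw [hf.eq_const x h0 h1]
  · rw [norm_mul, mul_div_assoc]
    exact mul_le_mul_of_nonneg_left (hC x hx) (norm_nonneg _)

theorem exists_norm_le (hf : IsTame f a) : ∃ C : ℝ, ∀ x, 0 < x → ‖f x‖ ≤ C := by
  obtain ⟨C, hC⟩ := hf.decay
  refine ⟨max ‖a‖ C, fun x hx => ?_⟩
  rcases lt_or_ge x 1 with h | h
  · rw [hf.eq_const x hx h]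
    exact le_max_left _ _
  · refine ((hC x h).trans (div_le_self ?_ h)).trans (le_max_right _ _)
    have h1 := (norm_nonneg _).trans (hC x h)
    by_contra! hneg
    exact absurd h1 (not_le.2 (div_neg_of_neg_of_pos hneg (by linarith)))

theorem locallyIntegrableOn (hf : IsTame f a) : LocallyIntegrableOn f (Set.Ioi 0) := by
  obtain ⟨C, hC⟩ := hf.exists_norm_le
  refine (locallyIntegrableOn_iff isOpen_Ioi.isLocallyClosed).2 fun k hk hkc => ?_
  refine Measure.integrableOn_of_bounded (M := C) hkc.measure_lt_top.ne
    hf.measurable.aestronglyMeasurable ?_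
  filter_upwards [ae_restrict_mem hkc.measurableSet] with x hx
  exact hC x (hk hx)

theorem isBigO_top (hf : IsTame f a) : f =O[atTop] fun x : ℝ => x ^ (-1 : ℝ) := by
  obtain ⟨C, hC⟩ := hf.decay
  refine Asymptotics.IsBigO.of_bound C ?_
  filter_upwards [eventually_ge_atTop 1] with x hx
  have hx0 : 0 < x := by linarith
  rw [Real.norm_of_nonneg (Real.rpow_nonneg hx0.le _), Real.rpow_neg_one]
  exact hC x hx

theorem isBigO_zero (hf : IsTame f a) : f =O[𝓝[>] 0] fun x : ℝ => x ^ (-0 : ℝ) := by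
  refine Asymptotics.IsBigO.of_bound ‖a‖ ?_
  filter_upwards [nhdsWithin_le_nhds (Iio_mem_nhds one_pos), self_mem_nhdsWithin] with x h1 h0
  rw [hf.eq_const x h0 h1]
  simp

theorem mellinConvergent (hf : IsTame f a) {z : ℂ} (h0 : 0 < z.re) (h1 : z.re < 1) :
    MellinConvergent f z :=
  mellinConvergent_of_isBigO_rpow hf.locallyIntegrableOn hf.isBigO_top h1 hf.isBigO_zero h0

theorem differentiableAt_mellin (hf : IsTame f a) {z : ℂ} (h0 : 0 < z.re) (h1 : z.re < 1) :
    DifferentiableAt ℂ (mellin f) z :=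
  mellin_differentiableAt_of_isBigO_rpow hf.locallyIntegrableOn hf.isBigO_top h1 hf.isBigO_zero h0

end IsTame

/-- The weighted average `x ↦ ∫_0^1 f(xu) u^{-ρ} du`. On the Mellin side it is division by
`s - ρ`. -/
noncomputable def powerAverage (ρ : ℂ) (f : ℝ → ℂ) (x : ℝ) : ℂ :=
  ∫ u in Set.Ioc (0 : ℝ) 1, f (x * u) * (u : ℂ) ^ (-ρ)

theorem measurable_powerAverage (ρ : ℂ) {f : ℝ → ℂ} (hf : Measurable f) :
    Measurable (powerAverage ρ f) := by
  refine (StronglyMeasurable.integral_prod_right (ν := volume.restrict (Set.Ioc (0 : ℝ) 1))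
    (f := fun x u => f (x * u) * (u : ℂ) ^ (-ρ)) ?_).measurable
  refine Measurable.stronglyMeasurable ?_
  have h1 : Measurable fun p : ℝ × ℝ => f (p.1 * p.2) :=
    hf.comp (measurable_fst.mul measurable_snd)
  have h2 : Measurable fun p : ℝ × ℝ => (p.2 : ℂ) ^ (-ρ) := by fun_prop
  exact h1.mul h2

theorem IsTame.powerAverage {f : ℝ → ℂ} {a : ℂ} (hf : IsTame f a) {ρ : ℂ} (h0 : 0 < ρ.re)
    (h1 : ρ.re < 1) (hρ : mellin f (1 - ρ) = 0) :
    IsTame (powerAverage ρ f) (a * (1 - ρ)⁻¹) := by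
  refine ⟨measurable_powerAverage ρ hf.measurable, fun x hx0 hx1 => ?_, ?_⟩
  · rw [BurnolZeta.powerAverage, ← (integrableOn_Ioc_cpow h1).2, ← integral_const_mul]
    refine setIntegral_congr_fun measurableSet_Ioc fun u hu => ?_
    rw [hf.eq_const (x * u) (mul_pos hx0 hu.1) (by nlinarith [hu.1, hu.2])]
  obtain ⟨C, hC⟩ := hf.decay
  refine ⟨C / ρ.re, fun x hx => ?_⟩
  have hx0 : 0 < x := by linarith
  -- Since the integral over `(0, ∞)` vanishes, the average is minus the integral over `(1, ∞)`.
  have hz0 : 0 < (1 - ρ).re := by simp; linarith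
  have hz1 : (1 - ρ).re < 1 := by simp; linarith
  have e : ∀ u : ℝ, (u : ℂ) ^ (1 - ρ - 1) • f (x * u) = f (x * u) * (u : ℂ) ^ (-ρ) := fun u => by
    rw [smul_eq_mul, mul_comm, show 1 - ρ - 1 = -ρ by ring]
  have hconv : IntegrableOn (fun u : ℝ => f (x * u) * (u : ℂ) ^ (-ρ)) (Set.Ioi 0) := by
    have := (MellinConvergent.comp_mul_left hx0).2 (hf.mellinConvergent hz0 hz1)
    rw [MellinConvergent] at this
    simpa only [e] using this
  have hzero : ∫ u in Set.Ioi (0 : ℝ), f (x * u) * (u : ℂ) ^ (-ρ) = 0 := by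
    have := mellin_comp_mul_left f (1 - ρ) hx0
    rw [hρ, smul_zero, mellin] at this
    simpa only [e] using this
  rw [setIntegral_Ioi_zero_split hconv] at hzero
  have e2 : BurnolZeta.powerAverage ρ f x =
      -∫ u in Set.Ioi (1 : ℝ), f (x * u) * (u : ℂ) ^ (-ρ) := eq_neg_of_add_eq_zero_left hzero
  have hlt : -ρ.re - 1 < -1 := by linarith
  have hI := integral_Ioi_rpow_of_lt hlt one_pos
  rw [e2, norm_neg]
  refine (norm_integral_le_of_norm_le (g := fun u => C / x * u ^ (-ρ.re - 1))
    ((integrableOn_Ioi_rpow_of_lt hlt one_pos).const_mul _) ?_).trans (le_of_eq ?_)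
  · filter_upwards [ae_restrict_mem measurableSet_Ioi] with u hu
    have hu1 : 1 < u := hu
    have hu0 : 0 < u := by linarith
    rw [norm_mul, norm_cpow_eq_rpow_re_of_pos hu0, neg_re, Real.rpow_sub_one hu0.ne']
    calc ‖f (x * u)‖ * u ^ (-ρ.re) ≤ C / (x * u) * u ^ (-ρ.re) := by
          gcongr
          exact hC _ (by nlinarith)
      _ = _ := by field_simp
  · rw [integral_const_mul, hI, Real.one_rpow, show -ρ.re - 1 + 1 = -ρ.re by ring,
      neg_div_neg_eq]
    field_simp

/-- The average divides the Mellin transform by `s - ρ`, to the right of `ρ`. -/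
theorem mellin_powerAverage_of_re_lt {f : ℝ → ℂ} {a : ℂ} (hf : IsTame f a) {ρ s : ℂ}
    (h : ρ.re < s.re) (h0 : 0 < s.re) (h1 : s.re < 1) :
    mellin (powerAverage ρ f) (1 - s) = mellin f (1 - s) / (s - ρ) := by
  set z := 1 - s with hz
  have hz0 : 0 < z.re := by simp [hz]; linarith
  have hz1 : z.re < 1 := by simp [hz]; linarith
  set μ := volume.restrict (Set.Ioi (0 : ℝ)) with hμ
  set ν := volume.restrict (Set.Ioc (0 : ℝ) 1) with hν
  set H : ℝ → ℝ → ℂ := fun x u => (x : ℂ) ^ (z - 1) * (f (x * u) * (u : ℂ) ^ (-ρ)) with hH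
  have hHm : Measurable (Function.uncurry H) := by
    have h1 : Measurable fun p : ℝ × ℝ => f (p.1 * p.2) :=
      hf.measurable.comp (measurable_fst.mul measurable_snd)
    have h2 : Measurable fun p : ℝ × ℝ => (p.2 : ℂ) ^ (-ρ) := by fun_prop
    have h3 : Measurable fun p : ℝ × ℝ => (p.1 : ℂ) ^ (z - 1) := by fun_prop
    exact h3.mul (h1.mul h2)
  have hu : ∀ᵐ u ∂ν, u ∈ Set.Ioc (0 : ℝ) 1 := ae_restrict_mem measurableSet_Ioc
  have hslice : ∀ u, 0 < u → (fun x => H x u) =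
      fun x : ℝ => ((x : ℂ) ^ (z - 1) • f (u * x)) * (u : ℂ) ^ (-ρ) := by
    intro u _
    ext x
    simp only [hH, smul_eq_mul]
    rw [mul_comm x u, mul_assoc]
  set J := ∫ x in Set.Ioi (0 : ℝ), x ^ (z.re - 1) * ‖f x‖ with hJ
  have hnorm : ∀ u, 0 < u → ∫ x, ‖H x u‖ ∂μ = u ^ (-z.re - ρ.re) * J := by
    intro u hu0
    have e1 : ∀ x ∈ Set.Ioi (0 : ℝ), ‖H x u‖ =
        u ^ (1 - z.re - ρ.re) * ((u * x) ^ (z.re - 1) * ‖f (u * x)‖) := by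
      intro x hx
      have hx0 : 0 < x := hx
      simp only [hH]
      rw [norm_mul, norm_mul, norm_cpow_eq_rpow_re_of_pos hx0, norm_cpow_eq_rpow_re_of_pos hu0,
        Real.mul_rpow hu0.le hx0.le, sub_re, one_re, neg_re, mul_comm x u,
        show 1 - z.re - ρ.re = -(z.re - 1) + -ρ.re by ring, Real.rpow_add hu0,
        Real.rpow_neg hu0.le (z.re - 1)]
      have := (Real.rpow_pos_of_pos hu0 (z.re - 1)).ne'
      field_simp
    rw [hμ, setIntegral_congr_fun measurableSet_Ioi e1, integral_const_mul,
      integral_comp_mul_left_Ioi (fun y => y ^ (z.re - 1) * ‖f y‖) 0 hu0, mul_zero, smul_eq_mul,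
      ← mul_assoc]
    congr 1
    rw [← Real.rpow_neg_one u, ← Real.rpow_add hu0]
    congr 1
    ring
  have hHi : Integrable (Function.uncurry H) (μ.prod ν) := by
    rw [integrable_prod_iff' hHm.aestronglyMeasurable]
    constructor
    · filter_upwards [hu] with u hu
      have h3 := (MellinConvergent.comp_mul_left hu.1).2 (hf.mellinConvergent hz0 hz1)
      have h4 := Integrable.mul_const h3 ((u : ℂ) ^ (-ρ))
      have e := hslice u hu.1
      simp only [Function.uncurry]
      rw [e]
      exact h4
    · have h3 : IntegrableOn (fun u : ℝ => u ^ (-z.re - ρ.re)) (Set.Ioc 0 1) :=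
        (intervalIntegrable_iff_integrableOn_Ioc_of_le zero_le_one).1
          (intervalIntegral.intervalIntegrable_rpow' (by simp [hz]; linarith))
      refine (h3.mul_const J).congr ?_
      filter_upwards [hu] with u hu
      exact (hnorm u hu.1).symm
  have hin : ∀ x : ℝ, ∫ u, H x u ∂ν = (x : ℂ) ^ (z - 1) • powerAverage ρ f x := by
    intro x
    simp only [hH]
    rw [integral_const_mul, smul_eq_mul, powerAverage]
  have h3 := integral_integral_swap hHi
  simp only [hin] at h3
  have h4 : ∫ u, ∫ x, H x u ∂μ ∂ν = ∫ u in Set.Ioc (0 : ℝ) 1, mellin f z * (u : ℂ) ^ (-(z + ρ)) := by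
    refine integral_congr_ae ?_
    filter_upwards [hu] with u hu
    have h5 : ∫ x, H x u ∂μ = mellin (fun x => f (u * x)) z * (u : ℂ) ^ (-ρ) := by
      rw [hslice u hu.1, integral_mul_const]
      rfl
    rw [h5, mellin_comp_mul_left f z hu.1, neg_add, cpow_add _ _ (ofReal_ne_zero.2 hu.1.ne'),
      smul_eq_mul]
    ring
  rw [mellin, h3, h4, integral_const_mul,
    (integrableOn_Ioc_cpow (s := z + ρ) (by simp [hz]; linarith)).2, div_eq_mul_inv]
  congr 2
  rw [hz]
  ring

/-- The average divides the Mellin transform by `s - ρ` in the whole strip. -/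
theorem mul_mellin_powerAverage {f : ℝ → ℂ} {a : ℂ} (hf : IsTame f a) {ρ : ℂ} (h0 : 0 < ρ.re)
    (h1 : ρ.re < 1) (hρ : mellin f (1 - ρ) = 0) {s : ℂ} (hs0 : 0 < s.re) (hs1 : s.re < 1) :
    (s - ρ) * mellin (powerAverage ρ f) (1 - s) = mellin f (1 - s) := by
  set U : Set ℂ := {s | 0 < s.re} ∩ {s | s.re < 1} with hU
  have hUo : IsOpen U := (isOpen_lt continuous_const continuous_re).inter
    (isOpen_lt continuous_re continuous_const)
  have hUc : IsPreconnected U :=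
    ((convex_halfSpace_re_gt 0).inter (convex_halfSpace_re_lt 1)).isPreconnected
  have hd : ∀ {g : ℝ → ℂ} {b : ℂ}, IsTame g b → DifferentiableOn ℂ (fun s => mellin g (1 - s)) U := by
    intro g b hg s hs
    have h3 := hg.differentiableAt_mellin (z := 1 - s) (by simpa using hs.2) (by simpa using hs.1)
    exact (h3.comp s (differentiableAt_id.const_sub 1)).differentiableWithinAt
  have hA : AnalyticOnNhd ℂ (fun s => (s - ρ) * mellin (powerAverage ρ f) (1 - s)) U :=
    DifferentiableOn.analyticOnNhd ((differentiableOn_id.sub_const ρ).mul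
      (hd (hf.powerAverage h0 h1 hρ))) hUo
  have hB : AnalyticOnNhd ℂ (fun s => mellin f (1 - s)) U := (hd hf).analyticOnNhd hUo
  set c : ℝ := (ρ.re + 1) / 2 with hc
  refine hA.eqOn_of_preconnected_of_eventuallyEq hB hUc (z₀ := (c : ℂ)) ?_ ?_ ⟨hs0, hs1⟩
  · constructor
    · show 0 < (c : ℂ).re
      rw [ofReal_re]; linarith
    · show (c : ℂ).re < 1
      rw [ofReal_re]; linarith
  · have hn : {s : ℂ | ρ.re < s.re} ∩ {s : ℂ | s.re < 1} ∈ 𝓝 (c : ℂ) := by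
      refine ((isOpen_lt continuous_const continuous_re).inter
        (isOpen_lt continuous_re continuous_const)).mem_nhds ⟨?_, ?_⟩
      · show ρ.re < (c : ℂ).re
        rw [ofReal_re]; linarith
      · show (c : ℂ).re < 1
        rw [ofReal_re]; linarith
    filter_upwards [hn] with z hz
    have h3 : ρ.re < z.re := hz.1
    rw [mellin_powerAverage_of_re_lt hf h3 (by linarith) hz.2]
    refine mul_div_cancel₀ _ (sub_ne_zero.2 fun h => ?_)
    rw [h] at h3
    exact lt_irrefl _ h3

end BurnolZeta

/-! ### Mellin transforms `ζ(s)/s` and `ζ(s)/(s - ρ)^k` -/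

namespace BurnolZeta

open Complex Filter

/-- The function `x ↦ -{x}/x`, whose Mellin transform is `ζ(s)/s`. -/
noncomputable def fractKernel (x : ℝ) : ℂ := -((Int.fract x : ℝ) : ℂ) / x

theorem isTame_fractKernel : IsTame fractKernel (-1) := by
  refine ⟨?_, fun x h0 h1 => ?_, 1, fun x hx => ?_⟩
  · unfold fractKernel
    fun_prop
  · rw [fractKernel, Int.fract_eq_self.2 ⟨h0.le, h1⟩, neg_div, div_self (ofReal_ne_zero.2 h0.ne')]
  · rw [fractKernel, norm_div, norm_neg, norm_real, norm_real,
      Real.norm_of_nonneg (Int.fract_nonneg x), Real.norm_of_nonneg (zero_le_one.trans hx)]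
    gcongr
    exact (Int.fract_lt_one x).le

/-- The fractional part, cut off to `(1, ∞)`. -/
noncomputable def fractTail : ℝ → ℂ := (Set.Ioi 1).indicator fun x => ((Int.fract x : ℝ) : ℂ)

theorem norm_fractTail_le (x : ℝ) : ‖fractTail x‖ ≤ 1 := by
  refine (norm_indicator_le_norm_self _ _).trans ?_
  rw [norm_real, Real.norm_of_nonneg (Int.fract_nonneg x)]
  exact (Int.fract_lt_one x).le

theorem mellin_fractTail {s : ℂ} (hs : 0 < s.re) :
    MellinConvergent fractTail (-s) ∧ DifferentiableAt ℂ (mellin fractTail) (-s) := by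
  have hm : Measurable fractTail := by
    refine Measurable.indicator ?_ measurableSet_Ioi
    fun_prop
  have hloc : LocallyIntegrableOn fractTail (Set.Ioi 0) := by
    refine (locallyIntegrableOn_iff isOpen_Ioi.isLocallyClosed).2 fun k hk hkc => ?_
    exact Measure.integrableOn_of_bounded (M := 1) hkc.measure_lt_top.ne
      hm.aestronglyMeasurable (Eventually.of_forall norm_fractTail_le)
  have htop : fractTail =O[atTop] fun x : ℝ => x ^ (-0 : ℝ) := by
    refine Asymptotics.IsBigO.of_bound 1 (Eventually.of_forall fun x => ?_)
    simpa using norm_fractTail_le x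
  have hbot : fractTail =O[𝓝[>] 0] fun x : ℝ => x ^ (-(-s.re - 1) : ℝ) := by
    have : fractTail =ᶠ[𝓝[>] 0] fun _ => 0 := by
      filter_upwards [nhdsWithin_le_nhds (Iio_mem_nhds one_pos)] with t ht
      exact Set.indicator_of_notMem (by simpa using le_of_lt ht) _
    exact this.trans_isBigO (Asymptotics.isBigO_zero _ _)
  have h1 : (-s).re < 0 := by simpa using hs
  have h2 : -s.re - 1 < (-s).re := by simp
  exact ⟨mellinConvergent_of_isBigO_rpow hloc htop h1 hbot h2,
    mellin_differentiableAt_of_isBigO_rpow hloc htop h1 hbot h2⟩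

theorem mellin_fractTail_eq {s : ℂ} (hs : 0 < s.re) :
    IntegrableOn (fun x : ℝ => ((Int.fract x : ℝ) : ℂ) * (x : ℂ) ^ (-s - 1)) (Set.Ioi 1) ∧
      mellin fractTail (-s) = ∫ x in Set.Ioi (1 : ℝ), ((Int.fract x : ℝ) : ℂ) * (x : ℂ) ^ (-s - 1) := by
  have hsub : Set.Ioi (1 : ℝ) ⊆ Set.Ioi 0 := Set.Ioi_subset_Ioi zero_le_one
  have h := (mellin_fractTail hs).1
  have e : ∀ x : ℝ, (x : ℂ) ^ (-s - 1) • fractTail x = (Set.Ioi (1 : ℝ)).indicator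
      (fun x : ℝ => ((Int.fract x : ℝ) : ℂ) * (x : ℂ) ^ (-s - 1)) x := by
    intro x
    by_cases hx : x ∈ Set.Ioi (1 : ℝ)
    · rw [fractTail, Set.indicator_of_mem hx, Set.indicator_of_mem hx, smul_eq_mul, mul_comm]
    · rw [fractTail, Set.indicator_of_notMem hx, Set.indicator_of_notMem hx, smul_zero]
  rw [MellinConvergent] at h
  rw [mellin]
  simp only [e] at h ⊢
  rw [IntegrableOn, integrable_indicator_iff measurableSet_Ioi, IntegrableOn,
    Measure.restrict_restrict_of_subset hsub] at h
  rw [setIntegral_indicator measurableSet_Ioi, Set.inter_eq_right.2 hsub]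
  exact ⟨h, rfl⟩

theorem riemannZeta_eq_mellin_fractTail {s : ℂ} (hs : 1 < s.re) :
    riemannZeta s = s / (s - 1) - s * mellin fractTail (-s) := by
  have hO : (fun n : ℕ => ∑ k ∈ Finset.Icc 1 n, (1 : ℕ → ℂ) k) =O[atTop]
      fun n : ℕ => (n : ℝ) ^ (1 : ℝ) := by
    refine Asymptotics.IsBigO.of_bound 1 (Eventually.of_forall fun n => ?_)
    simp
  have h := LSeries_eq_mul_integral 1 zero_le_one hs (LSeriesSummable_one_iff.2 hs) hO
  have hre : (-s).re < -1 := by simpa using hs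
  have h2 := mellin_fractTail_eq (s := s) (by linarith)
  have hs1 : s - 1 ≠ 0 := sub_ne_zero.2 fun h => by
    rw [h, one_re] at hs
    exact lt_irrefl _ hs
  rw [← LSeries_one_eq_riemannZeta hs, h, h2.2]
  have e : ∫ t in Set.Ioi (1 : ℝ), (∑ k ∈ Finset.Icc 1 ⌊t⌋₊, (1 : ℕ → ℂ) k) * (t : ℂ) ^ (-(s + 1)) =
      ∫ t in Set.Ioi (1 : ℝ), ((t : ℂ) ^ (-s) - ((Int.fract t : ℝ) : ℂ) * (t : ℂ) ^ (-s - 1)) := by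
    refine setIntegral_congr_fun measurableSet_Ioi fun t ht => ?_
    have ht0 : 0 < t := zero_lt_one.trans ht
    have htc : (t : ℂ) ≠ 0 := ofReal_ne_zero.2 ht0.ne'
    have h3 : ((⌊t⌋₊ : ℕ) : ℂ) = (t : ℂ) - ((Int.fract t : ℝ) : ℂ) := by
      have h4 : ((⌊t⌋₊ : ℕ) : ℝ) = t - Int.fract t := by
        rw [natCast_floor_eq_intCast_floor ht0.le]
        linarith [Int.floor_add_fract t]
      rw [← ofReal_sub, ← h4, ofReal_natCast]
    simp only [Pi.one_apply, Finset.sum_const, Nat.card_Icc, add_tsub_cancel_right, nsmul_eq_mul,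
      mul_one]
    rw [h3, show -(s + 1) = -s - 1 by ring, sub_mul]
    congr 1
    rw [cpow_sub _ _ htc, cpow_one]
    field_simp
  rw [e, integral_sub (integrableOn_Ioi_cpow_of_lt hre one_pos) h2.1,
    integral_Ioi_cpow_of_lt hre one_pos, ofReal_one, one_cpow]
  rw [mul_sub]
  congr 1
  rw [show -s + 1 = -(s - 1) by ring, neg_div_neg_eq, mul_one_div]

/-- The Mellin transform of `-{x}/x` is `ζ(s)/s` in the critical strip. -/
theorem mellin_fractKernel {s : ℂ} (h0 : 0 < s.re) (h1 : s.re < 1) :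
    mellin fractKernel (1 - s) = riemannZeta s / s := by
  have hU : IsOpen {s : ℂ | 0 < s.re} := isOpen_lt continuous_const continuous_re
  -- The continuation of the formula for `ζ` to the right half-plane is by the identity theorem
  -- for the product with `s (1 - s) Γ_ℝ(s)`, which has no pole at `1`.
  have key : xi s = s * Gammaℝ s * (-s + s * (s - 1) * mellin fractTail (-s)) := by
    have hA : AnalyticOnNhd ℂ xi {s : ℂ | 0 < s.re} := fun z _ => differentiable_xi.analyticAt z
    have hB : AnalyticOnNhd ℂ (fun s => s * Gammaℝ s * (-s + s * (s - 1) * mellin fractTail (-s)))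
        {s : ℂ | 0 < s.re} := by
      refine DifferentiableOn.analyticOnNhd (fun z hz => ?_) hU
      have h2 : DifferentiableAt ℂ (fun s => mellin fractTail (-s)) z :=
        (mellin_fractTail hz).2.comp z differentiableAt_id.neg
      have h3 := (analyticAt_Gammaℝ hz).differentiableAt
      exact DifferentiableAt.differentiableWithinAt (by fun_prop)
    refine hA.eqOn_of_preconnected_of_eventuallyEq hB (convex_halfSpace_re_gt 0).isPreconnected
      (z₀ := 2) (by simp) ?_ h0
    have hn : {s : ℂ | 1 < s.re} ∈ 𝓝 (2 : ℂ) :=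
      (isOpen_lt continuous_const continuous_re).mem_nhds (by simp)
    filter_upwards [hn] with z hz
    have hz1 : 1 < z.re := hz
    have hz0 : z ≠ 0 := fun h => by
      rw [h, zero_re] at hz1
      linarith
    have hz2 : z ≠ 1 := fun h => by
      rw [h, one_re] at hz1
      linarith
    have hz3 : z - 1 ≠ 0 := sub_ne_zero.2 hz2
    rw [xi_eq hz0 hz2 (Gammaℝ_ne_zero_of_re_pos (by linarith)), riemannZeta_eq_mellin_fractTail hz1]
    field_simp
    ring
  have hs0 : s ≠ 0 := fun h => by
    rw [h, zero_re] at h0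
    linarith
  have hs1 : 1 - s ≠ 0 := sub_ne_zero.2 fun h => by
    rw [← h, one_re] at h1
    linarith
  obtain ⟨hne, hx⟩ := xi_eq_of_mem_strip h0 h1
  have hG : Gammaℝ s ≠ 0 := Gammaℝ_ne_zero_of_re_pos h0
  have hz : (1 - s) * riemannZeta s = -s + s * (s - 1) * mellin fractTail (-s) := by
    refine mul_left_cancel₀ (mul_ne_zero hs0 hG) ?_
    rw [← key, hx]
    ring
  have hconv := isTame_fractKernel.mellinConvergent (z := 1 - s) (by simpa using h1)
    (by simpa using h0)
  have h3 := integrableOn_Ioc_cpow h1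
  have e1 : ∫ x in Set.Ioc (0 : ℝ) 1, (x : ℂ) ^ (1 - s - 1) • fractKernel x =
      -(1 - s)⁻¹ := by
    rw [← h3.2, ← integral_neg, integral_Ioc_eq_integral_Ioo, integral_Ioc_eq_integral_Ioo]
    refine setIntegral_congr_fun measurableSet_Ioo fun x hx => ?_
    simp only [isTame_fractKernel.eq_const x hx.1 hx.2, sub_sub_cancel_left, smul_eq_mul, mul_neg,
      mul_one]
  have e2 : ∫ x in Set.Ioi (1 : ℝ), (x : ℂ) ^ (1 - s - 1) • fractKernel x =
      -mellin fractTail (-s) := by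
    rw [(mellin_fractTail_eq h0).2, ← integral_neg]
    refine setIntegral_congr_fun measurableSet_Ioi fun x hx => ?_
    have hxc : (x : ℂ) ≠ 0 := ofReal_ne_zero.2 (zero_lt_one.trans hx).ne'
    simp only [sub_sub_cancel_left, smul_eq_mul, fractKernel]
    rw [cpow_sub _ _ hxc, cpow_one]
    field_simp
  rw [mellin, setIntegral_Ioi_zero_split hconv, e1, e2]
  field_simp
  linear_combination -hz

/-- Repeated division of `ζ(s)/s` by `s - ρ` on the Mellin side. -/
theorem exists_isTame_mellin {ρ : ℂ} (hρ : ρ ∈ nontrivialZeros) (j : ℕ)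
    (hj : j + 1 ≤ analyticOrderNatAt riemannZeta ρ) :
    ∃ (f : ℝ → ℂ) (a : ℂ), IsTame f a ∧ ∀ s : ℂ, 0 < s.re → s.re < 1 →
      (s - ρ) ^ (j + 1) * mellin f (1 - s) = riemannZeta s := by
  induction j with
  | zero =>
    have hzero : mellin fractKernel (1 - ρ) = 0 := by
      rw [mellin_fractKernel hρ.2.1 hρ.2.2, hρ.1, zero_div]
    have hT := isTame_fractKernel.powerAverage hρ.2.1 hρ.2.2 hzero
    refine ⟨_, _, isTame_fractKernel.add (hT.const_mul ρ), fun s h0 h1 => ?_⟩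
    have hs0 : s ≠ 0 := fun h => by
      rw [h, zero_re] at h0
      linarith
    have hz0 : 0 < (1 - s).re := by simpa using h1
    have hz1 : (1 - s).re < 1 := by simpa using h0
    have h3 := mul_mellin_powerAverage isTame_fractKernel hρ.2.1 hρ.2.2 hzero h0 h1
    have h4 := hasMellin_const_smul (hT.mellinConvergent hz0 hz1) ρ
    have h5 := (hasMellin_add (isTame_fractKernel.mellinConvergent hz0 hz1) h4.1).2
    have h6 : mellin (fun x => fractKernel x + ρ * powerAverage ρ fractKernel x) (1 - s) =
        mellin fractKernel (1 - s) + ρ * mellin (powerAverage ρ fractKernel) (1 - s) := by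
      rw [h4.2] at h5
      exact h5
    rw [h6, mellin_fractKernel h0 h1]
    rw [mellin_fractKernel h0 h1] at h3
    rw [zero_add, pow_one, mul_add, mul_left_comm, h3]
    field_simp
    ring
  | succ j ih =>
    obtain ⟨f, a, hf, hM⟩ := ih (by omega)
    have hzero : mellin f (1 - ρ) = 0 := by
      set M : ℂ → ℂ := fun s => mellin f (1 - s) with hMdef
      have hA : AnalyticAt ℂ M ρ := by
        refine DifferentiableOn.analyticAt (s := {s : ℂ | 0 < s.re ∧ s.re < 1}) (fun z hz => ?_)
          (eventually_mem_strip hρ.2.1 hρ.2.2)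
        have h3 := hf.differentiableAt_mellin (z := 1 - z) (by simpa using hz.2)
          (by simpa using hz.1)
        exact (h3.comp z (differentiableAt_id.const_sub 1)).differentiableWithinAt
      have hP : AnalyticAt ℂ ((· - ρ) ^ (j + 1) : ℂ → ℂ) ρ := by fun_prop
      by_contra hne
      have h0 : analyticOrderAt M ρ = 0 := hA.analyticOrderAt_eq_zero.2 hne
      have e : riemannZeta =ᶠ[𝓝 ρ] ((· - ρ) ^ (j + 1)) * M := by
        filter_upwards [eventually_mem_strip hρ.2.1 hρ.2.2] with z hz
        exact (hM z hz.1 hz.2).symm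
      have h1 := analyticOrderAt_congr e
      rw [analyticOrderAt_mul hP hA, h0, add_zero, analyticOrderAt_centeredMonomial,
        ← cast_analyticOrderNatAt_riemannZeta hρ] at h1
      have h2 : analyticOrderNatAt riemannZeta ρ = j + 1 := by exact_mod_cast h1
      omega
    refine ⟨_, _, hf.powerAverage hρ.2.1 hρ.2.2 hzero, fun s h0 h1 => ?_⟩
    rw [pow_succ, mul_assoc, mul_mellin_powerAverage hf hρ.2.1 hρ.2.2 hzero h0 h1, hM s h0 h1]

end BurnolZeta

/-! ### Totality of the Gaussians -/

namespace BurnolZeta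

open Complex FourierTransform Filter

theorem criticalPoint_neg (τ : ℝ) : criticalPoint (-τ) = 1 - criticalPoint τ := by
  simp only [criticalPoint]
  push_cast
  ring

theorem conj_criticalPoint (τ : ℝ) :
    (starRingEnd ℂ) (criticalPoint τ) = 1 - criticalPoint τ := by
  refine Complex.ext ?_ ?_
  · rw [conj_re, sub_re, one_re, criticalPoint_re]
    norm_num
  · rw [conj_im, sub_im, one_im, zero_sub]

theorem continuous_criticalPoint : Continuous criticalPoint := by
  unfold criticalPoint
  fun_prop

theorem conj_ofReal_cpow {x : ℝ} (hx : 0 < x) (s : ℂ) :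
    (starRingEnd ℂ) ((x : ℂ) ^ s) = (x : ℂ) ^ (starRingEnd ℂ) s := by
  have harg : (x : ℂ).arg ≠ Real.pi := by
    rw [arg_ofReal_of_nonneg hx.le]
    exact Real.pi_ne_zero.symm
  rw [cpow_conj _ _ harg, conj_ofReal]

theorem conj_Gammaℝ (s : ℂ) : (starRingEnd ℂ) (Gammaℝ s) = Gammaℝ ((starRingEnd ℂ) s) := by
  rw [Gammaℝ_def, Gammaℝ_def, map_mul, conj_ofReal_cpow Real.pi_pos, ← Gamma_conj,
    map_div₀, map_div₀, map_neg, map_ofNat]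

/-- The Gaussian `x ↦ e^{-π t² x²}` as an element of `L²(0,∞)`. -/
noncomputable def gaussVector {t : ℝ} (ht : 0 < t) : HalfLineL2 :=
  ((memLp_gauss ht).restrict (Set.Ioi 0)).toLp

theorem gaussVector_ae_eq {t : ℝ} (ht : 0 < t) :
    ∀ᵐ x ∂(volume.restrict (Set.Ioi (0 : ℝ))), gaussVector ht x = (gauss t x : ℂ) :=
  ((memLp_gauss ht).restrict (Set.Ioi 0)).coeFn_toLp

theorem mellinTransform_gaussVector {t : ℝ} (ht : 0 < t) :
    ∀ᵐ τ : ℝ, mellinTransform (gaussVector ht) τ =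
      (t : ℂ) ^ (criticalPoint τ - 1) * (Gammaℝ (1 - criticalPoint τ) / 2) := by
  have hM : ∀ s : ℂ, 0 < s.re → IntegrableOn (fun x : ℝ => (x : ℂ) ^ (s - 1) * (gauss t x : ℂ))
      (Set.Ioi 0) ∧ ∫ x in Set.Ioi (0 : ℝ), (x : ℂ) ^ (s - 1) * (gauss t x : ℂ) =
        (t : ℂ) ^ (-s) * (Gammaℝ s / 2) := by
    intro s hs
    have h := hasMellin_gauss hs ht
    have e : (fun x => (gauss x t : ℂ)) = fun x => (gauss t x : ℂ) := by
      ext x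
      simp only [gauss]
      ring_nf
    rw [e] at h
    exact ⟨h.1, h.2⟩
  have hi : IntegrableOn (fun x => ‖gaussVector ht x‖ * x ^ (-(1 / 2) : ℝ)) (Set.Ioi 0) := by
    refine (hM (1 / 2 : ℂ) (by simp)).1.norm.congr ?_
    filter_upwards [gaussVector_ae_eq ht, ae_restrict_mem measurableSet_Ioi] with x hx h0
    rw [hx, norm_mul, norm_cpow_eq_rpow_re_of_pos h0, mul_comm]
    norm_num
  filter_upwards [mellinTransform_ae_eq_integral _ hi] with τ hτ
  have h := (hM (1 - criticalPoint τ) (by simp [criticalPoint_re]; norm_num)).2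
  rw [hτ, show criticalPoint τ - 1 = -(1 - criticalPoint τ) by ring, ← h]
  refine integral_congr_ae ?_
  filter_upwards [gaussVector_ae_eq ht] with x hx
  rw [hx, mul_comm, sub_sub_cancel_left]

/-- The Parseval formula for the Mellin transform, against a Gaussian. -/
theorem integral_gauss_mul_eq (f : HalfLineL2) {t : ℝ} (ht : 0 < t) :
    ∫ x in Set.Ioi (0 : ℝ), (gauss t x : ℂ) * f x =
      ∫ τ : ℝ, (t : ℂ) ^ (-criticalPoint τ) / 2 *
        (Gammaℝ (criticalPoint τ) * mellinTransform f τ) := by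
  have h := inner_mellinTransform (gaussVector ht) f
  rw [L2.inner_def, L2.inner_def] at h
  calc _ = ∫ x in Set.Ioi (0 : ℝ), inner ℂ (gaussVector ht x) (f x) := by
        refine integral_congr_ae ?_
        filter_upwards [gaussVector_ae_eq ht] with x hx
        rw [hx, RCLike.inner_apply, conj_ofReal, mul_comm]
    _ = _ := h.symm
    _ = _ := by
        refine integral_congr_ae ?_
        filter_upwards [mellinTransform_gaussVector ht] with τ hτ
        rw [hτ, RCLike.inner_apply, map_mul, conj_ofReal_cpow ht, map_div₀, conj_Gammaℝ, map_sub,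
          map_sub, map_one, conj_criticalPoint, sub_sub_cancel, sub_sub_cancel_left, map_ofNat]
        ring

theorem exists_norm_Gammaℝ_criticalPoint_le :
    ∃ K : ℝ, ∀ τ : ℝ, ‖Gammaℝ (criticalPoint τ)‖ ≤ K := by
  refine ⟨2 * ∫ t in Set.Ioi (0 : ℝ), t ^ (-(1 / 2) : ℝ) * gauss t 1, fun τ => ?_⟩
  have h := (hasMellin_gauss (s := criticalPoint τ) (by rw [criticalPoint_re]; norm_num)
    one_pos).2
  rw [ofReal_one, one_cpow, one_mul] at h
  have e : Gammaℝ (criticalPoint τ) = 2 * mellin (fun t => (gauss t 1 : ℂ)) (criticalPoint τ) := by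
    rw [h]
    ring
  rw [e, norm_mul, norm_ofNat]
  refine mul_le_mul_of_nonneg_left ?_ zero_le_two
  refine (norm_integral_le_integral_norm _).trans (le_of_eq ?_)
  refine setIntegral_congr_fun measurableSet_Ioi fun t ht => ?_
  simp only [norm_smul]
  rw [norm_cpow_eq_rpow_re_of_pos ht, norm_real, Real.norm_of_nonneg (gauss_pos t 1).le, sub_re,
    criticalPoint_re, one_re]
  norm_num

theorem continuous_Gammaℝ_criticalPoint : Continuous fun τ => Gammaℝ (criticalPoint τ) := by
  rw [continuous_iff_continuousAt]
  intro τ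
  have h := analyticAt_Gammaℝ (s := criticalPoint τ) (by rw [criticalPoint_re]; norm_num)
  exact ContinuousAt.comp (f := criticalPoint) h.continuousAt continuous_criticalPoint.continuousAt

/-- The Gaussians `e^{-π t² x²}`, `t > 0`, are total in `L²(0,∞)`: on the Mellin side, the scalar
products with them are the values of a Fourier transform. -/
theorem eq_zero_of_integral_gauss {f : HalfLineL2}
    (h : ∀ t : ℝ, 0 < t → ∫ x in Set.Ioi (0 : ℝ), (gauss t x : ℂ) * f x = 0) : f = 0 := by
  obtain ⟨K, hK⟩ := exists_norm_Gammaℝ_criticalPoint_le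
  set W : ℝ → ℂ := fun τ => Gammaℝ (criticalPoint τ) * mellinTransform f τ with hW
  have hWm : AEStronglyMeasurable W volume :=
    continuous_Gammaℝ_criticalPoint.aestronglyMeasurable.mul (Lp.aestronglyMeasurable _)
  have hW2 : MemLp W 2 volume := by
    refine MemLp.of_le_mul (c := K) (Lp.memLp (mellinTransform f)) hWm
      (Eventually.of_forall fun τ => ?_)
    rw [norm_mul]
    exact mul_le_mul_of_nonneg_right (hK τ) (norm_nonneg _)
  have hG2 : MemLp (fun τ => Gammaℝ (criticalPoint τ)) 2 volume := by
    refine MemLp.of_le_mul (c := 2) (Lp.memLp (mellinTransform (gaussVector one_pos)))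
      continuous_Gammaℝ_criticalPoint.aestronglyMeasurable ?_
    filter_upwards [mellinTransform_gaussVector one_pos] with τ hτ
    rw [hτ, ofReal_one, one_cpow, one_mul, ← conj_criticalPoint, ← conj_Gammaℝ, norm_div,
      RCLike.norm_conj, norm_ofNat]
    linarith
  have hW1 : Integrable W := hG2.integrable_mul (Lp.memLp (mellinTransform f))
  have hF : ∀ v : ℝ, 𝓕 W v = 0 := by
    intro v
    have h1 := h (Real.exp v) (Real.exp_pos v)
    rw [integral_gauss_mul_eq f (Real.exp_pos v)] at h1
    have e : ∫ τ : ℝ, ((Real.exp v : ℝ) : ℂ) ^ (-criticalPoint τ) / 2 * W τ =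
        Complex.exp (-(v / 2)) / 2 * 𝓕 W v := by
      rw [Real.fourier_real_eq_integral_exp_smul, ← integral_const_mul]
      refine integral_congr_ae (Eventually.of_forall fun τ => ?_)
      simp only [ofReal_exp_cpow, smul_eq_mul]
      have e' : Complex.exp (v * -criticalPoint τ) =
          Complex.exp (-(v / 2)) * Complex.exp (↑(-2 * Real.pi * τ * v) * I) := by
        rw [← Complex.exp_add]
        congr 1
        simp only [criticalPoint]
        push_cast
        ring
      rw [e']
      ring
    rw [e] at h1
    exact (mul_eq_zero.1 h1).resolve_left (div_ne_zero (Complex.exp_ne_zero _) two_ne_zero)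
  have h0 : Lp.fourierTransformₗᵢ ℝ ℂ (hW2.toLp W) = 0 := by
    refine Lp.ext ?_
    filter_upwards [fourierLp_toLp_ae_eq hW1 hW2, Lp.coeFn_zero ℂ 2 (volume : Measure ℝ)]
      with v h1 h2
    rw [h1, h2, hF v]
    rfl
  have h1 : hW2.toLp W = 0 := (LinearIsometryEquiv.map_eq_zero_iff _).1 h0
  have h2 : W =ᵐ[volume] 0 := by
    have := hW2.coeFn_toLp
    rw [h1] at this
    exact this.symm.trans (Lp.coeFn_zero ℂ 2 _)
  have h3 : mellinTransform f = 0 := by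
    refine Lp.ext ?_
    filter_upwards [h2, Lp.coeFn_zero ℂ 2 (volume : Measure ℝ)] with τ h4 h5
    rw [h5]
    exact (mul_eq_zero.1 h4).resolve_left
      (Gammaℝ_ne_zero_of_re_pos (by rw [criticalPoint_re]; norm_num))
  have h4 := norm_mellinTransform f
  rw [h3, norm_zero] at h4
  exact norm_eq_zero.1 h4.symm

/-- The functional equation of the Mellin transforms characterizes the cosine transform. -/
theorem cosineTransform_eq_of_mellinTransform {f g : HalfLineL2}
    (h : ∀ᵐ τ : ℝ, Gammaℝ (criticalPoint (-τ)) * mellinTransform g (-τ) =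
      Gammaℝ (criticalPoint τ) * mellinTransform f τ) : cosineTransform f = g := by
  rw [← sub_eq_zero]
  refine eq_zero_of_integral_gauss fun t ht => ?_
  have e : ∫ x in Set.Ioi (0 : ℝ), (gauss t x : ℂ) * (cosineTransform f - g : HalfLineL2) x =
      (∫ x in Set.Ioi (0 : ℝ), (gauss t x : ℂ) * cosineTransform f x) -
        ∫ x in Set.Ioi (0 : ℝ), (gauss t x : ℂ) * g x := by
    rw [← integral_sub (integrableOn_gauss_mul _ ht) (integrableOn_gauss_mul _ ht)]
    refine integral_congr_ae ?_
    filter_upwards [Lp.coeFn_sub (cosineTransform f) g] with x hx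
    rw [hx, Pi.sub_apply, mul_sub]
  have hu : 0 < t⁻¹ := inv_pos.2 ht
  have h1 := integral_gauss_mul_cosineTransform f hu
  rw [inv_inv] at h1
  rw [e, h1, sub_eq_zero, integral_gauss_mul_eq f hu, integral_gauss_mul_eq g ht,
    ← integral_const_mul]
  refine Eq.trans ?_ (integral_neg_eq_self _ volume)
  refine integral_congr_ae ?_
  filter_upwards [h] with τ hτ
  rw [hτ, criticalPoint_neg]
  have htc : (t : ℂ) ≠ 0 := ofReal_ne_zero.2 ht.ne'
  have h2 : ((t⁻¹ : ℝ) : ℂ) ^ (-criticalPoint τ) = (t : ℂ) ^ criticalPoint τ := by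
    rw [cpow_neg, ofReal_inv, inv_cpow, inv_inv]
    rw [arg_ofReal_of_nonneg ht.le]
    exact Real.pi_ne_zero.symm
  rw [h2, neg_sub, cpow_sub _ _ htc, cpow_one]
  push_cast
  field_simp

end BurnolZeta

/-! ### Membership of `ζ(s)/(s - ρ)^k` in `L` -/

namespace BurnolZeta

open Complex Filter

theorem IsTame.memLp {f : ℝ → ℂ} {a : ℂ} (hf : IsTame f a) :
    MemLp f 2 (volume.restrict (Set.Ioi 0)) := by
  rw [memLp_two_iff_integrable_sq_norm hf.measurable.aestronglyMeasurable]
  obtain ⟨C, hC⟩ := hf.exists_norm_le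
  obtain ⟨D, hD⟩ := hf.decay
  have hm : AEStronglyMeasurable (fun x => ‖f x‖ ^ 2) volume :=
    (hf.measurable.norm.pow_const 2).aestronglyMeasurable
  have h1 : IntegrableOn (fun x => ‖f x‖ ^ 2) (Set.Ioc 0 1) := by
    refine Measure.integrableOn_of_bounded (M := C ^ 2) measure_Ioc_lt_top.ne hm ?_
    filter_upwards [ae_restrict_mem measurableSet_Ioc] with x hx
    rw [norm_pow, norm_norm]
    exact pow_le_pow_left₀ (norm_nonneg _) (hC x hx.1) 2
  have h2 : IntegrableOn (fun x => ‖f x‖ ^ 2) (Set.Ioi 1) := by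
    have hi := (integrableOn_Ioi_rpow_of_lt (show (-2 : ℝ) < -1 by norm_num) one_pos).const_mul
      (D ^ 2)
    refine Integrable.mono' hi hm.restrict ?_
    filter_upwards [ae_restrict_mem measurableSet_Ioi] with x hx
    have hx0 : 0 < x := zero_lt_one.trans hx
    rw [norm_pow, norm_norm, Real.rpow_neg hx0.le, Real.rpow_two, ← div_eq_mul_inv, ← div_pow]
    exact pow_le_pow_left₀ (norm_nonneg _) (hD x (le_of_lt hx)) 2
  have h3 := h1.union h2
  rwa [Set.Ioc_union_Ioi_eq_Ioi (zero_le_one (α := ℝ))] at h3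

theorem IsTame.exists_mem_constantNearZero {f : ℝ → ℂ} {a : ℂ} (hf : IsTame f a) :
    ∃ F ∈ constantNearZero, ∀ᵐ τ : ℝ, mellinTransform F τ = mellin f (1 - criticalPoint τ) := by
  have hae := hf.memLp.coeFn_toLp
  refine ⟨hf.memLp.toLp, mem_constantNearZero.2 ⟨a, ?_⟩, ?_⟩
  · filter_upwards [ae_restrict_of_ae_restrict_of_subset (fun x (hx : x ∈ Set.Ioo (0 : ℝ) 1) => hx.1)
      hae, ae_restrict_mem measurableSet_Ioo] with x hx h1
    rw [hx, hf.eq_const x h1.1 h1.2]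
  · have hi : IntegrableOn (fun x => ‖hf.memLp.toLp f x‖ * x ^ (-(1 / 2) : ℝ)) (Set.Ioi 0) := by
      have h1 : MellinConvergent f (1 / 2 : ℂ) :=
        hf.mellinConvergent (by norm_num) (by norm_num)
      refine (Integrable.norm h1).congr ?_
      filter_upwards [hae, ae_restrict_mem measurableSet_Ioi] with x hx h0
      rw [hx, norm_smul, norm_cpow_eq_rpow_re_of_pos h0, mul_comm]
      norm_num
    filter_upwards [mellinTransform_ae_eq_integral _ hi] with τ hτ
    rw [hτ, mellin]
    refine integral_congr_ae ?_
    filter_upwards [hae] with x hx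
    rw [hx, smul_eq_mul, mul_comm, sub_sub_cancel_left]

theorem criticalPoint_injective : Function.Injective criticalPoint := by
  intro x y h
  have h1 := congrArg im h
  rw [criticalPoint_im, criticalPoint_im] at h1
  exact mul_left_cancel₀ (mul_ne_zero two_ne_zero Real.pi_ne_zero) h1

theorem ae_criticalPoint_ne (ρ : ℂ) : ∀ᵐ τ : ℝ, criticalPoint τ ≠ ρ := by
  rw [ae_iff]
  refine Set.Subsingleton.measure_zero (fun x hx y hy => ?_) _
  simp only [ne_eq, not_not, Set.mem_ofPred_eq] at hx hy
  exact criticalPoint_injective (hx.trans hy.symm)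

/-- The symmetric form of the functional equation, `Γ_ℝ(1-s) ζ(1-s) = Γ_ℝ(s) ζ(s)`. -/
theorem Gammaℝ_mul_riemannZeta_one_sub {s : ℂ} (h0 : 0 < s.re) (h1 : s.re < 1) :
    Gammaℝ (1 - s) * riemannZeta (1 - s) = Gammaℝ s * riemannZeta s := by
  obtain ⟨hne, hx⟩ := xi_eq_of_mem_strip h0 h1
  obtain ⟨-, hx'⟩ := xi_eq_of_mem_strip (s := 1 - s) (by simpa using h1) (by simpa using h0)
  rw [xi_one_sub, hx, sub_sub_cancel] at hx'
  refine mul_left_cancel₀ (left_ne_zero_of_mul hne) ?_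
  linear_combination -hx'

/-! ### The functions `ζ(s)/(s - ρ)^k` -/

theorem zetaQuotient_of_ne {ρ s : ℂ} (k : ℕ) (hs : s ≠ ρ) :
    zetaQuotient ρ k s = riemannZeta s / (s - ρ) ^ k :=
  Function.update_of_ne hs _ _

/-- The singularity of `ζ(s)/(s - ρ)^k` at `ρ` is removable, for `k` up to the multiplicity. -/
theorem analyticAt_zetaQuotient_self {ρ : ℂ} (hρ : ρ ∈ nontrivialZeros) {k : ℕ}
    (hk : k ≤ analyticOrderNatAt riemannZeta ρ) : AnalyticAt ℂ (zetaQuotient ρ k) ρ := by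
  have h1 : (k : ℕ∞) ≤ analyticOrderAt riemannZeta ρ := by
    rw [← cast_analyticOrderNatAt_riemannZeta hρ]
    exact_mod_cast hk
  obtain ⟨q, hq, hqe⟩ := (natCast_le_analyticOrderAt
    (analyticAt_riemannZeta (ne_one_of_mem_nontrivialZeros hρ))).1 h1
  have e : ∀ᶠ z in 𝓝[≠] ρ, q z = riemannZeta z / (z - ρ) ^ k := by
    filter_upwards [hqe.filter_mono nhdsWithin_le_nhds, self_mem_nhdsWithin] with z hz hz1
    have : z - ρ ≠ 0 := sub_ne_zero.2 hz1
    rw [hz, smul_eq_mul]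
    field_simp
  have hlim : Tendsto (fun s => riemannZeta s / (s - ρ) ^ k) (𝓝[≠] ρ) (𝓝 (q ρ)) :=
    (hq.continuousAt.tendsto.mono_left nhdsWithin_le_nhds).congr' e
  refine hq.congr ?_
  filter_upwards [eventually_nhdsWithin_iff.1 e] with z hz
  by_cases h : z = ρ
  · rw [h, zetaQuotient, Function.update_self, hlim.limUnder_eq]
  · rw [zetaQuotient_of_ne k h, hz h]

theorem zetaQuotient_eventuallyEq {ρ s : ℂ} (k : ℕ) (hs : s ≠ ρ) :
    zetaQuotient ρ k =ᶠ[𝓝 s] fun z => riemannZeta z / (z - ρ) ^ k := by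
  filter_upwards [isOpen_compl_singleton.mem_nhds hs] with z hz
  exact zetaQuotient_of_ne k hz

theorem analyticAt_zetaQuotient {ρ : ℂ} (hρ : ρ ∈ nontrivialZeros) {k : ℕ}
    (hk : k ≤ analyticOrderNatAt riemannZeta ρ) {s : ℂ} (hs : s ≠ 1) :
    AnalyticAt ℂ (zetaQuotient ρ k) s := by
  by_cases h : s = ρ
  · rw [h]
    exact analyticAt_zetaQuotient_self hρ hk
  · refine AnalyticAt.congr ?_ (zetaQuotient_eventuallyEq k h).symm
    have hp : AnalyticAt ℂ (fun z : ℂ => (z - ρ) ^ k) s := by fun_prop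
    exact (analyticAt_riemannZeta hs).div hp (pow_ne_zero k (sub_ne_zero.2 h))

theorem meromorphicAt_zetaQuotient_one {ρ : ℂ} (hρ : ρ ∈ nontrivialZeros) (k : ℕ) :
    MeromorphicAt (zetaQuotient ρ k) 1 := by
  have hp : AnalyticAt ℂ (fun z : ℂ => (z - ρ) ^ k) 1 := by fun_prop
  have h := meromorphicAt_riemannZeta_one.div hp.meromorphicAt
  refine h.congr ?_
  have h1 : (1 : ℂ) ≠ ρ := (ne_one_of_mem_nontrivialZeros hρ).symm
  exact ((zetaQuotient_eventuallyEq k h1).symm.filter_mono nhdsWithin_le_nhds)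

/-- For `k` up to the multiplicity of `ρ`, the function `ζ(s)/(s - ρ)^k` belongs to the space `L`.
The cosine transform of its Mellin preimage is, up to a sign, the preimage of
`ζ(s)/(s - (1 - ρ))^k`. -/
theorem exists_mem_spaceL_zetaQuotient {ρ : ℂ} (hρ : ρ ∈ nontrivialZeros) {k : ℕ} (hk1 : 1 ≤ k)
    (hk : k ≤ analyticOrderNatAt riemannZeta ρ) :
    ∃ G ∈ spaceL, IsMeromorphicExtension G (zetaQuotient ρ k) := by
  obtain ⟨j, rfl⟩ : ∃ j, k = j + 1 := ⟨k - 1, by omega⟩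
  have hstrip : ∀ τ, 0 < (criticalPoint τ).re ∧ (criticalPoint τ).re < 1 := fun τ => by
    rw [criticalPoint_re]
    norm_num
  have hvec : ∀ ρ ∈ nontrivialZeros, j + 1 ≤ analyticOrderNatAt riemannZeta ρ →
      ∃ F ∈ constantNearZero, ∀ᵐ τ : ℝ,
        (criticalPoint τ - ρ) ^ (j + 1) * mellinTransform F τ = riemannZeta (criticalPoint τ) := by
    intro ρ hρ hj
    obtain ⟨f, a, hf, hM⟩ := exists_isTame_mellin hρ j hj
    obtain ⟨F, hF, hFM⟩ := hf.exists_mem_constantNearZero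
    refine ⟨F, hF, ?_⟩
    filter_upwards [hFM] with τ hτ
    rw [hτ]
    exact hM _ (hstrip τ).1 (hstrip τ).2
  obtain ⟨F, hF, hFM⟩ := hvec ρ hρ hk
  obtain ⟨F', hF', hFM'⟩ := hvec (1 - ρ) (one_sub_mem_nontrivialZeros hρ)
    (by rwa [analyticOrderNatAt_riemannZeta_one_sub hρ])
  have hcos : cosineTransform F = (-1 : ℂ) ^ (j + 1) • F' := by
    refine cosineTransform_eq_of_mellinTransform ?_
    have hqm := (Measure.measurePreserving_neg (volume : Measure ℝ)).quasiMeasurePreserving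
    have hs : ∀ᵐ τ : ℝ, mellinTransform ((-1 : ℂ) ^ (j + 1) • F') τ =
        (-1 : ℂ) ^ (j + 1) * mellinTransform F' τ := by
      rw [map_smul]
      exact Lp.coeFn_smul _ _
    filter_upwards [hFM, hqm.ae hFM', hqm.ae hs, ae_criticalPoint_ne ρ] with τ h1 h2 h3 h4
    have hne : (criticalPoint τ - ρ) ^ (j + 1) ≠ 0 := pow_ne_zero _ (sub_ne_zero.2 h4)
    rw [criticalPoint_neg] at h2
    rw [h3, criticalPoint_neg]
    refine mul_left_cancel₀ hne ?_
    have hfe := Gammaℝ_mul_riemannZeta_one_sub (hstrip τ).1 (hstrip τ).2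
    rw [← h1, ← h2, show 1 - criticalPoint τ - (1 - ρ) = -1 * (criticalPoint τ - ρ) by ring,
      mul_pow] at hfe
    linear_combination hfe
  refine ⟨mellinTransform F, ⟨F, ⟨hF, ?_⟩, rfl⟩, fun s hs => ?_,
    meromorphicAt_zetaQuotient_one hρ _, ?_⟩
  · show cosineTransform F ∈ constantNearZero
    rw [hcos]
    exact Submodule.smul_mem _ _ hF'
  · exact (analyticAt_zetaQuotient hρ hk hs).differentiableAt.differentiableWithinAt
  · filter_upwards [hFM, ae_criticalPoint_ne ρ] with τ h1 h2
    have hne : (criticalPoint τ - ρ) ^ (j + 1) ≠ 0 := pow_ne_zero _ (sub_ne_zero.2 h2)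
    rw [zetaQuotient_of_ne _ h2, ← h1]
    field_simp

end BurnolZeta

/-! ### Uniqueness of the extension, and of functions with given jets at the zeros -/

namespace BurnolZeta

open Complex Filter

namespace IsMeromorphicExtension

variable {G G' : CriticalLineL2} {g g' : ℂ → ℂ}

theorem analyticOnNhd (h : IsMeromorphicExtension G g) : AnalyticOnNhd ℂ g {1}ᶜ :=
  h.1.analyticOnNhd isOpen_compl_singleton

theorem analyticAt (h : IsMeromorphicExtension G g) {s : ℂ} (hs : s ≠ 1) : AnalyticAt ℂ g s :=
  h.analyticOnNhd s hs

theorem congr (h : IsMeromorphicExtension G g) (hg : ∀ s, s ≠ 1 → g' s = g s) :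
    IsMeromorphicExtension G g' := by
  refine ⟨h.1.congr hg, h.2.1.congr ?_, ?_⟩
  · filter_upwards [self_mem_nhdsWithin] with s hs
    exact (hg s hs).symm
  · filter_upwards [h.2.2, ae_criticalPoint_ne 1] with τ h1 h2
    rw [h1, hg _ h2]

theorem zero : IsMeromorphicExtension 0 0 :=
  ⟨differentiableOn_const 0, MeromorphicAt.const 0 1, Lp.coeFn_zero ℂ 2 _⟩

theorem add (h : IsMeromorphicExtension G g) (h' : IsMeromorphicExtension G' g') :
    IsMeromorphicExtension (G + G') (g + g') := by
  refine ⟨h.1.add h'.1, h.2.1.add h'.2.1, ?_⟩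
  filter_upwards [h.2.2, h'.2.2, Lp.coeFn_add G G'] with τ h1 h2 h3
  rw [h3, Pi.add_apply, h1, h2, Pi.add_apply]

theorem smul (c : ℂ) (h : IsMeromorphicExtension G g) :
    IsMeromorphicExtension (c • G) (c • g) := by
  refine ⟨h.1.const_smul c, (MeromorphicAt.const c 1).smul h.2.1, ?_⟩
  filter_upwards [h.2.2, Lp.coeFn_smul c G] with τ h1 h3
  rw [h3, Pi.smul_apply, h1, Pi.smul_apply]

/-- The extension is unique away from `1`, by the identity theorem. -/
theorem eq_of_ne_one (h : IsMeromorphicExtension G g) (h' : IsMeromorphicExtension G g') {s : ℂ}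
    (hs : s ≠ 1) : g s = g' s := by
  have hne : ∀ τ, criticalPoint τ ≠ 1 := fun τ h => by
    have := congrArg re h
    rw [criticalPoint_re, one_re] at this
    norm_num at this
  have hcont : ∀ {G : CriticalLineL2} {g : ℂ → ℂ}, IsMeromorphicExtension G g →
      Continuous fun τ => g (criticalPoint τ) := by
    intro G g h
    rw [continuous_iff_continuousAt]
    intro τ
    exact ContinuousAt.comp (f := criticalPoint) (h.analyticAt (hne τ)).continuousAt
      continuous_criticalPoint.continuousAt
  have hline : (fun τ => g (criticalPoint τ)) = fun τ => g' (criticalPoint τ) := by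
    refine ((hcont h).ae_eq_iff_eq volume (hcont h')).1 ?_
    filter_upwards [h.2.2, h'.2.2] with τ h1 h2
    rw [← h1, ← h2]
  have hpre : IsPreconnected ({1}ᶜ : Set ℂ) :=
    (isConnected_compl_singleton_of_one_lt_rank (by simp) 1).isPreconnected
  refine h.analyticOnNhd.eqOn_of_preconnected_of_frequently_eq h'.analyticOnNhd hpre
    (z₀ := criticalPoint 0) (hne 0) ?_ hs
  have ht : Tendsto criticalPoint (𝓝[≠] 0) (𝓝[≠] criticalPoint 0) := by
    refine tendsto_nhdsWithin_of_tendsto_nhds_of_eventually_within _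
      (continuous_criticalPoint.continuousAt.tendsto.mono_left nhdsWithin_le_nhds) ?_
    filter_upwards [self_mem_nhdsWithin] with τ hτ
    exact fun h => hτ (criticalPoint_injective h)
  exact ht.frequently (Eventually.of_forall fun τ => congrFun hline τ).frequently

theorem eventuallyEq (h : IsMeromorphicExtension G g) (h' : IsMeromorphicExtension G g') {s : ℂ}
    (hs : s ≠ 1) : g =ᶠ[𝓝 s] g' := by
  filter_upwards [isOpen_compl_singleton.mem_nhds hs] with z hz
  exact h.eq_of_ne_one h' hz

end IsMeromorphicExtension

/-- The elements of `L` come from pairs of functions, and so extend to `ℂ ∖ {1}`. -/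
theorem exists_cosinePair_of_mem_spaceL {G : CriticalLineL2} (hG : G ∈ spaceL) :
    ∃ p : CosinePair, IsMeromorphicExtension G p.ext ∧ ‖p.f‖ = ‖G‖ ∧ ‖p.f'‖ ≤ 2 * ‖G‖ := by
  obtain ⟨f, hf, rfl⟩ := hG
  obtain ⟨p, rfl, hp'⟩ := exists_cosinePair hf
  refine ⟨p, ⟨p.differentiableOn_ext, p.meromorphicAt_ext, p.mellinTransform_ae_eq_ext⟩,
    (norm_mellinTransform _).symm, ?_⟩
  rw [hp', norm_mellinTransform]
  exact norm_cosineTransform_le _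

/-- A function in `L` is determined by its jets at the zeros of `ζ`, taken with multiplicity:
if `g` vanishes with the multiplicities of the zeros, then its completion is an entire multiple of
`xi`, and the growth estimates force the quotient to vanish. -/
theorem eq_zero_of_analyticOrderAt_le {G : CriticalLineL2} (hG : G ∈ spaceL) {g : ℂ → ℂ}
    (hg : IsMeromorphicExtension G g)
    (h : ∀ ρ ∈ nontrivialZeros, analyticOrderAt riemannZeta ρ ≤ analyticOrderAt g ρ) :
    G = 0 ∧ ∀ s : ℂ, s ≠ 1 → g s = 0 := by
  obtain ⟨p, hp, -, -⟩ := exists_cosinePair_of_mem_spaceL hG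
  have hord : ∀ z, analyticOrderAt xi z ≤ analyticOrderAt p.completed z := by
    intro z
    by_cases hz : xi z = 0
    · have hzN := mem_nontrivialZeros_iff.2 hz
      have h1 := ne_one_of_mem_nontrivialZeros hzN
      obtain ⟨hA, hA0⟩ := analyticOrderAt_strip_factor hzN.2.1 hzN.2.2
      have e : p.completed =ᶠ[𝓝 z] (fun s => s * (1 - s) * Gammaℝ s) * p.ext := by
        filter_upwards [eventually_mem_strip hzN.2.1 hzN.2.2] with w hw
        have hne := (xi_eq_of_mem_strip hw.1 hw.2).1
        have hne' := left_ne_zero_of_mul hne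
        exact p.completed_eq (left_ne_zero_of_mul hne')
          (sub_ne_zero.1 (right_ne_zero_of_mul hne')).symm (right_ne_zero_of_mul hne)
      rw [analyticOrderAt_congr e, analyticOrderAt_mul hA (hp.analyticAt h1), hA0, zero_add,
        analyticOrderAt_xi_eq hzN.2.1 hzN.2.2, ← analyticOrderAt_congr (hg.eventuallyEq hp h1)]
      exact h z hzN
    · rw [(differentiable_xi.analyticAt z).analyticOrderAt_eq_zero.2 hz]
      exact zero_le
  obtain ⟨H, hH, hHe⟩ := exists_entire_quotient p.differentiable_completed differentiable_xi
    analyticOrderAt_xi_ne_top hord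
  obtain ⟨A, hA⟩ := p.exists_norm_completed_le
  obtain ⟨K, hK⟩ := p.exists_norm_completed_le_of_two_le
  obtain ⟨K', hK'⟩ := p.swap.exists_norm_completed_le_of_two_le
  have hle : ∀ (B : ℝ) (s : ℂ), B ≤ max K K' → B / √s.re * ‖s * (1 - s) * Gammaℝ s‖ ≤
      max K K' / √s.re * ‖s * (1 - s) * Gammaℝ s‖ := fun B s hB => by gcongr
  have hH0 := eq_zero_of_mul_xi hH hHe hA
    (fun s hs => (hK s hs).trans (hle K s (le_max_left _ _)))
    (fun s hs => by
      rw [← p.swap_completed]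
      exact (hK' s hs).trans (hle K' s (le_max_right _ _)))
  have hG0 : G = 0 := by
    refine Lp.ext ?_
    filter_upwards [hp.2.2, Lp.coeFn_zero ℂ 2 (volume : Measure ℝ)] with τ h1 h2
    have h0 : 0 < (criticalPoint τ).re ∧ (criticalPoint τ).re < 1 := by
      rw [criticalPoint_re]
      norm_num
    have hne := (xi_eq_of_mem_strip h0.1 h0.2).1
    have hne' := left_ne_zero_of_mul hne
    have h3 := p.completed_eq (left_ne_zero_of_mul hne')
      (sub_ne_zero.1 (right_ne_zero_of_mul hne')).symm (right_ne_zero_of_mul hne)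
    rw [hHe, hH0, zero_mul] at h3
    rw [h1, h2]
    exact (mul_eq_zero.1 h3.symm).resolve_left hne
  refine ⟨hG0, fun s hs => ?_⟩
  rw [hG0] at hg
  exact hg.eq_of_ne_one IsMeromorphicExtension.zero hs

/-! ### Evaluators -/

/-- The evaluation of the derivatives at a point other than `1` is a bounded linear form on `L`. -/
theorem exists_evaluator {ρ : ℂ} (hρ : ρ ≠ 1) (j : ℕ) :
    ∃ Y : spaceL, ∀ (G : spaceL) (g : ℂ → ℂ), IsMeromorphicExtension (G : CriticalLineL2) g →
      inner ℂ Y G = iteratedDeriv j g ρ := by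
  have hex : ∀ G : spaceL, ∃ p : CosinePair, IsMeromorphicExtension (G : CriticalLineL2) p.ext ∧
      ‖p.f‖ = ‖(G : CriticalLineL2)‖ ∧ ‖p.f'‖ ≤ 2 * ‖(G : CriticalLineL2)‖ := fun G =>
    exists_cosinePair_of_mem_spaceL G.2
  choose p hp hf hf' using hex
  have hder : ∀ (G : spaceL) (g : ℂ → ℂ), IsMeromorphicExtension (G : CriticalLineL2) g →
      iteratedDeriv j (p G).ext ρ = iteratedDeriv j g ρ := fun G g hg =>
    ((hp G).eventuallyEq hg hρ).iteratedDeriv_eq j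
  let ev : spaceL →ₗ[ℂ] ℂ :=
    { toFun := fun G => iteratedDeriv j (p G).ext ρ
      map_add' := fun G G' => by
        have h := (hp G).add (hp G')
        rw [← Submodule.coe_add] at h
        rw [hder _ _ h, iteratedDeriv_add ((hp G).analyticAt hρ).contDiffAt
          ((hp G').analyticAt hρ).contDiffAt]
      map_smul' := fun c G => by
        have h := (hp G).smul c
        rw [← Submodule.coe_smul] at h
        rw [hder _ _ h, iteratedDeriv_const_smul ((hp G).analyticAt hρ).contDiffAt]
        rfl }
  -- Cauchy's estimate on a circle around `ρ` that keeps away from `1`.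
  set r := ‖1 - ρ‖ / 2 with hr
  have hr0 : 0 < r := half_pos (norm_pos_iff.2 (sub_ne_zero.2 hρ.symm))
  obtain ⟨C, hC⟩ := CosinePair.exists_norm_numerator_le (‖ρ‖ + r)
  have hdist : ∀ s ∈ Metric.closedBall ρ r, r ≤ ‖1 - s‖ := by
    intro s hs
    have h1 : ‖s - ρ‖ ≤ r := by simpa [dist_eq_norm] using hs
    have h2 : ‖1 - ρ‖ ≤ ‖1 - s‖ + ‖s - ρ‖ := norm_sub_le_norm_sub_add_norm_sub 1 s ρ
    linarith
  have hbound : ∀ G : spaceL, ‖ev G‖ ≤ (j.factorial * (3 * |C| / r) / r ^ j) * ‖G‖ := by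
    intro G
    have hd : DiffContOnCl ℂ (p G).ext (Metric.ball ρ r) := by
      refine DifferentiableOn.diffContOnCl ?_
      rw [closure_ball _ hr0.ne']
      refine (p G).differentiableOn_ext.mono fun s hs h1 => ?_
      have h2 := hdist s hs
      rw [Set.mem_singleton_iff.1 h1, sub_self, norm_zero] at h2
      linarith
    have hs : ∀ s ∈ Metric.sphere ρ r, ‖(p G).ext s‖ ≤ 3 * |C| / r * ‖G‖ := by
      intro s hs
      have h2 := hdist s (Metric.sphere_subset_closedBall hs)
      have h3 : ‖s‖ ≤ ‖ρ‖ + r := by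
        have h4 : ‖s - ρ‖ = r := by simpa [dist_eq_norm] using hs
        have h5 := norm_add_le ρ (s - ρ)
        rw [add_sub_cancel, h4] at h5
        exact h5
      rw [CosinePair.ext, norm_div]
      calc ‖(p G).numerator s‖ / ‖1 - s‖ ≤ (|C| * (3 * ‖G‖)) / r := by
            gcongr
            refine (hC (p G) s h3).trans ?_
            have h6 : ‖(p G).f‖ + ‖(p G).f'‖ ≤ 3 * ‖G‖ := by
              have h7 := hf' G
              rw [hf G]
              rw [← Submodule.coe_norm] at h7 ⊢
              linarith
            calc C * (‖(p G).f‖ + ‖(p G).f'‖) ≤ |C| * (‖(p G).f‖ + ‖(p G).f'‖) := by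
                  gcongr
                  exact le_abs_self C
              _ ≤ _ := by gcongr
        _ = _ := by ring
    refine (norm_iteratedDeriv_le_of_forall_mem_sphere_norm_le j hr0 hd hs).trans (le_of_eq ?_)
    ring
  refine ⟨(InnerProductSpace.toDual ℂ spaceL).symm (ev.mkContinuous _ hbound), fun G g hg => ?_⟩
  rw [InnerProductSpace.toDual_symm_apply]
  exact hder G g hg

end BurnolZeta

/-! ### Completeness of the evaluators -/

namespace BurnolZeta

open Complex Filter

/-- The evaluators at the non-trivial zeros, up to the multiplicity, are complete in `L`: a function
orthogonal to all of them vanishes with full multiplicities. -/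
theorem topologicalClosure_span_evaluators_eq_top {Y : zeroIndex → spaceL}
    (hY : ∀ (p : zeroIndex) (G : spaceL) (g : ℂ → ℂ),
      IsMeromorphicExtension (G : CriticalLineL2) g →
        inner ℂ (Y p) G = iteratedDeriv (p.1.2 - 1) g p.1.1) :
    (Submodule.span ℂ (Set.range Y)).topologicalClosure = ⊤ := by
  rw [Submodule.topologicalClosure_eq_top_iff, Submodule.eq_bot_iff]
  intro G hG
  obtain ⟨p, hp, -, -⟩ := exists_cosinePair_of_mem_spaceL G.2
  refine Subtype.ext (eq_zero_of_analyticOrderAt_le G.2 hp fun ρ hρ => ?_).1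
  rw [← cast_analyticOrderNatAt_riemannZeta hρ, natCast_le_analyticOrderAt_iff_iteratedDeriv_eq_zero
    (hp.analyticAt (ne_one_of_mem_nontrivialZeros hρ))]
  intro i hi
  have h := hY ⟨(ρ, i + 1), hρ, Nat.le_add_left 1 i, hi⟩ G _ hp
  simp only [add_tsub_cancel_right] at h
  rw [← h]
  exact (Submodule.mem_orthogonal _ _).1 hG _ (Submodule.subset_span ⟨_, rfl⟩)

/-! ### Functions vanishing at almost all zeros -/

/-- The order of `ζ(s)/(s - ρ)^k` at a zero other than `ρ` is the multiplicity of that zero. -/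
theorem analyticOrderAt_zetaQuotient_of_ne {ρ z : ℂ} (k : ℕ) (hz : z ∈ nontrivialZeros)
    (hne : z ≠ ρ) : analyticOrderAt (zetaQuotient ρ k) z = analyticOrderAt riemannZeta z := by
  have hp : AnalyticAt ℂ (fun w : ℂ => ((w - ρ) ^ k)⁻¹) z :=
    AnalyticAt.inv (by fun_prop) (pow_ne_zero k (sub_ne_zero.2 hne))
  have h0 : analyticOrderAt (fun w : ℂ => ((w - ρ) ^ k)⁻¹) z = 0 :=
    hp.analyticOrderAt_eq_zero.2 (inv_ne_zero (pow_ne_zero k (sub_ne_zero.2 hne)))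
  have e : zetaQuotient ρ k =ᶠ[𝓝 z] riemannZeta * fun w : ℂ => ((w - ρ) ^ k)⁻¹ :=
    (zetaQuotient_eventuallyEq k hne).trans
      (Eventually.of_forall fun w => div_eq_mul_inv _ _)
  rw [analyticOrderAt_congr e, analyticOrderAt_mul
    (analyticAt_riemannZeta (ne_one_of_mem_nontrivialZeros hz)) hp, h0, add_zero]

theorem analyticOrderAt_zetaQuotient_self {ρ : ℂ} (hρ : ρ ∈ nontrivialZeros) {r k : ℕ}
    (hk : r + k = analyticOrderNatAt riemannZeta ρ) :
    analyticOrderAt (zetaQuotient ρ k) ρ = r := by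
  have hA := analyticAt_zetaQuotient_self hρ (k := k) (by omega)
  have hp : AnalyticAt ℂ ((· - ρ) ^ k : ℂ → ℂ) ρ := by fun_prop
  have e : ∀ᶠ z in 𝓝[≠] ρ, riemannZeta z = (((· - ρ) ^ k : ℂ → ℂ) * zetaQuotient ρ k) z := by
    filter_upwards [self_mem_nhdsWithin] with z hz
    have : z - ρ ≠ 0 := sub_ne_zero.2 hz
    rw [Pi.mul_apply, zetaQuotient_of_ne k hz, Pi.pow_apply]
    field_simp
  have e' : riemannZeta =ᶠ[𝓝 ρ] ((· - ρ) ^ k : ℂ → ℂ) * zetaQuotient ρ k :=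
    ((analyticAt_riemannZeta (ne_one_of_mem_nontrivialZeros hρ)).frequently_eq_iff_eventually_eq
      (hp.mul hA)).1 e.frequently
  have h := analyticOrderAt_congr e'
  rw [analyticOrderAt_mul hp hA, analyticOrderAt_centeredMonomial,
    ← cast_analyticOrderNatAt_riemannZeta hρ, ← hk] at h
  push_cast at h
  rw [add_comm] at h
  exact (WithTop.add_left_cancel (ENat.natCast_ne_top k) h).symm

/-- Subtracting a multiple of a function of order exactly `r` raises the order. -/
theorem exists_add_one_le_analyticOrderAt {g q : ℂ → ℂ} {z : ℂ} {r : ℕ} (hg : AnalyticAt ℂ g z)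
    (hq : AnalyticAt ℂ q z) (hgr : (r : ℕ∞) ≤ analyticOrderAt g z)
    (hqr : analyticOrderAt q z = r) :
    ∃ a : ℂ, ((r + 1 : ℕ) : ℕ∞) ≤ analyticOrderAt (g + a • q) z := by
  obtain ⟨u, hu, hue⟩ := (natCast_le_analyticOrderAt hg).1 hgr
  obtain ⟨v, hv, hv0, hve⟩ := hq.analyticOrderAt_eq_natCast.1 hqr
  refine ⟨-(u z / v z), ?_⟩
  set w : ℂ → ℂ := fun x => u x + -(u z / v z) * v x with hw
  have hwA : AnalyticAt ℂ w z := hu.add (analyticAt_const.mul hv)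
  have hw0 : w z = 0 := by
    simp only [hw]
    field_simp
    ring
  have hp : AnalyticAt ℂ ((· - z) ^ r : ℂ → ℂ) z := by fun_prop
  have e : g + -(u z / v z) • q =ᶠ[𝓝 z] ((· - z) ^ r : ℂ → ℂ) * w := by
    filter_upwards [hue, hve] with x h1 h2
    simp only [Pi.add_apply, Pi.smul_apply, Pi.mul_apply, Pi.pow_apply, h1, h2, smul_eq_mul, hw]
    ring
  rw [analyticOrderAt_congr e, analyticOrderAt_mul hp hwA, analyticOrderAt_centeredMonomial]
  push_cast
  gcongr
  exact Order.one_le_iff_ne_zero.2 (hwA.analyticOrderAt_ne_zero.2 hw0)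

theorem le_analyticOrderAt_const_smul (c : ℂ) {q : ℂ → ℂ} {z : ℂ} (hq : AnalyticAt ℂ q z) :
    analyticOrderAt q z ≤ analyticOrderAt (c • q) z := by
  have e : c • q = (fun _ => c) * q := rfl
  rw [e, analyticOrderAt_mul analyticAt_const hq]
  exact le_add_self

/-- The non-trivial zeros where `g` vanishes to an order less than `ζ` does. -/
def exceptionalZeros (g : ℂ → ℂ) : Set ℂ :=
  {ρ ∈ nontrivialZeros | ¬ analyticOrderAt riemannZeta ρ ≤ analyticOrderAt g ρ}

theorem exceptionalZeros_add_subset (g g' : ℂ → ℂ) :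
    exceptionalZeros (g + g') ⊆ exceptionalZeros g ∪ exceptionalZeros g' := by
  rintro ρ ⟨hρ, h⟩
  by_contra hn
  rw [Set.mem_union, not_or] at hn
  have h1 : analyticOrderAt riemannZeta ρ ≤ analyticOrderAt g ρ := by
    by_contra h1
    exact hn.1 ⟨hρ, h1⟩
  have h2 : analyticOrderAt riemannZeta ρ ≤ analyticOrderAt g' ρ := by
    by_contra h2
    exact hn.2 ⟨hρ, h2⟩
  exact h ((le_min h1 h2).trans le_analyticOrderAt_add)

theorem exceptionalZeros_smul_zetaQuotient_subset (c : ℂ) {p : ℂ × ℕ} (hp : p ∈ zeroIndex) :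
    exceptionalZeros (c • zetaQuotient p.1 p.2) ⊆ {p.1} := by
  rintro ρ ⟨hρ, h⟩
  by_contra hne
  refine h ?_
  rw [← analyticOrderAt_zetaQuotient_of_ne p.2 hρ hne]
  exact le_analyticOrderAt_const_smul c
    (analyticAt_zetaQuotient hp.1 hp.2.2 (ne_one_of_mem_nontrivialZeros hρ))

theorem exceptionalZeros_congr {g g' : ℂ → ℂ} (h : ∀ s, s ≠ 1 → g s = g' s) :
    exceptionalZeros g = exceptionalZeros g' := by
  ext ρ
  refine and_congr_right fun hρ => ?_
  have e : g =ᶠ[𝓝 ρ] g' := by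
    filter_upwards [isOpen_compl_singleton.mem_nhds (ne_one_of_mem_nontrivialZeros hρ)] with z hz
    exact h z hz
  rw [analyticOrderAt_congr e]

/-- The finite linear combinations, away from `1`, of the functions `ζ(s)/(s - ρ)^k`. -/
def IsZetaCombination (g : ℂ → ℂ) : Prop :=
  ∃ c : zeroIndex →₀ ℂ, ∀ s : ℂ, s ≠ 1 →
    g s = c.sum fun p a => a * zetaQuotient p.1.1 p.1.2 s

theorem IsZetaCombination.of_add_smul {g : ℂ → ℂ} {a : ℂ} {p : ℂ × ℕ} (hp : p ∈ zeroIndex)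
    (h : IsZetaCombination (g + a • zetaQuotient p.1 p.2)) : IsZetaCombination g := by
  obtain ⟨c, hc⟩ := h
  refine ⟨c + Finsupp.single ⟨p, hp⟩ (-a), fun s hs => ?_⟩
  rw [Finsupp.sum_add_index' (by simp) (by intros; ring), ← hc s hs,
    Finsupp.sum_single_index (by simp)]
  simp

/-- The exceptional zeros are removed one at a time, by raising the order at each of them up to the
multiplicity with multiples of `ζ(s)/(s - ρ)^k` for `k` decreasing to `1`. -/
theorem isZetaCombination_of_exceptionalZeros_subset (S : Finset ℂ) :
    (∀ ρ ∈ S, ρ ∈ nontrivialZeros) → ∀ G ∈ spaceL, ∀ g : ℂ → ℂ, IsMeromorphicExtension G g →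
      exceptionalZeros g ⊆ S → IsZetaCombination g := by
  induction S using Finset.induction_on with
  | empty =>
    intro _ G hG g hg hS
    refine ⟨0, fun s hs => ?_⟩
    rw [Finsupp.sum_zero_index]
    refine (eq_zero_of_analyticOrderAt_le hG hg fun ρ hρ => ?_).2 s hs
    by_contra hn
    simpa using hS ⟨hρ, hn⟩
  | insert ρ S _ ih =>
    intro hN
    have hρ : ρ ∈ nontrivialZeros := hN ρ (Finset.mem_insert_self _ _)
    have hρ1 := ne_one_of_mem_nontrivialZeros hρ
    have hNS : ∀ z ∈ S, z ∈ nontrivialZeros := fun z hz => hN z (Finset.mem_insert_of_mem hz)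
    suffices H : ∀ k r : ℕ, r + k = analyticOrderNatAt riemannZeta ρ → ∀ G ∈ spaceL, ∀ g : ℂ → ℂ,
        IsMeromorphicExtension G g → exceptionalZeros g ⊆ (insert ρ S : Finset ℂ) →
        (r : ℕ∞) ≤ analyticOrderAt g ρ → IsZetaCombination g by
      intro G hG g hg hS
      exact H _ 0 (zero_add _) G hG g hg hS (by simp)
    intro k
    induction k with
    | zero =>
      intro r hr G hG g hg hS hle
      refine ih hNS G hG g hg fun z hz => ?_
      have h1 := hS hz
      rw [Finset.coe_insert] at h1
      refine h1.resolve_left fun h2 => hz.2 ?_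
      rw [h2, ← cast_analyticOrderNatAt_riemannZeta hρ, ← hr]
      exact hle
    | succ k ihk =>
      intro r hr G hG g hg hS hle
      have hp : (ρ, k + 1) ∈ zeroIndex := ⟨hρ, by simp, by simp only; omega⟩
      obtain ⟨Q, hQ, hQe⟩ := exists_mem_spaceL_zetaQuotient hρ (k := k + 1) (by omega) (by omega)
      obtain ⟨a, ha⟩ := exists_add_one_le_analyticOrderAt (hg.analyticAt hρ1) (hQe.analyticAt hρ1)
        hle (analyticOrderAt_zetaQuotient_self hρ hr)
      refine IsZetaCombination.of_add_smul hp (a := a) ?_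
      refine ihk (r + 1) (by omega) _ (spaceL.add_mem hG (spaceL.smul_mem a hQ)) _
        (hg.add (hQe.smul a)) ?_ ha
      refine (exceptionalZeros_add_subset _ _).trans (Set.union_subset hS ?_)
      refine (exceptionalZeros_smul_zetaQuotient_subset a hp).trans ?_
      simp

/-- Linear combinations of the functions `ζ(s)/(s - ρ)^k` belong to `L` and have finitely many
exceptional zeros. -/
theorem exists_extension_of_isZetaCombination {g : ℂ → ℂ} (h : IsZetaCombination g) :
    (∃ G ∈ spaceL, IsMeromorphicExtension G g) ∧ (exceptionalZeros g).Finite := by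
  obtain ⟨c, hc⟩ := h
  suffices H : (∃ G ∈ spaceL, IsMeromorphicExtension G
      fun s => c.sum fun p a => a * zetaQuotient p.1.1 p.1.2 s) ∧
      (exceptionalZeros fun s => c.sum fun p a => a * zetaQuotient p.1.1 p.1.2 s).Finite by
    obtain ⟨⟨G, hG, hGe⟩, hfin⟩ := H
    exact ⟨⟨G, hG, hGe.congr hc⟩, by rwa [exceptionalZeros_congr hc]⟩
  clear hc
  induction c using Finsupp.induction_linear with
  | zero =>
    simp only [Finsupp.sum_zero_index]
    refine ⟨⟨0, spaceL.zero_mem, IsMeromorphicExtension.zero⟩, ?_⟩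
    refine Set.finite_empty.subset fun ρ hρ => hρ.2 ?_
    rw [analyticOrderAt_eq_top.2 (Eventually.of_forall fun z => rfl)]
    exact le_top
  | add c c' h h' =>
    obtain ⟨⟨G, hG, hGe⟩, hfin⟩ := h
    obtain ⟨⟨G', hG', hGe'⟩, hfin'⟩ := h'
    have e : (fun s => (c + c').sum fun p a => a * zetaQuotient p.1.1 p.1.2 s) =
        (fun s => c.sum fun p a => a * zetaQuotient p.1.1 p.1.2 s) +
          fun s => c'.sum fun p a => a * zetaQuotient p.1.1 p.1.2 s := by
      ext s
      rw [Finsupp.sum_add_index' (by simp) (by intros; ring), Pi.add_apply]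
    rw [e]
    exact ⟨⟨G + G', spaceL.add_mem hG hG', hGe.add hGe'⟩,
      (hfin.union hfin').subset (exceptionalZeros_add_subset _ _)⟩
  | single p a =>
    have e : (fun s => (Finsupp.single p a).sum fun p a => a * zetaQuotient p.1.1 p.1.2 s) =
        a • zetaQuotient p.1.1 p.1.2 := by
      ext s
      rw [Finsupp.sum_single_index (by simp)]
      rfl
    rw [e]
    obtain ⟨Q, hQ, hQe⟩ := exists_mem_spaceL_zetaQuotient p.2.1 p.2.2.1 p.2.2.2
    exact ⟨⟨a • Q, spaceL.smul_mem a hQ, hQe.smul a⟩,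
      (Set.finite_singleton _).subset (exceptionalZeros_smul_zetaQuotient_subset a p.2)⟩

theorem analyticOrderAt_riemannZeta_le_of_eq_mul {g h : ℂ → ℂ} (hh : Differentiable ℂ h)
    (hgh : ∀ s : ℂ, s ≠ 1 → g s = h s * riemannZeta s) {ρ : ℂ} (hρ : ρ ≠ 1) :
    analyticOrderAt riemannZeta ρ ≤ analyticOrderAt g ρ := by
  have e : g =ᶠ[𝓝 ρ] h * riemannZeta := by
    filter_upwards [isOpen_compl_singleton.mem_nhds hρ] with z hz
    exact hgh z hz
  rw [analyticOrderAt_congr e, analyticOrderAt_mul (hh.analyticAt ρ) (analyticAt_riemannZeta hρ)]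
  exact le_add_self

end BurnolZeta

open BurnolZeta
theorem mainTheorem3 :
    -- every element of `L` is the restriction of a meromorphic function
    (∀ G ∈ spaceL, ∃ g : ℂ → ℂ, IsMeromorphicExtension G g) ∧
    -- if `g ∈ L` and `g / ζ` is entire, then `g = 0`
    (∀ G ∈ spaceL, ∀ g : ℂ → ℂ, IsMeromorphicExtension G g →
      (∃ h : ℂ → ℂ, Differentiable ℂ h ∧ ∀ s : ℂ, s ≠ 1 → g s = h s * riemannZeta s) →
      G = 0 ∧ ∀ s : ℂ, s ≠ 1 → g s = 0) ∧
    -- the evaluators at the non-trivial zeros are represented by vectors of `L`,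
    -- and these vectors are complete in `L`
    (∃ Y : zeroIndex → spaceL,
      (∀ (p : zeroIndex) (G : spaceL) (g : ℂ → ℂ), IsMeromorphicExtension (G : CriticalLineL2) g →
        inner ℂ (Y p) G = iteratedDeriv (p.1.2 - 1) g p.1.1) ∧
      (Submodule.span ℂ (Set.range Y)).topologicalClosure = ⊤) ∧
    -- the functions in `L` vanishing with full multiplicities at all but finitely many zeros are
    -- exactly the finite linear combinations of the functions `ζ(s) / (s - ρ)^k`
    (∀ g : ℂ → ℂ,
      ((∃ G ∈ spaceL, IsMeromorphicExtension G g) ∧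
        {ρ ∈ nontrivialZeros | ¬ analyticOrderAt riemannZeta ρ ≤ analyticOrderAt g ρ}.Finite) ↔
      ∃ c : zeroIndex →₀ ℂ, ∀ s : ℂ, s ≠ 1 →
        g s = c.sum fun p a => a * zetaQuotient p.1.1 p.1.2 s) := by
  refine ⟨fun G hG => ?_, fun G hG g hg ⟨h, hh, hgh⟩ => ?_, ?_, fun g => ⟨?_, fun h => ?_⟩⟩
  · obtain ⟨p, hp, -, -⟩ := exists_cosinePair_of_mem_spaceL hG
    exact ⟨p.ext, hp⟩
  · exact eq_zero_of_analyticOrderAt_le hG hg fun ρ hρ =>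
      analyticOrderAt_riemannZeta_le_of_eq_mul hh hgh (ne_one_of_mem_nontrivialZeros hρ)
  · choose Y hY using fun p : zeroIndex =>
      exists_evaluator (ne_one_of_mem_nontrivialZeros p.2.1) (p.1.2 - 1)
    exact ⟨Y, hY, topologicalClosure_span_evaluators_eq_top hY⟩
  · rintro ⟨⟨G, hG, hg⟩, hfin⟩
    refine isZetaCombination_of_exceptionalZeros_subset hfin.toFinset (fun ρ hρ => ?_) G hG g hg
      (fun ρ hρ => ?_)
    · exact ((Set.Finite.mem_toFinset hfin).1 hρ).1
    · exact Finset.mem_coe.2 ((Set.Finite.mem_toFinset hfin).2 hρ)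
  · exact exists_extension_of_isZetaCombination h
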